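/- Let $\psi(x)=\tfrac12x^2+\delta\psi(x)$, where $\delta\psi\in C^2(\mathbf R)$ is bounded together with its first two derivatives, let $\varphi(m)=\sup_{\sigma\in\mathbf R}\{\sigma m-\log\int_{\mathbf R}e^{\sigma x-\psi(x)}dx\}$ be its Cramér transform, let $s\in\{1,-1\}$ and $T>0$. *Discrete objects.* Let $N=KM$. Let $X$ be the space of $x\in\mathbf R^N$ with $\sum_i x_i=0$ and scalar product $\sum_i x_i\tilde x_i$, and let $Y$ be the space of $y\in\mathbf R^M$ with $\sum_i y_i=0$ and scalar product $\langle y,\tilde y\rangle_Y=\frac1M\sum_i y_i\tilde y_i$. On $X$, with indices modulo $N$, let $(Ax)_i=N^2(2x_i-x_{i+1}-x_{i-1})$ and $(Jx)_i=\frac N2(x_{i+1}-x_{i-1})$. Let $P:X\to Y$, $(Px)_i=\frac1K\sum_{j=(i-1)K+1}^{iK}x_j$, with adjoint $P^t$. Put $\bar A^{-1}=PA^{-1}NP^t$ and $\bar J_s=\bar A\,PA^{-1}N(sJ)P^t$. Finally let $\bar H(y)=\frac1M\sum_{i=1}^M\psi_K(y_i)+\frac1N\log\bar Z$, where $\psi_K(m)=-\frac1K\log\int_{\{x\in\mathbf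 R^K:\ \frac1K\sum_i x_i=m\}}e^{-\sum_{j=1}^K\psi(x_j)}dx$ and $\bar Z$ is the constant that makes $e^{-N\bar H(y)}dy$ a probability measure on $Y$. *Functions on the torus.* To $y\in\mathbf R^M$ associate the step function $\bar y$ on $\mathbb T=\mathbf R/\mathbf Z$ with $\bar y(\theta)=y_i$ for $\theta\in[\frac{i-1}M,\frac iM)$. For $w\in L^2(\mathbb T)$ with average $0$ put $\|w\|_{H^{-1}}^2=\int_{\mathbb T}g^2d\theta$, where $g'=w$ and $\int_{\mathbb T}g\,d\theta=0$. Let $H^{-1}$ be the corresponding completion and $\langle\cdot,\cdot\rangle_{H^{-1}}$ its scalar product. *Weak solutions.* Let $\zeta_0\in L^2(\mathbb T)$. A weak solution on $[0,T]\times\mathbb T$ of $$\frac{\partial\zeta}{\partial t}=\frac{\partial^2}{\partial\theta^2}\varphi'(\zeta)-s\,\frac{\partial}{\partial\theta}\varphi'(\zeta),\qquad \zeta(0,\cdot)=\zeta_0, \qquad (*)$$ is a function $\zeta$ with $\zeta(t,\cdot)$ of average $0$ for almost every $t$, with $\zeta\in L^\infty_t(L^2_\theta)$, $\frac{\partial\zeta}{\partial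 t}\in L^2_t(H^{-1}_\theta)$ and $\varphi'(\zeta)\in L^2_t(L^2_\theta)$, such that for almost every $t\in[0,T]$ and all $g\in L^2(\mathbb T)$ with average $0$ $$\Big\langle g,\frac{\partial\zeta}{\partial t}\Big\rangle_{H^{-1}}=-\int_{\mathbb T}g\,\varphi'(\zeta)\,d\theta-s\int_{\mathbb T}G\,\varphi'(\zeta)\,d\theta,\qquad G'=g,\ \int_{\mathbb T}G\,d\theta=0,$$ and such that the version of $\zeta$ which is continuous in time with values in $H^{-1}$ equals $\zeta_0$ at $t=0$. **Proposition.** Let $M_\ell\to\infty$, $K_\ell\to\infty$ be sequences of positive integers and $N_\ell=K_\ell M_\ell$. Let $\eta^\ell:[0,T]\to Y_\ell$ solve $$\frac{d\eta^\ell}{dt}=-(\bar A+\bar J_s)\nabla_Y\bar H(\eta^\ell),$$ with initial data $\eta^\ell(0)$ such that $\|\bar\eta^\ell(0)-\zeta_0\|_{L^2}\to0$. Then $(*)$ has exactly one weak solution $\zeta$ (up to equality almost everywhere), and the step functions converge to it strongly in $L^\infty_t(H^{-1}_\theta)$: $$\operatorname*{ess\,sup}_{t\in[0,T]}\|\bar\eta^\ell(t)-\zeta(t,\cdot)\|_{H^{-1}}\longrightarrow0\qquad(\ell\to\infty).$$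 -/

import Mathlib

open MeasureTheory Filter Topology Set
open scoped ENNReal ContDiff InnerProductSpace

noncomputable section

namespace WeakKawasaki

/-! ### Spin spaces and operators -/

/-- The space of vectors of `ℝⁿ` with mean `0`. It carries the `ℓ²` scalar product and
the corresponding Lebesgue measure `volume`. It is both the microscopic space `X_{N,0}` (`n = N`)
and, as a vector space, the macroscopic space `Y_{M,0}` (`n = M`). -/
def meanZero (n : ℕ) : Submodule ℝ (EuclideanSpace ℝ (Fin n)) where
  carrier := {x | ∑ i, x i = 0}
  add_mem' := by
    intro a b ha hb
    simp only [mem_ofPred_eq, PiLp.add_apply, Finset.sum_add_distrib] at *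
    rw [ha, hb, add_zero]
  zero_mem' := by simp
  smul_mem' := by
    intro c x hx
    simp only [mem_ofPred_eq, PiLp.smul_apply, smul_eq_mul, ← Finset.mul_sum] at *
    rw [hx, mul_zero]

theorem mem_meanZero {n : ℕ} {x : EuclideanSpace ℝ (Fin n)} :
    x ∈ meanZero n ↔ ∑ i, x i = 0 := Iff.rfl

/-- The scalar product `⟨y, y'⟩_Y = (1/M) ∑ y_i y'_i` of the macroscopic space. -/
def innerY {M : ℕ} (y y' : meanZero M) : ℝ := (M : ℝ)⁻¹ * ∑ i, y.1 i * y'.1 i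

theorem innerY_eq {M : ℕ} (y y' : meanZero M) : innerY y y' = (M : ℝ)⁻¹ * ⟪y, y'⟫_ℝ := by
  simp [innerY, Submodule.coe_inner, PiLp.inner_apply, mul_comm]

/-- The discrete Laplacian `(A x)_i = N² (2 x_i - x_{i+1} - x_{i-1})`, indices modulo `N`. -/
def opA (N : ℕ) : Module.End ℝ (meanZero N) where
  toFun x := ⟨WithLp.toLp 2 fun i =>
      (N : ℝ) ^ 2 * (2 * x.1 i - x.1 (finRotate N i) - x.1 ((finRotate N).symm i)), by
    have h := mem_meanZero.1 x.2
    rw [mem_meanZero]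
    simp only [← Finset.mul_sum, Finset.sum_sub_distrib]
    rw [Equiv.sum_comp (finRotate N) (fun i => x.1 i),
      Equiv.sum_comp (finRotate N).symm (fun i => x.1 i), h]
    simp⟩
  map_add' x y := by ext i; simp; ring
  map_smul' c x := by ext i; simp; ring

/-- The discrete derivative `(J x)_i = (N/2) (x_{i+1} - x_{i-1})`, indices modulo `N`. -/
def opJ (N : ℕ) : Module.End ℝ (meanZero N) where
  toFun x := ⟨WithLp.toLp 2 fun i =>
      (N : ℝ) / 2 * (x.1 (finRotate N i) - x.1 ((finRotate N).symm i)), by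
    have h := mem_meanZero.1 x.2
    rw [mem_meanZero]
    simp only [← Finset.mul_sum, Finset.sum_sub_distrib]
    rw [Equiv.sum_comp (finRotate N) (fun i => x.1 i),
      Equiv.sum_comp (finRotate N).symm (fun i => x.1 i), h]
    simp⟩
  map_add' x y := by ext i; simp; ring
  map_smul' c x := by ext i; simp; ring

/-- The coarse-graining operator, for `N = M * K`: averages over `M` consecutive blocks of
length `K`. The block number `i` consists of the indices `finProdFinEquiv (i, r) = r + K * i`. -/
def opP (M K : ℕ) : meanZero (M * K) →ₗ[ℝ] meanZero M where
  toFun x := ⟨WithLp.toLp 2 fun i => (K : ℝ)⁻¹ * ∑ r : Fin K, x.1 (finProdFinEquiv (i, r)), by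
    have h := mem_meanZero.1 x.2
    rw [mem_meanZero]
    simp only [← Finset.mul_sum]
    rw [← Fintype.sum_prod_type (f := fun p : Fin M × Fin K => x.1 (finProdFinEquiv p)),
      Equiv.sum_comp finProdFinEquiv (fun i => x.1 i), h, mul_zero]⟩
  map_add' x y := by ext i; simp [Finset.sum_add_distrib]; ring
  map_smul' c x := by ext i; simp [← Finset.mul_sum]; ring

/-- The adjoint `Pᵗ` of `P`, for the `ℓ²` product on `X` and the product `innerY` on `Y`. Since
`innerY` is `1/M` times the `ℓ²` product, it is `1/M` times the `ℓ²` adjoint. -/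
def opPt (M K : ℕ) : meanZero M →ₗ[ℝ] meanZero (M * K) :=
  (M : ℝ)⁻¹ • LinearMap.adjoint (opP M K)

theorem innerY_opP (M K : ℕ) (x : meanZero (M * K)) (y : meanZero M) :
    innerY (opP M K x) y = ⟪x, opPt M K y⟫_ℝ := by
  rw [innerY_eq, opPt, LinearMap.smul_apply, inner_smul_right, LinearMap.adjoint_inner_right]

/-- `Ā⁻¹ = P A⁻¹ N Pᵗ`. -/
def macroAInv (M K : ℕ) : Module.End ℝ (meanZero M) :=
  ((M * K : ℕ) : ℝ) • (opP M K ∘ₗ Ring.inverse (opA (M * K)) ∘ₗ opPt M K)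

/-- `Ā`, the inverse of `P A⁻¹ N Pᵗ`. -/
def macroA (M K : ℕ) : Module.End ℝ (meanZero M) := Ring.inverse (macroAInv M K)

/-- `J̄ = Ā P A⁻¹ N J Pᵗ`, for the microscopic antisymmetric operator `s • J`. -/
def macroJ (s : ℝ) (M K : ℕ) : Module.End ℝ (meanZero M) :=
  macroA M K ∘ₗ (((M * K : ℕ) : ℝ) •
    (opP M K ∘ₗ Ring.inverse (opA (M * K)) ∘ₗ (s • opJ (M * K)) ∘ₗ opPt M K))

/-! The two inverses above are genuine inverses. -/

theorem inner_opA (N : ℕ) (x : meanZero N) :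
    ⟪opA N x, x⟫_ℝ = (N : ℝ) ^ 2 * ∑ i, (x.1 (finRotate N i) - x.1 i) ^ 2 := by
  have e1 : ∑ i, x.1 ((finRotate N).symm i) * x.1 i = ∑ i, x.1 i * x.1 (finRotate N i) := by
    rw [← Equiv.sum_comp (finRotate N)]
    exact Finset.sum_congr rfl fun i _ => by rw [Equiv.symm_apply_apply]
  have e2 : ∑ i, x.1 (finRotate N i) ^ 2 = ∑ i, x.1 i ^ 2 :=
    Equiv.sum_comp (finRotate N) (fun i => x.1 i ^ 2)
  have : ⟪opA N x, x⟫_ℝ = (N : ℝ) ^ 2 * ∑ i,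
      (2 * x.1 i ^ 2 - x.1 i * x.1 (finRotate N i) - x.1 ((finRotate N).symm i) * x.1 i) := by
    rw [Submodule.coe_inner, PiLp.inner_apply, Finset.mul_sum]
    refine Finset.sum_congr rfl fun i _ => ?_
    simp [opA]; ring
  rw [this]
  congr 1
  have e3 : ∑ i, (x.1 (finRotate N i) - x.1 i) ^ 2 =
      ∑ i, (x.1 (finRotate N i) ^ 2 + x.1 i ^ 2 - 2 * (x.1 i * x.1 (finRotate N i))) :=
    Finset.sum_congr rfl fun i _ => by ring
  rw [e3]
  simp only [Finset.sum_sub_distrib, Finset.sum_add_distrib, ← Finset.mul_sum]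
  rw [e1, e2]; ring

theorem eq_zero_of_inner_opA {N : ℕ} (x : meanZero N) (h : ⟪opA N x, x⟫_ℝ ≤ 0) : x = 0 := by
  rcases N with _ | n
  · ext i; exact i.elim0
  rw [inner_opA] at h
  have hs : ∑ i, (x.1 (finRotate (n + 1) i) - x.1 i) ^ 2 = 0 := by
    have h0 : 0 ≤ ∑ i, (x.1 (finRotate (n + 1) i) - x.1 i) ^ 2 :=
      Finset.sum_nonneg fun i _ => sq_nonneg _
    have hp : (0 : ℝ) < ((n + 1 : ℕ) : ℝ) ^ 2 := by positivity
    nlinarith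
  rw [Finset.sum_eq_zero_iff_of_nonneg fun i _ => sq_nonneg _] at hs
  have hc : ∀ i : Fin (n + 1), x.1 i = x.1 0 := by
    intro i
    induction i using Fin.induction with
    | zero => rfl
    | succ i ih =>
      have := hs i.castSucc (Finset.mem_univ _)
      rw [finRotate_apply, Fin.coeSucc_eq_succ] at this
      rw [← ih]
      exact sub_eq_zero.1 (pow_eq_zero_iff (two_ne_zero)|>.1 this)
  have hm := mem_meanZero.1 x.2
  simp only [hc] at hm
  have h0 : x.1 0 = 0 := by
    simp only [Finset.sum_const, Finset.card_univ, Fintype.card_fin, nsmul_eq_mul] at hm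
    rcases mul_eq_zero.1 hm with h | h
    · exact absurd h (by positivity)
    · exact h
  ext i
  simpa [h0] using hc i

theorem isUnit_of_ker {V : Type*} [AddCommGroup V] [Module ℝ V] [FiniteDimensional ℝ V]
    (f : Module.End ℝ V) (h : ∀ x, f x = 0 → x = 0) : IsUnit f :=
  (LinearMap.isUnit_iff_ker_eq_bot f).2 (LinearMap.ker_eq_bot'.2 h)

theorem isUnit_opA (N : ℕ) : IsUnit (opA N) :=
  isUnit_of_ker _ fun x hx => eq_zero_of_inner_opA x (by simp [hx])

theorem opP_opPt {M K : ℕ} (hM : 0 < M) (hK : 0 < K) (y : meanZero M) :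
    ((M * K : ℕ) : ℝ) • opP M K (opPt M K y) = y := by
  have hMr : (M : ℝ) ≠ 0 := by positivity
  have hKr : (K : ℝ) ≠ 0 := by positivity
  have hb : ∑ j : Fin (M * K), y.1 (finProdFinEquiv.symm j).1 = 0 := by
    rw [← Equiv.sum_comp finProdFinEquiv, Fintype.sum_prod_type]
    simp [← Finset.mul_sum, mem_meanZero.1 y.2]
  let z : meanZero (M * K) :=
    ⟨WithLp.toLp 2 fun j => ((M * K : ℕ) : ℝ)⁻¹ * y.1 (finProdFinEquiv.symm j).1, by
      rw [mem_meanZero]; simp only [← Finset.mul_sum, hb, mul_zero]⟩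
  have hz : opPt M K y = z := by
    refine ext_inner_left ℝ fun x => ?_
    rw [← innerY_opP, Submodule.coe_inner, PiLp.inner_apply, innerY,
      ← Equiv.sum_comp finProdFinEquiv, Fintype.sum_prod_type, Finset.mul_sum]
    refine Finset.sum_congr rfl fun i _ => ?_
    simp only [opP, z, LinearMap.coe_mk, AddHom.coe_mk, Equiv.symm_apply_apply]
    rw [Finset.mul_sum, Finset.sum_mul, Finset.mul_sum]
    refine Finset.sum_congr rfl fun r _ => ?_
    simp; ring
  rw [hz]
  ext i
  simp only [opP, z, LinearMap.coe_mk, AddHom.coe_mk, Submodule.coe_smul, PiLp.smul_apply,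
    Equiv.symm_apply_apply, Finset.sum_const, Finset.card_univ, Fintype.card_fin, nsmul_eq_mul,
    smul_eq_mul, Nat.cast_mul]
  field_simp

theorem isUnit_macroAInv {M K : ℕ} (hM : 0 < M) (hK : 0 < K) : IsUnit (macroAInv M K) := by
  refine isUnit_of_ker _ fun y hy => ?_
  have hN : ((M * K : ℕ) : ℝ) ≠ 0 := by
    have := Nat.mul_pos hM hK
    positivity
  have h1 : opP M K (Ring.inverse (opA (M * K)) (opPt M K y)) = 0 := by
    simpa [macroAInv, hM.ne', hK.ne'] using hy
  set u := Ring.inverse (opA (M * K)) (opPt M K y) with hu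
  have hA : opA (M * K) u = opPt M K y := by
    rw [hu, ← Module.End.mul_apply, Ring.mul_inverse_cancel _ (isUnit_opA _)]; rfl
  have h2 : u = 0 := by
    apply eq_zero_of_inner_opA
    rw [real_inner_comm, hA, ← innerY_opP, h1]
    simp [innerY]
  rw [← opP_opPt hM hK y, ← hA, h2]; simp

/-! ### Potentials and Hamiltonians -/

/-- The single-site potential `ψ(x) = x²/2 + δψ(x)`. -/
def potential (δψ : ℝ → ℝ) (x : ℝ) : ℝ := x ^ 2 / 2 + δψ x

/-- `ψ_K(m) = -(1/K) log ∫_{X_{K,m}} exp(-∑ ψ(x_i)) dx`. The affine hyperplane `X_{K,m}` of the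
vectors with mean `m` is `m + X_{K,0}`, with its `(K-1)`-dimensional Lebesgue measure. -/
def psiK (ψ : ℝ → ℝ) (K : ℕ) (m : ℝ) : ℝ :=
  -(K : ℝ)⁻¹ * Real.log (∫ x : meanZero K, Real.exp (-∑ i, ψ (m + x.1 i)))

/-- The normalising constant of the coarse-grained measure `exp(-N H̄(y)) dy`; recall `N / M = K`. -/
def macroZ (ψ : ℝ → ℝ) (M K : ℕ) : ℝ :=
  ∫ y : meanZero M, Real.exp (-(K : ℝ) * ∑ i, psiK ψ K (y.1 i))

/-- The coarse-grained Hamiltonian `H̄(y) = (1/M) ∑ ψ_K(y_i) + (1/N) log Z̄`. -/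
def macroH (ψ : ℝ → ℝ) (M K : ℕ) (y : meanZero M) : ℝ :=
  (M : ℝ)⁻¹ * ∑ i, psiK ψ K (y.1 i) + ((M * K : ℕ) : ℝ)⁻¹ * Real.log (macroZ ψ M K)

/-- The gradient with respect to the scalar product `innerY`; since this product is `1/M` times
the `ℓ²` product, it is `M` times the `ℓ²` gradient. -/
def gradY {M : ℕ} (F : meanZero M → ℝ) (y : meanZero M) : meanZero M :=
  (M : ℝ) • gradient F y

theorem innerY_gradY {M : ℕ} (hM : 0 < M) (F : meanZero M → ℝ) (y v : meanZero M) :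
    innerY (gradY F y) v = fderiv ℝ F y v := by
  have hMr : (M : ℝ) ≠ 0 := by positivity
  have h : ⟪(M : ℝ) • gradient F y, v⟫_ℝ = (M : ℝ) * ⟪gradient F y, v⟫_ℝ :=
    real_inner_smul_left (gradient F y).1 v.1 (M : ℝ)
  rw [innerY_eq, gradY, h, gradient, InnerProductSpace.toDual_symm_apply]
  field_simp

/-- The Cramér transform `φ(m) = sup_σ (σ m - log ∫ exp(σ x - ψ(x)) dx)`. -/
def cramer (ψ : ℝ → ℝ) (m : ℝ) : ℝ :=
  ⨆ σ : ℝ, (σ * m - Real.log (∫ x : ℝ, Real.exp (σ * x - ψ x)))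

/-! ### Functions on the torus

The torus `ℝ/ℤ` is represented by its fundamental domain `[0,1)`, with Lebesgue measure. -/

/-- Lebesgue measure on the torus. -/
def torusMeasure : Measure ℝ := volume.restrict (Ico 0 1)

/-- Lebesgue measure on `[0,T] × 𝕋`. -/
def spaceTime (T : ℝ) : Measure (ℝ × ℝ) := (volume.restrict (Icc 0 T)).prod torusMeasure

/-- The step function `x̄` with value `x_i` on `[(i-1)/n, i/n)`, `i = 1, …, n` (indices in `Fin n`
start from `0`). -/
def stepFun {n : ℕ} (x : EuclideanSpace ℝ (Fin n)) (θ : ℝ) : ℝ :=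
  ∑ i : Fin n, (Ico ((i : ℝ) / n) (((i : ℝ) + 1) / n)).indicator (fun _ => x i) θ

/-- `w ∈ L²(𝕋)` with average `0`. -/
def MemL20 (w : ℝ → ℝ) : Prop := MemLp w 2 torusMeasure ∧ ∫ θ, w θ ∂torusMeasure = 0

/-- The primitive of `w` with average `0`. It is periodic when `w` has average `0`. -/
def prim (w : ℝ → ℝ) (θ : ℝ) : ℝ :=
  (∫ s in (0 : ℝ)..θ, w s) - ∫ u in (0 : ℝ)..1, ∫ s in (0 : ℝ)..u, w s

/-- The norm `‖w‖_{H⁻¹} = (∫ g² dθ)^{1/2}`, where `g' = w` and `∫ g dθ = 0`. -/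
def hMinusNorm (w : ℝ → ℝ) : ℝ := Real.sqrt (∫ θ, prim w θ ^ 2 ∂torusMeasure)

/-! ### Weak solutions -/

/-- Test functions on `(0,T) × 𝕋`: smooth, `1`-periodic in `θ`, and vanishing for `t` outside of a
compact subset of `(0,T)`. -/
def IsTestFun (T : ℝ) (p : ℝ → ℝ → ℝ) : Prop :=
  ContDiff ℝ ∞ (fun q : ℝ × ℝ => p q.1 q.2) ∧ (∀ t θ, p t (θ + 1) = p t θ) ∧
    ∃ a b, 0 < a ∧ b < T ∧ ∀ t, t ∉ Icc a b → ∀ θ, p t θ = 0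

/-- The regularity `∂ζ/∂t ∈ L²_t(H⁻¹_θ)`, with `∂ζ/∂t = ∂V/∂θ` as distributions on `(0,T) × 𝕋`.
An element of `H⁻¹(𝕋)` is the derivative of exactly one `v ∈ L²(𝕋)` with average `0`, its norm is
`‖v‖_{L²}`, and `⟨g, v'⟩_{H⁻¹} = ∫ G v dθ` for `g ∈ L²(𝕋)` with average `0` and primitive `G`. -/
def HasTimeDeriv (T : ℝ) (ζ V : ℝ → ℝ → ℝ) : Prop :=
  MemLp (fun q : ℝ × ℝ => V q.1 q.2) 2 (spaceTime T) ∧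
  (∀ᵐ t ∂volume.restrict (Icc 0 T), MemL20 (V t)) ∧
  ∀ p : ℝ → ℝ → ℝ, IsTestFun T p →
    ∫ q, ζ q.1 q.2 * deriv (fun t => p t q.2) q.1 ∂spaceTime T =
      ∫ q, V q.1 q.2 * deriv (fun θ => p q.1 θ) q.2 ∂spaceTime T

/-- `ζ` is a weak solution on `[0,T] × 𝕋`, with initial condition `ζ₀`, of
`∂ζ/∂t = ∂²φ'(ζ)/∂θ² - s ∂φ'(ζ)/∂θ`. Since `ζ ∈ L^∞_t(L²_θ)` and `∂ζ/∂t ∈ L²_t(H⁻¹_θ)`, `ζ` is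
continuous in time with values in `H⁻¹`, up to modification on a null set of times; the initial
condition refers to this version. -/
structure IsWeakSolution (φ : ℝ → ℝ) (s T : ℝ) (ζ₀ : ℝ → ℝ) (ζ : ℝ → ℝ → ℝ) : Prop where
  measurable : AEStronglyMeasurable (fun q : ℝ × ℝ => ζ q.1 q.2) (spaceTime T)
  mean_zero : ∀ᵐ t ∂volume.restrict (Icc 0 T), MemL20 (ζ t)
  bounded : ∃ C : ℝ, ∀ᵐ t ∂volume.restrict (Icc 0 T), ∫ θ, ζ t θ ^ 2 ∂torusMeasure ≤ C
  memLp_flux : MemLp (fun q : ℝ × ℝ => deriv φ (ζ q.1 q.2)) 2 (spaceTime T)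
  weak_form : ∃ V : ℝ → ℝ → ℝ, HasTimeDeriv T ζ V ∧
    ∀ᵐ t ∂volume.restrict (Icc 0 T), ∀ g : ℝ → ℝ, MemL20 g →
      ∫ θ, prim g θ * V t θ ∂torusMeasure =
        -(∫ θ, g θ * deriv φ (ζ t θ) ∂torusMeasure)
          - s * ∫ θ, prim g θ * deriv φ (ζ t θ) ∂torusMeasure
  initial : ∀ ε > 0, ∃ δ > 0, ∀ᵐ t ∂volume.restrict (Icc 0 T), t < δ →
    hMinusNorm (fun θ => ζ t θ - ζ₀ θ) ≤ ε

end WeakKawasaki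

end

/-!
The limit equation is `∂ζ/∂t = ∂²Φ(ζ)/∂θ² - s ∂Φ(ζ)/∂θ` with `Φ = φ'`, where the function `Φ` is
strongly monotone and Lipschitz. Such an equation is a perturbed gradient flow in `H⁻¹`: two
solutions are compared by testing the equation of their difference with this difference itself.
Strong monotonicity controls the `L²` norm of the difference, the drift term is absorbed in it, and
Grönwall's inequality bounds the `H⁻¹` distance. The same computation applies to approximate
solutions (`ApproxSol`), which satisfy the weak formulation and the relation between density and
flux up to small errors: see `ApproxSol.stability`. It gives the uniqueness of weak solutions, and
it shows that approximate solutions with vanishing errors form a Cauchy sequence in `L²` and in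
`L^∞(H⁻¹)`. The limit is a weak solution (`exists_limit_approxSol`): the nonlinearity passes to the
limit by strong convergence, and the time derivatives by weak convergence in `L²(H⁻¹)`. In
particular, existence is obtained from the discrete dynamics. Three facts remain.

* Convergence of the potentials (`exists_cramer_bounds`). By the Holley–Stroock comparison with the
  Gaussian, the second derivative of `log ∫ exp (σ x - ψ x) dx` lies between two positive constants,
  so its Legendre transform `φ` has a strongly monotone Lipschitz derivative. Splitting `ℝᴷ` along
  the mean shows that the Laplace transform of `exp (-K ψ_K)` is the `K`-th power of that of
  `exp (-ψ)`, up to a constant factor. As `ψ_K` is semiconcave uniformly in `K`, Laplace's method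
  yields `|ψ_K' - φ'| ≤ D / √K` uniformly, without a local central limit theorem.

* The discrete dynamics are approximate solutions (`exists_approxSol_macro`). The primitive of a
  step function is piecewise affine, and the trapezoidal rule for products of affine functions has
  an explicit error. Therefore the quadratic form of `Ā⁻¹` is exactly the `H⁻¹` scalar product of
  step functions plus `(6N²)⁻¹` times their `L²` scalar product (`innerY_macroAInv`), and the drift
  is exact as well. Applying `Ā⁻¹` to the equation of motion gives the weak formulation, with flux
  `ψ_K'(η̄)`, for test functions which are step functions (`weak_form_macro`); replacing a general
  test function by its cell averages costs `O(M^{-1/2})`. The bounds on the velocity that enter the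
  errors come from the dissipation of the free energy (`energy_estimate`).

* Weak solutions and exact solutions in the sense of `ApproxSol` are the same
  (`ApproxSol.isWeakSolution`, `IsWeakSolution.exists_approxSol`). The latter satisfy the equation
  integrated in time; this is recovered from the distributional formulation by the lemma of
  du Bois-Reymond in time and the completeness of the trigonometric system in space.
-/

noncomputable section

namespace WeakKawasaki

/-! ### The single-site measure -/

open ProbabilityTheory in
/-- A second moment of the standard Gaussian density tilted by `exp (σ x)`, about any point. -/
theorem integral_sub_sq_mul_exp_gaussian (σ c : ℝ) :
    Integrable (fun x : ℝ => (x - c) ^ 2 * Real.exp (σ * x - x ^ 2 / 2)) ∧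
    ∫ x : ℝ, (x - c) ^ 2 * Real.exp (σ * x - x ^ 2 / 2) =
      (1 + (σ - c) ^ 2) * ∫ x : ℝ, Real.exp (σ * x - x ^ 2 / 2) := by
  have hpdf : ∀ x : ℝ, Real.exp (σ * x - x ^ 2 / 2) =
      (√(2 * Real.pi) * Real.exp (σ ^ 2 / 2)) * gaussianPDFReal σ 1 x := by
    intro x
    have h2 : √(2 * Real.pi) ≠ 0 := by positivity
    simp only [gaussianPDFReal, NNReal.coe_one, mul_one]
    rw [mul_assoc, mul_left_comm (Real.exp _), ← mul_assoc, mul_inv_cancel₀ h2, one_mul,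
      ← Real.exp_add]
    congr 1; ring
  have hm : MemLp (fun x : ℝ => x - c) 2 (gaussianReal σ 1) :=
    (memLp_id_gaussianReal' 2 (by simp)).sub (memLp_const c)
  have hi := hm.integrable_sq
  have hv : ∫ x, (x - c) ^ 2 ∂gaussianReal σ 1 = 1 + (σ - c) ^ 2 := by
    have h1 := variance_eq_sub hm
    have h2 : Var[fun x : ℝ => x - c; gaussianReal σ 1] = 1 := by
      rw [variance_sub_const (by fun_prop)]
      simp
    have h3 : ∫ x, (x - c) ∂gaussianReal σ 1 = σ - c := by
      rw [integral_sub (f := fun x : ℝ => x)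
        ((memLp_id_gaussianReal' (μ := σ) (v := 1) 1 (by simp)).integrable (by simp))
        (integrable_const c), integral_id_gaussianReal]
      simp
    rw [h2] at h1
    simp only [Pi.pow_apply] at h1
    rw [h3] at h1; linarith
  have hone : (1 : NNReal) ≠ 0 := one_ne_zero
  rw [integral_gaussianReal_eq_integral_smul hone] at hv
  rw [gaussianReal_of_var_ne_zero _ hone, integrable_withDensity_iff_integrable_smul₀'
    (by fun_prop) (by simp [gaussianPDF])] at hi
  simp only [toReal_gaussianPDF, smul_eq_mul] at hi hv
  simp only [hpdf]
  constructor
  · refine (hi.const_mul (√(2 * Real.pi) * Real.exp (σ ^ 2 / 2))).congr (ae_of_all _ fun x => ?_)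
    simp only; ring
  · rw [integral_const_mul, integral_gaussianPDFReal_eq_one σ hone, mul_one, ← hv,
      ← integral_mul_const]
    exact integral_congr_ae (ae_of_all _ fun x => by simp only; ring)

theorem integrable_exp_gaussian (σ : ℝ) :
    Integrable (fun x : ℝ => Real.exp (σ * x - x ^ 2 / 2)) := by
  have h := (integrable_exp_neg_mul_sq (b := 1 / 2) (by norm_num)).comp_sub_right σ
  refine (h.const_mul (Real.exp (σ ^ 2 / 2))).congr (ae_of_all _ fun x => ?_)
  simp only
  rw [← Real.exp_add]; congr 1; ring

/-- The weight `exp (σ x - ψ x)` is comparable to the Gaussian one when `δψ` is bounded. -/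
theorem exp_potential_le {δψ : ℝ → ℝ} {B : ℝ} (hB : ∀ x, |δψ x| ≤ B) (σ x : ℝ) :
    Real.exp (σ * x - potential δψ x) ≤ Real.exp B * Real.exp (σ * x - x ^ 2 / 2) := by
  rw [← Real.exp_add, Real.exp_le_exp, potential]
  have := (abs_le.1 (hB x)).1; linarith

theorem le_exp_potential {δψ : ℝ → ℝ} {B : ℝ} (hB : ∀ x, |δψ x| ≤ B) (σ x : ℝ) :
    Real.exp (-B) * Real.exp (σ * x - x ^ 2 / 2) ≤ Real.exp (σ * x - potential δψ x) := by
  rw [← Real.exp_add, Real.exp_le_exp, potential]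
  have := (abs_le.1 (hB x)).2; linarith

theorem integrable_exp_potential {δψ : ℝ → ℝ} (hc : Continuous δψ) {B : ℝ}
    (hB : ∀ x, |δψ x| ≤ B) (σ : ℝ) :
    Integrable (fun x : ℝ => Real.exp (σ * x - potential δψ x)) := by
  refine ((integrable_exp_gaussian σ).const_mul (Real.exp B)).mono'
    (Continuous.aestronglyMeasurable (by unfold potential; fun_prop)) (ae_of_all _ fun x => ?_)
  rw [Real.norm_of_nonneg (Real.exp_pos _).le]
  exact exp_potential_le hB σ x

theorem integral_exp_potential_pos {δψ : ℝ → ℝ} (hc : Continuous δψ) {B : ℝ}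
    (hB : ∀ x, |δψ x| ≤ B) (σ : ℝ) : 0 < ∫ x : ℝ, Real.exp (σ * x - potential δψ x) :=
  integral_exp_pos (integrable_exp_potential hc hB σ)

/-- The logarithm of the partition function `log ∫ exp (σ x - ψ x) dx`, whose Legendre transform
is the Cramér transform of `ψ`. -/
def logZ (ψ : ℝ → ℝ) (σ : ℝ) : ℝ := Real.log (∫ x : ℝ, Real.exp (σ * x - ψ x))

/-- The single-site measure `exp (-ψ x) dx`. -/
def siteMeasure (ψ : ℝ → ℝ) : Measure ℝ :=
  volume.withDensity fun x => ENNReal.ofReal (Real.exp (-ψ x))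

open ProbabilityTheory

theorem integral_siteMeasure {δψ : ℝ → ℝ} (hc : Continuous δψ) (f : ℝ → ℝ) :
    ∫ x, f x ∂siteMeasure (potential δψ) = ∫ x, Real.exp (-potential δψ x) * f x := by
  rw [siteMeasure, integral_withDensity_eq_integral_toReal_smul₀ (by unfold potential; fun_prop)
    (by simp)]
  simp [Real.exp_nonneg]

theorem integrable_siteMeasure {δψ : ℝ → ℝ} (hc : Continuous δψ) (f : ℝ → ℝ) :
    Integrable f (siteMeasure (potential δψ)) ↔
      Integrable (fun x => Real.exp (-potential δψ x) * f x) := by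
  rw [siteMeasure, integrable_withDensity_iff_integrable_smul₀' (by unfold potential; fun_prop)
    (by simp)]
  simp [Real.exp_nonneg]

/-- Mathlib's theory of cumulant generating functions applies to `logZ`. -/
theorem cgf_siteMeasure {δψ : ℝ → ℝ} (hc : Continuous δψ) :
    cgf id (siteMeasure (potential δψ)) = logZ (potential δψ) := by
  ext σ
  rw [cgf, mgf, integral_siteMeasure hc, logZ]
  congr 1
  refine integral_congr_ae (ae_of_all _ fun x => ?_)
  simp only [id]; rw [← Real.exp_add]; congr 1; ring

theorem integrableExpSet_siteMeasure {δψ : ℝ → ℝ} (hc : Continuous δψ) {B : ℝ}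
    (hB : ∀ x, |δψ x| ≤ B) :
    integrableExpSet id (siteMeasure (potential δψ)) = univ := by
  ext σ
  simp only [integrableExpSet, mem_univ, iff_true, mem_ofPred_eq]
  rw [integrable_siteMeasure hc]
  refine (integrable_exp_potential hc hB σ).congr (ae_of_all _ fun x => ?_)
  simp only [id]; rw [← Real.exp_add]; congr 1; ring

/-- By the Holley–Stroock comparison with the Gaussian, the variance of the single-site measure is
bounded above and below uniformly in the tilt: so `logZ` is uniformly convex and `C^{1,1}`. -/
theorem iteratedDeriv_two_logZ {δψ : ℝ → ℝ} (hc : Continuous δψ) {B : ℝ}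
    (hB : ∀ x, |δψ x| ≤ B) (σ : ℝ) :
    Real.exp (-(2 * B)) ≤ iteratedDeriv 2 (logZ (potential δψ)) σ ∧
    iteratedDeriv 2 (logZ (potential δψ)) σ ≤ Real.exp (2 * B) := by
  set ψ := potential δψ with hψ
  have hmem : σ ∈ interior (integrableExpSet id (siteMeasure ψ)) := by
    rw [integrableExpSet_siteMeasure hc hB]; simp
  have hZ : ∀ c, mgf id (siteMeasure ψ) c = ∫ x : ℝ, Real.exp (c * x - ψ x) := by
    intro c
    rw [mgf, integral_siteMeasure hc]
    refine integral_congr_ae (ae_of_all _ fun x => ?_)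
    simp only [id]; rw [← Real.exp_add]; congr 1; ring
  have hZpos := integral_exp_potential_pos hc hB σ
  have h1 := iteratedDeriv_two_cgf_eq_integral hmem
  have h2 := deriv_cgf hmem
  rw [cgf_siteMeasure hc, hZ, integral_siteMeasure hc] at h1
  rw [cgf_siteMeasure hc, hZ, integral_siteMeasure hc] at h2
  rw [← hψ] at h1 h2 hZpos
  set m := deriv (logZ ψ) σ with hm
  have e : ∀ (p : ℝ → ℝ) x, Real.exp (-ψ x) * (p x * Real.exp (σ * id x)) =
      p x * Real.exp (σ * x - ψ x) := by
    intro p x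
    rw [mul_left_comm, ← Real.exp_add]; simp only [id]; congr 2; ring
  have e2 := fun x => e (fun x => (id x - m) ^ 2) x
  simp only [e2] at h1
  have e3 := fun x => e id x
  simp only [e3] at h2
  simp only [id] at h2
  simp only [id] at h1
  set Z := ∫ x : ℝ, Real.exp (σ * x - ψ x) with hZd
  set G := ∫ x : ℝ, Real.exp (σ * x - x ^ 2 / 2) with hG
  have hGpos : 0 < G := integral_exp_pos (integrable_exp_gaussian σ)
  have hq : ∀ c, Integrable (fun x => (x - c) ^ 2 * Real.exp (σ * x - ψ x)) := by
    intro c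
    refine ((integral_sub_sq_mul_exp_gaussian σ c).1.const_mul (Real.exp B)).mono'
      (Continuous.aestronglyMeasurable (by rw [hψ]; unfold potential; fun_prop))
      (ae_of_all _ fun x => ?_)
    rw [Real.norm_of_nonneg (by positivity), mul_left_comm]
    exact mul_le_mul_of_nonneg_left (exp_potential_le hB σ x) (sq_nonneg _)
  have hZG1 : Z ≤ Real.exp B * G := by
    rw [hZd, hG, ← integral_const_mul]
    exact integral_mono (integrable_exp_potential hc hB σ)
      ((integrable_exp_gaussian σ).const_mul _) fun x => exp_potential_le hB σ x
  have hZG2 : Real.exp (-B) * G ≤ Z := by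
    rw [hZd, hG, ← integral_const_mul]
    exact integral_mono ((integrable_exp_gaussian σ).const_mul _)
      (integrable_exp_potential hc hB σ) fun x => le_exp_potential hB σ x
  have hee : Real.exp (2 * B) = Real.exp B * Real.exp B := by rw [← Real.exp_add]; congr 1; ring
  have hee' : Real.exp (-(2 * B)) = Real.exp (-B) * Real.exp (-B) := by
    rw [← Real.exp_add]; congr 1; ring
  have hinv : Real.exp B * Real.exp (-B) = 1 := by rw [← Real.exp_add]; simp
  rw [h1]
  constructor
  · rw [le_div_iff₀ hZpos]
    -- the normalised second moment of the tilted Gaussian about `m` is `1 + (σ - m)² ≥ 1`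
    calc Real.exp (-(2 * B)) * Z ≤ Real.exp (-(2 * B)) * (Real.exp B * G) := by gcongr
      _ = Real.exp (-B) * ((Real.exp B * Real.exp (-B)) * G) := by rw [hee']; ring
      _ ≤ Real.exp (-B) * ((1 + (σ - m) ^ 2) * G) := by
          rw [hinv]
          gcongr
          nlinarith [sq_nonneg (σ - m)]
      _ ≤ _ := by
          rw [← (integral_sub_sq_mul_exp_gaussian σ m).2, ← integral_const_mul]
          refine integral_mono ((integral_sub_sq_mul_exp_gaussian σ m).1.const_mul _) (hq m)
            fun x => ?_
          simp only
          rw [mul_left_comm]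
          exact mul_le_mul_of_nonneg_left (le_exp_potential hB σ x) (sq_nonneg _)
  · rw [div_le_iff₀ hZpos]
    have hxi : Integrable (fun x => x * Real.exp (σ * x - ψ x)) := by
      have h := ((hq 0).sub (hq 1)).add (integrable_exp_potential hc hB σ)
      refine (h.div_const 2).congr (ae_of_all _ fun x => ?_)
      simp only [Pi.add_apply, Pi.sub_apply, hψ]; ring
    -- the mean minimises the second moment
    have hmin : ∫ x, (x - m) ^ 2 * Real.exp (σ * x - ψ x) ≤
        ∫ x, (x - σ) ^ 2 * Real.exp (σ * x - ψ x) := by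
      have h3 : ∫ x, (x - σ) ^ 2 * Real.exp (σ * x - ψ x) =
          (∫ x, (x - m) ^ 2 * Real.exp (σ * x - ψ x)) +
            (2 * (m - σ) * ∫ x, x * Real.exp (σ * x - ψ x)) + (σ ^ 2 - m ^ 2) * Z := by
        have hi1 := (hxi.const_mul (2 * (m - σ)))
        have hi2 := (integrable_exp_potential hc hB σ).const_mul (σ ^ 2 - m ^ 2)
        rw [hZd, ← integral_const_mul, ← integral_const_mul, ← integral_add (hq m) hi1]
        refine Eq.trans ?_ (integral_add ((hq m).add hi1) hi2)
        refine integral_congr_ae (ae_of_all _ fun x => ?_)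
        ring
      have h4 : ∫ x, x * Real.exp (σ * x - ψ x) = m * Z := by
        rw [eq_div_iff hZpos.ne'] at h2
        exact h2.symm
      rw [h3, h4]
      nlinarith [mul_nonneg (sq_nonneg (m - σ)) hZpos.le]
    calc _ ≤ _ := hmin
      _ ≤ ∫ x, Real.exp B * ((x - σ) ^ 2 * Real.exp (σ * x - x ^ 2 / 2)) := by
          refine integral_mono (hq σ) ((integral_sub_sq_mul_exp_gaussian σ σ).1.const_mul _)
            fun x => ?_
          simp only
          rw [mul_left_comm]
          exact mul_le_mul_of_nonneg_left (exp_potential_le hB σ x) (sq_nonneg _)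
      _ = Real.exp B * G := by
          rw [integral_const_mul, (integral_sub_sq_mul_exp_gaussian σ σ).2]; simp [hG]
      _ = Real.exp (2 * B) * (Real.exp (-B) * G) := by
          rw [hee, mul_assoc, ← mul_assoc (Real.exp B) (Real.exp (-B)), hinv, one_mul]
      _ ≤ _ := by gcongr

theorem contDiff_logZ {δψ : ℝ → ℝ} (hc : Continuous δψ) {B : ℝ} (hB : ∀ x, |δψ x| ≤ B) :
    ContDiff ℝ 2 (logZ (potential δψ)) := by
  have h := analyticOnNhd_cgf (X := id) (μ := siteMeasure (potential δψ))
  rw [integrableExpSet_siteMeasure hc hB, cgf_siteMeasure hc, interior_univ] at h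
  exact h.contDiff

/-! ### Legendre transforms of uniformly convex functions -/

/-- A differentiable function with monotone derivative lies above its tangents. -/
theorem tangent_le_of_monotone {g g' : ℝ → ℝ} (hg : ∀ x, HasDerivAt g (g' x) x)
    (hmono : Monotone g') (x y : ℝ) : g x + g' x * (y - x) ≤ g y := by
  have hc : Continuous g := continuous_iff_continuousAt.2 fun x => (hg x).continuousAt
  rcases lt_trichotomy x y with h | h | h
  · obtain ⟨c, hc1, hc2⟩ := exists_hasDerivAt_eq_slope g g' h hc.continuousOn fun z _ => hg z
    have := hmono hc1.1.le
    rw [eq_div_iff (by linarith)] at hc2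
    nlinarith
  · subst h; simp
  · obtain ⟨c, hc1, hc2⟩ := exists_hasDerivAt_eq_slope g g' h hc.continuousOn fun z _ => hg z
    have := hmono hc1.2.le
    rw [eq_div_iff (by linarith)] at hc2
    nlinarith

/-- Bounds on the second derivative, as monotonicity of the first derivative up to linear terms. -/
theorem monotone_deriv_of_iteratedDeriv_two_bounds {L : ℝ → ℝ} (hL : ContDiff ℝ 2 L) {a b : ℝ}
    (h : ∀ σ, a ≤ iteratedDeriv 2 L σ ∧ iteratedDeriv 2 L σ ≤ b) :
    Monotone (fun σ => deriv L σ - a * σ) ∧ Monotone (fun σ => b * σ - deriv L σ) := by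
  have hd : Differentiable ℝ (deriv L) := by
    have : ContDiff ℝ 1 (deriv L) := by
      have h2 : ContDiff ℝ (1 + 1) L := by simpa [one_add_one_eq_two] using hL
      exact (contDiff_succ_iff_deriv.1 h2).2.2
    exact this.differentiable (by simp)
  have hi : ∀ σ, iteratedDeriv 2 L σ = deriv (deriv L) σ := by
    intro σ; rw [iteratedDeriv_succ, iteratedDeriv_one]
  simp only [hi] at h
  have hx : ∀ (c σ : ℝ), HasDerivAt (fun x => c * x) c σ := fun c σ => by
    simpa using (hasDerivAt_id σ).const_mul c
  constructor
  · refine monotone_of_deriv_nonneg (hd.sub (by fun_prop)) fun σ => ?_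
    rw [((hd σ).hasDerivAt.fun_sub (hx a σ)).deriv]; linarith [(h σ).1]
  · refine monotone_of_deriv_nonneg (Differentiable.sub (by fun_prop) hd) fun σ => ?_
    rw [((hx b σ).fun_sub (hd σ).hasDerivAt).deriv]; linarith [(h σ).2]

/-- Legendre transform of a uniformly convex `C^{1,1}` function `L`: it is differentiable, its
derivative is the inverse of that of `L`, hence Lipschitz and strongly monotone. -/
theorem legendre_of_uniformly_convex {L : ℝ → ℝ} (hL : ContDiff ℝ 2 L) {a b : ℝ} (ha : 0 < a)
    (h : ∀ σ, a ≤ iteratedDeriv 2 L σ ∧ iteratedDeriv 2 L σ ≤ b)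
    {φ : ℝ → ℝ} (hφ : φ = fun m => ⨆ σ : ℝ, (σ * m - L σ)) :
    (∀ m σ, σ * m - L σ ≤ φ m) ∧
    (∀ m, ∃ σ, deriv L σ = m ∧ φ m = σ * m - L σ ∧ HasDerivAt φ σ m) ∧
    (∀ σ h, L (σ + h) ≤ L σ + deriv L σ * h + b / 2 * h ^ 2) ∧
    (∀ x y, b⁻¹ * (x - y) ^ 2 ≤ (deriv φ x - deriv φ y) * (x - y)) ∧
    (∀ x y, |deriv φ x - deriv φ y| ≤ a⁻¹ * |x - y|) := by
  obtain ⟨hm1, hm2⟩ := monotone_deriv_of_iteratedDeriv_two_bounds hL h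
  have hab : a ≤ b := (h 0).1.trans (h 0).2
  have hb : 0 < b := ha.trans_le hab
  have hLd : ∀ σ, HasDerivAt L (deriv L σ) σ := fun σ =>
    (hL.differentiable (by simp) σ).hasDerivAt
  have hq : ∀ (c σ : ℝ), HasDerivAt (fun x : ℝ => c / 2 * x ^ 2) (c * σ) σ := fun c σ => by
    exact ((hasDerivAt_pow 2 σ).const_mul (c / 2)).congr_deriv (by norm_num; ring)
  have hlow : ∀ σ h, L σ + deriv L σ * h + a / 2 * h ^ 2 ≤ L (σ + h) := by
    intro σ h
    have := tangent_le_of_monotone (fun σ => (hLd σ).fun_sub (hq a σ)) hm1 σ (σ + h)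
    nlinarith
  have hup : ∀ σ h, L (σ + h) ≤ L σ + deriv L σ * h + b / 2 * h ^ 2 := by
    intro σ h
    have := tangent_le_of_monotone (fun σ => (hq b σ).fun_sub (hLd σ)) hm2 σ (σ + h)
    nlinarith
  have hle : ∀ σ τ, τ * deriv L σ - L τ ≤ σ * deriv L σ - L σ := by
    intro σ τ
    have := hlow σ (τ - σ)
    rw [add_sub_cancel] at this
    nlinarith [sq_nonneg (τ - σ)]
  have hval : ∀ σ, φ (deriv L σ) = σ * deriv L σ - L σ := by
    intro σ
    rw [hφ]
    exact le_antisymm (ciSup_le (hle σ))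
      (le_ciSup (f := fun τ => τ * deriv L σ - L τ) ⟨_, forall_mem_range.2 (hle σ)⟩ σ)
  have hcont : Continuous (deriv L) := hL.continuous_deriv (by simp)
  have hsurj : Function.Surjective (deriv L) := by
    have ht : Tendsto (fun σ => a * σ + deriv L 0) atTop atTop :=
      tendsto_atTop_add_const_right _ _ (tendsto_id.const_mul_atTop ha)
    have hb' : Tendsto (fun σ => a * σ + deriv L 0) atBot atBot :=
      tendsto_atBot_add_const_right _ _ (tendsto_id.const_mul_atBot ha)
    refine hcont.surjective (tendsto_atTop_mono' _ ?_ ht) (tendsto_atBot_mono' _ ?_ hb')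
    · filter_upwards [eventually_ge_atTop 0] with σ hσ
      have := hm1 hσ; simp only at this; linarith
    · filter_upwards [eventually_le_atBot 0] with σ hσ
      have := hm1 hσ; simp only at this; linarith
  have hineq : ∀ m σ, σ * m - L σ ≤ φ m := by
    intro m σ
    obtain ⟨τ, rfl⟩ := hsurj m
    rw [hval]; exact hle τ σ
  -- quantitative strict monotonicity of the derivative
  have hmon : ∀ σ τ, a * (σ - τ) ^ 2 ≤ (deriv L σ - deriv L τ) * (σ - τ) ∧
      a * |σ - τ| ≤ |deriv L σ - deriv L τ| ∧ |deriv L σ - deriv L τ| ≤ b * |σ - τ| ∧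
      (deriv L σ - deriv L τ) ^ 2 ≤ b * ((deriv L σ - deriv L τ) * (σ - τ)) := by
    have key : ∀ σ τ, τ ≤ σ → a * (σ - τ) ≤ deriv L σ - deriv L τ ∧
        deriv L σ - deriv L τ ≤ b * (σ - τ) := by
      intro σ τ hle
      have h1 := hm1 hle
      have h2 := hm2 hle
      simp only at h1 h2
      constructor <;> linarith
    intro σ τ
    rcases le_total τ σ with hle | hle
    · obtain ⟨h1, h2⟩ := key σ τ hle
      have h0 : 0 ≤ σ - τ := by linarith
      have h3 : 0 ≤ deriv L σ - deriv L τ := by nlinarith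
      rw [abs_of_nonneg h0, abs_of_nonneg h3]
      refine ⟨by nlinarith, h1, h2, by nlinarith⟩
    · obtain ⟨h1, h2⟩ := key τ σ hle
      have h0 : 0 ≤ τ - σ := by linarith
      have h3 : 0 ≤ deriv L τ - deriv L σ := by nlinarith
      rw [abs_sub_comm σ, abs_sub_comm (deriv L σ), abs_of_nonneg h0, abs_of_nonneg h3]
      refine ⟨by nlinarith, h1, h2, by nlinarith⟩
  have hder : ∀ σ, HasDerivAt φ σ (deriv L σ) := by
    intro σ
    rw [hasDerivAt_iff_isLittleO, Asymptotics.isLittleO_iff]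
    intro c hc
    have : ∀ᶠ x in 𝓝 (deriv L σ), |x - deriv L σ| < a * c := by
      have := Metric.ball_mem_nhds (deriv L σ) (mul_pos ha hc)
      filter_upwards [this] with x hx using by simpa [Real.dist_eq] using hx
    filter_upwards [this] with x hx
    obtain ⟨τ, rfl⟩ := hsurj x
    have h1 := hineq (deriv L τ) σ
    have h2 := hineq (deriv L σ) τ
    rw [hval] at h1 h2 ⊢
    rw [hval, Real.norm_eq_abs, Real.norm_eq_abs, smul_eq_mul]
    have h3 := (hmon τ σ).2.1
    have h4 : |τ - σ| ≤ c := by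
      have : a * |τ - σ| ≤ a * c := h3.trans hx.le
      exact le_of_mul_le_mul_left this ha
    have h5 : |(τ - σ) * (deriv L τ - deriv L σ)| ≤ c * |deriv L τ - deriv L σ| := by
      rw [abs_mul]; gcongr
    have h6 := (abs_le.1 h5).2
    rw [abs_le]
    constructor
    · have : 0 ≤ c * |deriv L τ - deriv L σ| := by positivity
      nlinarith
    · nlinarith
  refine ⟨hineq, fun m => ?_, hup, fun x y => ?_, fun x y => ?_⟩
  · obtain ⟨σ, rfl⟩ := hsurj m
    exact ⟨σ, rfl, hval σ, hder σ⟩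
  · obtain ⟨σ, rfl⟩ := hsurj x
    obtain ⟨τ, rfl⟩ := hsurj y
    rw [(hder σ).deriv, (hder τ).deriv, inv_mul_le_iff₀ hb]
    linarith [(hmon σ τ).2.2.2]
  · obtain ⟨σ, rfl⟩ := hsurj x
    obtain ⟨τ, rfl⟩ := hsurj y
    rw [(hder σ).deriv, (hder τ).deriv, le_inv_mul_iff₀ ha]
    exact (hmon σ τ).2.1

/-! ### Coarse-grained potentials -/

/-- Properties of a free energy `f m = -log ∫ exp (-U m x) dρ x`, when `U` is bounded, with a
bounded first derivative `V` in `m`, and satisfies a second-order upper bound: by Jensen's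
inequality this bound passes to `f`. -/
theorem freeEnergy_properties {Ω : Type*} [MeasurableSpace Ω] (ρ : Measure Ω) [IsFiniteMeasure ρ]
    [NeZero ρ] (U V : ℝ → Ω → ℝ) (hUm : ∀ m, Measurable (U m)) (hVm : ∀ m, Measurable (V m))
    (hd : ∀ m x, HasDerivAt (fun m => U m x) (V m x) m) (hVc : ∀ x, Continuous fun m => V m x)
    {A A' c : ℝ} (hA : ∀ m x, |U m x| ≤ A) (hA' : ∀ m x, |V m x| ≤ A')
    (hT : ∀ m h x, U (m + h) x ≤ U m x + V m x * h + c / 2 * h ^ 2) :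
    ∃ f' : ℝ → ℝ, Continuous f' ∧
      (∀ m, HasDerivAt (fun m => -Real.log (∫ x, Real.exp (-U m x) ∂ρ)) (f' m) m) ∧
      (∀ m, |f' m| ≤ A') ∧
      (∀ m h, -Real.log (∫ x, Real.exp (-U (m + h) x) ∂ρ) ≤
        -Real.log (∫ x, Real.exp (-U m x) ∂ρ) + f' m * h + c / 2 * h ^ 2) ∧
      (∀ m, |-Real.log (∫ x, Real.exp (-U m x) ∂ρ) + Real.log (ρ.real univ)| ≤ A) ∧
      (∀ m, 0 < ∫ x, Real.exp (-U m x) ∂ρ) := by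
  have hexp : ∀ m x, Real.exp (-U m x) ≤ Real.exp A := fun m x =>
    Real.exp_le_exp.2 (by linarith [(abs_le.1 (hA m x)).1])
  have hexp' : ∀ m x, Real.exp (-A) ≤ Real.exp (-U m x) := fun m x =>
    Real.exp_le_exp.2 (by linarith [(abs_le.1 (hA m x)).2])
  have hEm : ∀ m, Measurable fun x => Real.exp (-U m x) := fun m =>
    Real.measurable_exp.comp (hUm m).neg
  have hEi : ∀ m, Integrable (fun x => Real.exp (-U m x)) ρ := fun m =>
    Integrable.of_bound (hEm m).aestronglyMeasurable (Real.exp A) (ae_of_all _ fun x => by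
      rw [Real.norm_of_nonneg (Real.exp_pos _).le]; exact hexp m x)
  have hVb : ∀ m x, ‖V m x * Real.exp (-U m x)‖ ≤ A' * Real.exp A := fun m x => by
    have := (abs_nonneg _).trans (hA' m x)
    rw [norm_mul, Real.norm_eq_abs, Real.norm_of_nonneg (Real.exp_pos _).le]
    exact mul_le_mul (hA' m x) (hexp m x) (Real.exp_pos _).le this
  have hVi : ∀ m, Integrable (fun x => V m x * Real.exp (-U m x)) ρ := fun m =>
    Integrable.of_bound ((hVm m).mul (hEm m)).aestronglyMeasurable _ (ae_of_all _ (hVb m))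
  set D : ℝ → ℝ := fun m => ∫ x, Real.exp (-U m x) ∂ρ with hD
  have hDpos : ∀ m, 0 < D m := fun m => integral_exp_pos (hEi m)
  have hUc : ∀ x, Continuous fun m => U m x := fun x =>
    continuous_iff_continuousAt.2 fun m => (hd m x).continuousAt
  have hDd : ∀ m, HasDerivAt D (-∫ x, V m x * Real.exp (-U m x) ∂ρ) m := by
    intro m
    have := (hasDerivAt_integral_of_dominated_loc_of_deriv_le (μ := ρ) (s := univ)
      (F := fun m x => Real.exp (-U m x)) (F' := fun m x => -(V m x * Real.exp (-U m x)))
      (bound := fun _ => A' * Real.exp A) (x₀ := m) univ_mem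
      (Eventually.of_forall fun m => (hEm m).aestronglyMeasurable) (hEi m)
      (hVi m).aestronglyMeasurable.neg (ae_of_all _ fun x m _ => by rw [norm_neg]; exact hVb m x)
      (integrable_const _) (ae_of_all _ fun x m _ => by
        have := (hd m x).neg.exp
        exact this.congr_deriv (by simp; ring))).2
    rwa [integral_neg] at this
  have hDc : Continuous D := continuous_iff_continuousAt.2 fun m => (hDd m).continuousAt
  have hNc : Continuous fun m => ∫ x, V m x * Real.exp (-U m x) ∂ρ :=
    continuous_of_dominated (fun m => (hVi m).aestronglyMeasurable)
      (bound := fun _ => A' * Real.exp A) (fun m => ae_of_all _ (hVb m)) (integrable_const _)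
      (ae_of_all _ fun x => (hVc x).mul (Real.continuous_exp.comp (hUc x).neg))
  set N : ℝ → ℝ := fun m => ∫ x, V m x * Real.exp (-U m x) ∂ρ with hN
  refine ⟨fun m => N m / D m, hNc.div hDc fun m => (hDpos m).ne', fun m => ?_, fun m => ?_,
    fun m h => ?_, fun m => ?_, hDpos⟩
  · exact ((hDd m).log (hDpos m).ne').neg.congr_deriv (by simp only [hN]; ring)
  · rw [abs_div, abs_of_pos (hDpos m), div_le_iff₀ (hDpos m), hD, ← integral_const_mul]
    refine (abs_integral_le_integral_abs).trans (integral_mono (hVi m).abs ((hEi m).const_mul _)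
      fun x => ?_)
    simp only [abs_mul, Real.abs_exp]
    exact mul_le_mul_of_nonneg_right (hA' m x) (Real.exp_pos _).le
  · set a := N m / D m with ha
    have hkey : Real.exp (-(a * h + c / 2 * h ^ 2)) * D m ≤ D (m + h) := by
      have h1 : ∀ x, Real.exp (-(a * h + c / 2 * h ^ 2)) *
          ((1 + a * h) * Real.exp (-U m x) - h * (V m x * Real.exp (-U m x))) ≤
            Real.exp (-U (m + h) x) := by
        intro x
        have e1 : Real.exp (-(U m x + V m x * h + c / 2 * h ^ 2)) ≤ Real.exp (-U (m + h) x) :=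
          Real.exp_le_exp.2 (by linarith [hT m h x])
        refine le_trans ?_ e1
        have e2 := Real.add_one_le_exp (-(V m x - a) * h)
        have e3 : Real.exp (-(U m x + V m x * h + c / 2 * h ^ 2)) =
            Real.exp (-(a * h + c / 2 * h ^ 2)) * Real.exp (-U m x) *
              Real.exp (-(V m x - a) * h) := by
          rw [← Real.exp_add, ← Real.exp_add]; congr 1; ring
        rw [e3]
        have e4 : 0 ≤ Real.exp (-(a * h + c / 2 * h ^ 2)) * Real.exp (-U m x) := by positivity
        nlinarith [mul_le_mul_of_nonneg_left e2 e4]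
      have h2 := integral_mono ((((hEi m).const_mul (1 + a * h)).sub
        ((hVi m).const_mul h)).const_mul (Real.exp (-(a * h + c / 2 * h ^ 2)))) (hEi (m + h)) h1
      simp only [Pi.sub_apply] at h2
      rw [integral_const_mul, integral_sub ((hEi m).const_mul (1 + a * h))
        ((hVi m).const_mul h), integral_const_mul, integral_const_mul] at h2
      have h3 : (1 + a * h) * D m - h * N m = D m := by
        have : N m = a * D m := by rw [ha]; field_simp [(hDpos m).ne']
        rw [this]; ring
      change _ * ((1 + a * h) * D m - h * N m) ≤ D (m + h) at h2
      rwa [h3] at h2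
    have h4 := Real.log_le_log (by have := hDpos m; positivity) hkey
    rw [Real.log_mul (Real.exp_pos _).ne' (hDpos m).ne', Real.log_exp] at h4
    linarith
  · have hρ : 0 < ρ.real univ := by
      rw [measureReal_def, ENNReal.toReal_pos_iff]
      exact ⟨(Measure.measure_univ_pos.2 (NeZero.ne ρ)), measure_lt_top _ _⟩
    have h1 : D m ≤ Real.exp A * ρ.real univ := by
      have := integral_mono (hEi m) (integrable_const (Real.exp A)) (hexp m)
      simpa [mul_comm] using this
    have h2 : Real.exp (-A) * ρ.real univ ≤ D m := by
      have := integral_mono (integrable_const (Real.exp (-A))) (hEi m) (hexp' m)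
      simpa [mul_comm] using this
    have h3 := Real.log_le_log (hDpos m) h1
    have h4 := Real.log_le_log (by positivity) h2
    rw [Real.log_mul (Real.exp_pos _).ne' hρ.ne', Real.log_exp] at h3 h4
    rw [abs_le]
    constructor <;> linarith

theorem exp_neg_normSq_integrable (n : ℕ) :
    Integrable fun x : meanZero n => Real.exp (-(1 / 2) * ‖x‖ ^ 2) := by
  by_contra h
  have h1 := GaussianFourier.integral_rexp_neg_mul_sq_norm (V := meanZero n) (b := 1 / 2)
    (by norm_num)
  rw [integral_undef h] at h1
  have : 0 < (Real.pi / (1 / 2)) ^ (Module.finrank ℝ (meanZero n) / 2 : ℝ) := by positivity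
  linarith

/-- The standard Gaussian weight on the hyperplane of vectors of mean `0` (not normalised). -/
def gaussMeanZero (n : ℕ) : Measure (meanZero n) :=
  volume.withDensity fun x => ENNReal.ofReal (Real.exp (-(1 / 2) * ‖x‖ ^ 2))

instance (n : ℕ) : IsFiniteMeasure (gaussMeanZero n) :=
  isFiniteMeasure_withDensity_ofReal (exp_neg_normSq_integrable n).2

theorem integral_gaussMeanZero (n : ℕ) (f : meanZero n → ℝ) :
    ∫ x, f x ∂gaussMeanZero n = ∫ x, Real.exp (-(1 / 2) * ‖x‖ ^ 2) * f x := by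
  rw [gaussMeanZero, integral_withDensity_eq_integral_toReal_smul₀ (by fun_prop) (by simp)]
  simp [Real.exp_nonneg]

instance (n : ℕ) : NeZero (gaussMeanZero n) := by
  refine ⟨fun h => ?_⟩
  have h1 := integral_gaussMeanZero n (fun _ => 1)
  rw [h] at h1
  simp only [integral_zero_measure, mul_one] at h1
  exact (integral_exp_pos (exp_neg_normSq_integrable n)).ne h1

theorem normSq_meanZero {n : ℕ} (x : meanZero n) : ‖x‖ ^ 2 = ∑ i, x.1 i ^ 2 := by
  rw [Submodule.coe_norm, EuclideanSpace.norm_sq_eq]; simp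

/-- A bound on the second derivative gives a second-order upper bound. -/
theorem le_taylor_two {f : ℝ → ℝ} (hf : ContDiff ℝ 2 f) {B : ℝ}
    (hB : ∀ x, |iteratedDeriv 2 f x| ≤ B) (y h : ℝ) :
    f (y + h) ≤ f y + deriv f y * h + B / 2 * h ^ 2 := by
  have hm := (monotone_deriv_of_iteratedDeriv_two_bounds hf fun x => abs_le.1 (hB x)).2
  have hq : ∀ σ, HasDerivAt (fun x : ℝ => B / 2 * x ^ 2) (B * σ) σ := fun σ =>
    ((hasDerivAt_pow 2 σ).const_mul (B / 2)).congr_deriv (by norm_num; ring)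
  have := tangent_le_of_monotone
    (fun σ => (hq σ).fun_sub (hf.differentiable (by simp) σ).hasDerivAt) hm y (y + h)
  nlinarith

/-- The coarse-grained potential `psiK` is `m²/2` plus a perturbation which is bounded, up to an
additive constant, has a bounded derivative, and is semiconcave, uniformly in `K`. -/
theorem psiK_properties {δψ : ℝ → ℝ} (hδ : ContDiff ℝ 2 δψ) {B : ℝ}
    (hB : ∀ x, |δψ x| ≤ B ∧ |deriv δψ x| ≤ B ∧ |iteratedDeriv 2 δψ x| ≤ B) {K : ℕ} (hK : 0 < K) :
    (∀ m, HasDerivAt (psiK (potential δψ) K) (deriv (psiK (potential δψ) K) m) m) ∧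
    Continuous (deriv (psiK (potential δψ) K)) ∧
    (∀ m, |deriv (psiK (potential δψ) K) m - m| ≤ B) ∧
    (∀ m h, psiK (potential δψ) K (m + h) ≤ psiK (potential δψ) K m +
      deriv (psiK (potential δψ) K) m * h + (1 + B) / 2 * h ^ 2) ∧
    (∃ c, ∀ m, |psiK (potential δψ) K m - m ^ 2 / 2 - c| ≤ B) ∧
    (∀ m, Real.exp (-(K : ℝ) * psiK (potential δψ) K m) =
      ∫ x : meanZero K, Real.exp (-∑ i, potential δψ (m + x.1 i))) := by
  have hKr : (0 : ℝ) < K := by exact_mod_cast hK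
  set U : ℝ → meanZero K → ℝ := fun m x => ∑ i, δψ (m + x.1 i) with hU
  set V : ℝ → meanZero K → ℝ := fun m x => ∑ i, deriv δψ (m + x.1 i) with hV
  have hδd : ∀ x, HasDerivAt δψ (deriv δψ x) x := fun x =>
    (hδ.differentiable (by simp) x).hasDerivAt
  have hdc : Continuous (deriv δψ) := hδ.continuous_deriv (by simp)
  have hδc : Continuous δψ := hδ.continuous
  have hsum : ∀ f : Fin K → ℝ, (∀ i, |f i| ≤ B) → |∑ i, f i| ≤ K * B := by
    intro f hf
    refine (Finset.abs_sum_le_sum_abs _ _).trans ((Finset.sum_le_sum fun i _ => hf i).trans ?_)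
    simp
  obtain ⟨f', hf'c, hf'd, hf'b, hf'T, hf'A, hpos⟩ := freeEnergy_properties (gaussMeanZero K) U V
    (fun m => by
      simp only [hU]
      exact Continuous.measurable (by fun_prop))
    (fun m => by
      simp only [hV]
      exact Continuous.measurable (by fun_prop))
    (fun m x => by
      simp only [hU, hV]
      exact HasDerivAt.fun_sum fun i _ => (hδd _).comp_add_const m (x.1 i))
    (fun x => by simp only [hV]; fun_prop)
    (A := K * B) (A' := K * B) (c := K * B) (fun m x => hsum _ fun i => (hB _).1)
    (fun m x => hsum _ fun i => (hB _).2.1) (fun m h x => by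
      simp only [hU, hV]
      calc ∑ i, δψ (m + h + x.1 i)
          ≤ ∑ i, (δψ (m + x.1 i) + deriv δψ (m + x.1 i) * h + B / 2 * h ^ 2) := by
            refine Finset.sum_le_sum fun i _ => ?_
            rw [add_right_comm]
            exact le_taylor_two hδ (fun x => (hB x).2.2) _ h
        _ = _ := by
            rw [Finset.sum_add_distrib, Finset.sum_add_distrib, Finset.sum_mul]
            simp; ring)
  set F : ℝ → ℝ := fun m => -Real.log (∫ x, Real.exp (-U m x) ∂gaussMeanZero K) with hF
  have hint : ∀ m, ∫ x : meanZero K, Real.exp (-∑ i, potential δψ (m + x.1 i)) =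
      Real.exp (-(K : ℝ) * (m ^ 2 / 2)) * ∫ x, Real.exp (-U m x) ∂gaussMeanZero K := by
    intro m
    rw [integral_gaussMeanZero, ← integral_const_mul]
    refine integral_congr_ae (ae_of_all _ fun x => ?_)
    simp only
    rw [← Real.exp_add, ← Real.exp_add, normSq_meanZero]
    congr 1
    have h1 : ∀ i, potential δψ (m + x.1 i) =
        m ^ 2 / 2 + m * x.1 i + 1 / 2 * x.1 i ^ 2 + δψ (m + x.1 i) := fun i => by
      rw [potential]; ring
    simp only [h1, Finset.sum_add_distrib, ← Finset.mul_sum, mem_meanZero.1 x.2, hU]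
    simp; ring
  have hpsi : ∀ m, psiK (potential δψ) K m = m ^ 2 / 2 + (K : ℝ)⁻¹ * F m := by
    intro m
    rw [psiK, hint, Real.log_mul (Real.exp_pos _).ne' (hpos m).ne', Real.log_exp, hF]
    field_simp
    ring
  have hd : ∀ m, HasDerivAt (psiK (potential δψ) K) (m + (K : ℝ)⁻¹ * f' m) m := by
    intro m
    have h1 : psiK (potential δψ) K = fun m => m ^ 2 / 2 + (K : ℝ)⁻¹ * F m := funext hpsi
    rw [h1]
    exact (((hasDerivAt_pow 2 m).div_const 2).add ((hf'd m).const_mul _)).congr_deriv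
      (by norm_num)
  have hd' : deriv (psiK (potential δψ) K) = fun m => m + (K : ℝ)⁻¹ * f' m :=
    funext fun m => (hd m).deriv
  refine ⟨fun m => ?_, ?_, fun m => ?_, fun m h => ?_,
    ⟨(K : ℝ)⁻¹ * -Real.log ((gaussMeanZero K).real univ), fun m => ?_⟩, fun m => ?_⟩
  · rw [hd']; exact hd m
  · rw [hd']; fun_prop
  · rw [hd']
    simp only [add_sub_cancel_left]
    rw [abs_mul, abs_of_pos (inv_pos.2 hKr), inv_mul_le_iff₀ hKr]
    exact hf'b m
  · rw [hd', hpsi, hpsi]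
    have := mul_le_mul_of_nonneg_left (hf'T m h) (inv_pos.2 hKr).le
    have e : (K : ℝ)⁻¹ * (F m + f' m * h + K * B / 2 * h ^ 2) =
        (K : ℝ)⁻¹ * F m + (K : ℝ)⁻¹ * f' m * h + B / 2 * h ^ 2 := by field_simp
    have h3 : (K : ℝ)⁻¹ * F (m + h) ≤ (K : ℝ)⁻¹ * F m + (K : ℝ)⁻¹ * f' m * h + B / 2 * h ^ 2 := by
      rw [← e]; exact this
    nlinarith
  · rw [hpsi]
    have e : m ^ 2 / 2 + (K : ℝ)⁻¹ * F m - m ^ 2 / 2 -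
        (K : ℝ)⁻¹ * -Real.log ((gaussMeanZero K).real univ) =
        (K : ℝ)⁻¹ * (F m + Real.log ((gaussMeanZero K).real univ)) := by ring
    rw [e, abs_mul, abs_of_pos (inv_pos.2 hKr), inv_mul_le_iff₀ hKr]
    exact hf'A m
  · rw [hint, hpsi]
    have e : -(K : ℝ) * (m ^ 2 / 2 + (K : ℝ)⁻¹ * F m) = -(K : ℝ) * (m ^ 2 / 2) - F m := by
      field_simp; ring
    rw [e, sub_eq_add_neg, Real.exp_add, hF]
    simp only [neg_neg]
    rw [Real.exp_log (hpos m)]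

/-- The decomposition of a vector of `ℝⁿ` into its mean and a vector of mean `0`. -/
def meanDecomposition {n : ℕ} (hn : 0 < n) :
    (ℝ × meanZero n) ≃ₗ[ℝ] EuclideanSpace ℝ (Fin n) where
  toFun p := WithLp.toLp 2 fun i => p.1 + p.2.1 i
  map_add' p q := by ext i; simp; ring
  map_smul' c p := by ext i; simp; ring
  invFun y := ((n : ℝ)⁻¹ * ∑ i, y i, ⟨WithLp.toLp 2 fun i => y i - (n : ℝ)⁻¹ * ∑ j, y j, by
    have : (n : ℝ) ≠ 0 := by positivity
    rw [mem_meanZero]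
    simp only [Finset.sum_sub_distrib, Finset.sum_const, Finset.card_univ, Fintype.card_fin,
      nsmul_eq_mul]
    field_simp; simp⟩)
  left_inv p := by
    have hn' : (n : ℝ) ≠ 0 := by positivity
    have h : (n : ℝ)⁻¹ * ∑ i, (p.1 + p.2.1 i) = p.1 := by
      rw [Finset.sum_add_distrib, mem_meanZero.1 p.2.2]
      simp [hn']
    ext i
    · simpa using h
    · simp [h]
  right_inv y := by ext i; simp

/-- Decomposing Lebesgue measure of `ℝᴷ` along the mean: the Laplace transform of
`exp (-K ψ_K)` is, up to a constant factor, the `K`-th power of that of `exp (-ψ)`. -/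
theorem exists_exp_logZ_eq {δψ : ℝ → ℝ} (hδ : ContDiff ℝ 2 δψ) {B : ℝ}
    (hB : ∀ x, |δψ x| ≤ B ∧ |deriv δψ x| ≤ B ∧ |iteratedDeriv 2 δψ x| ≤ B) {K : ℕ} (hK : 0 < K) :
    ∃ a : ℝ, 0 < a ∧ ∀ σ : ℝ,
      Integrable (fun m => Real.exp (K * (σ * m - psiK (potential δψ) K m))) ∧
      Real.exp (K * logZ (potential δψ) σ) =
        a * ∫ m, Real.exp (K * (σ * m - psiK (potential δψ) K m)) := by
  set ψ := potential δψ with hψ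
  set L := (meanDecomposition hK).toContinuousLinearEquiv with hL
  have hLm : Measurable L := L.continuous.measurable
  set ρ : Measure (ℝ × meanZero K) := (volume : Measure ℝ).prod volume with hρ
  have : (ρ.map L).IsAddHaarMeasure := L.isAddHaarMeasure_map ρ
  set c := Measure.addHaarScalarFactor (volume : Measure (EuclideanSpace ℝ (Fin K)))
    (ρ.map L) with hc
  have hcpos : 0 < c := Measure.addHaarScalarFactor_pos_of_isAddHaarMeasure _ _
  have hvol : (volume : Measure (EuclideanSpace ℝ (Fin K))) =
      c • ρ.map L :=
    Measure.isAddLeftInvariant_eq_smul _ _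
  refine ⟨c, by exact_mod_cast hcpos, fun σ => ?_⟩
  have hi1 := integrable_exp_potential hδ.continuous (fun x => (hB x).1) σ
  set F : EuclideanSpace ℝ (Fin K) → ℝ := fun x => ∏ i, Real.exp (σ * x i - ψ (x i)) with hF
  have hFi : Integrable F := by
    have := Integrable.fintype_prod (ι := Fin K) (μ := fun _ => (volume : Measure ℝ))
      (f := fun _ x => Real.exp (σ * x - ψ x)) (fun _ => hi1)
    rw [← volume_pi] at this
    exact ((PiLp.volume_preserving_ofLp (Fin K)).integrable_comp_emb
      (MeasurableEquiv.toLp 2 _).symm.measurableEmbedding).2 this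
  have hFint : ∫ x, F x = Real.exp (K * logZ ψ σ) := by
    have := integral_fintype_prod_volume_eq_pow (ι := Fin K) (fun x : ℝ => Real.exp (σ * x - ψ x))
    rw [← (PiLp.volume_preserving_ofLp (Fin K)).integral_comp
      (MeasurableEquiv.toLp 2 _).symm.measurableEmbedding] at this
    refine this.trans ?_
    rw [Fintype.card_fin, mul_comm, Real.exp_mul, logZ,
      Real.exp_log (integral_exp_potential_pos hδ.continuous (fun x => (hB x).1) σ),
      Real.rpow_natCast]
  have hFL : Integrable (fun p => F (L p)) ρ := by
    rw [hvol] at hFi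
    have h2 := (integrable_smul_measure (c := (c : ℝ≥0∞)) (by exact_mod_cast hcpos.ne')
      (by simp)).1 hFi
    exact (integrable_map_measure h2.aestronglyMeasurable hLm.aemeasurable).1 h2
  have hFLint : ∫ x, F x = c * ∫ p, F (L p) ∂ρ := by
    rw [hvol, integral_smul_nnreal_measure, integral_map hLm.aemeasurable
      (Continuous.aestronglyMeasurable (by
        have := hδ.continuous
        simp only [hF, hψ, potential]; fun_prop))]
    rfl
  have hval : ∀ (m : ℝ) (x : meanZero K), F (L (m, x)) =
      Real.exp (K * (σ * m)) * Real.exp (-∑ i, ψ (m + x.1 i)) := by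
    intro m x
    simp only [hF]
    rw [← Real.exp_sum, ← Real.exp_add]
    congr 1
    have : ∀ i, (L (m, x)) i = m + x.1 i := fun i => rfl
    simp only [this, Finset.sum_sub_distrib, mul_add, Finset.sum_add_distrib, ← Finset.mul_sum,
      mem_meanZero.1 x.2]
    simp; ring
  have hin : ∀ m, ∫ x : meanZero K, F (L (m, x)) = Real.exp (K * (σ * m - psiK ψ K m)) := by
    intro m
    simp only [hval]
    rw [integral_const_mul, ← (psiK_properties hδ hB hK).2.2.2.2.2 m, ← Real.exp_add]
    congr 1; ring
  constructor
  · have := hFL.integral_prod_left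
    simpa only [hin] using this
  · rw [← hFint, hFLint]
    congr 1
    rw [integral_prod _ hFL]
    simp only [hin]

/-! ### Convergence of the coarse-grained potentials -/

/-- Abstract form of the convergence `ψ_K → φ`: if the Laplace transform of `exp (-K g)` is
`a⁻¹ exp (K L)`, with `g` and `L` semiconcave and `φ` the Legendre transform of `L`, then `g - φ` is
bounded below by a constant `b`, and within distance `O(K^{-1/2})` of every point there is one where
`g - φ` exceeds `b` by at most `C / K`. In the statement `k` stands for `K`. -/
theorem laplace_bounds {g g' L L' φ : ℝ → ℝ} {k a Λ β : ℝ} (hk : 0 < k) (ha : 0 < a) (hΛ : 0 < Λ)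
    (hβ : 0 < β)
    (hg : ∀ m h, g (m + h) ≤ g m + g' m * h + Λ / 2 * h ^ 2)
    (hL : ∀ σ h, L (σ + h) ≤ L σ + L' σ * h + β / 2 * h ^ 2)
    (hi : ∀ σ, Integrable (fun m => Real.exp (k * (σ * m - g m))))
    (hI : ∀ σ, Real.exp (k * L σ) = a * ∫ m, Real.exp (k * (σ * m - g m)))
    (hφ : ∀ m σ, σ * m - L σ ≤ φ m)
    (hφ' : ∀ m, ∃ σ, L' σ = m ∧ φ m = σ * m - L σ) :
    ∃ b C : ℝ, (C = Real.log 4 + 2 * β + 1 + Λ / 2) ∧ (∀ m, φ m + b ≤ g m) ∧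
      (∀ m, ∃ m', |m' - m| ≤ (2 * β + 1) / √k ∧ g m' ≤ φ m' + b + C / k) := by
  have hsk : 0 < √k := Real.sqrt_pos.2 hk
  have hsq : √k * √k = k := Real.mul_self_sqrt hk.le
  refine ⟨k⁻¹ * (Real.log (a / √k) - Λ / 2), _, rfl, fun m => ?_, fun m => ?_⟩
  -- Lower bound: with `σ` the slope dual to `m`, the Laplace transform at `σ` is at least the
  -- contribution of an interval of length `1 / √k` with end point `m`.
  · obtain ⟨σ, hσ, hval⟩ := hφ' m
    set I := ∫ m, Real.exp (k * (σ * m - g m)) with hId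
    have hlow : Real.exp (k * (σ * m - g m) - Λ / 2) * (√k)⁻¹ ≤ I := by
      -- on one of the two sides of `m` the first order term of the exponent has the good sign
      have hpt : ∀ h : ℝ, |h| ≤ (√k)⁻¹ → 0 ≤ (σ - g' m) * h →
          Real.exp (k * (σ * m - g m) - Λ / 2) ≤ Real.exp (k * (σ * (m + h) - g (m + h))) := by
        intro h h1 h2
        rw [Real.exp_le_exp]
        have h3 : k * h ^ 2 ≤ 1 := by
          have : h ^ 2 ≤ ((√k)⁻¹) ^ 2 := sq_le_sq' (by linarith [(abs_le.1 h1).1]) (abs_le.1 h1).2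
          have e : k * ((√k)⁻¹) ^ 2 = 1 := by
            field_simp; rw [Real.sq_sqrt hk.le]
          calc k * h ^ 2 ≤ k * ((√k)⁻¹) ^ 2 := by gcongr
            _ = 1 := e
        have h4 := mul_le_mul_of_nonneg_left (hg m h) hk.le
        have h5 := mul_nonneg hk.le h2
        nlinarith [mul_le_mul_of_nonneg_left h3 hΛ.le]
      have hvol : ∀ u v : ℝ, v - u = (√k)⁻¹ → (∀ x ∈ Icc u v,
          Real.exp (k * (σ * m - g m) - Λ / 2) ≤ Real.exp (k * (σ * x - g x))) →
          Real.exp (k * (σ * m - g m) - Λ / 2) * (√k)⁻¹ ≤ I := by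
        intro u v huv hx
        have h1 : ∫ _ in Icc u v, Real.exp (k * (σ * m - g m) - Λ / 2) ≤
            ∫ x in Icc u v, Real.exp (k * (σ * x - g x)) :=
          setIntegral_mono_on (by simp) (hi σ).integrableOn measurableSet_Icc hx
        have h2 : ∫ x in Icc u v, Real.exp (k * (σ * x - g x)) ≤ I :=
          setIntegral_le_integral (hi σ) (ae_of_all _ fun x => (Real.exp_pos _).le)
        have hpos : 0 ≤ v - u := by rw [huv]; positivity
        simp only [integral_const, measureReal_restrict_apply_univ, Real.volume_real_Icc,
          max_eq_left hpos, smul_eq_mul] at h1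
        rw [← huv]; linarith
      rcases le_total 0 (σ - g' m) with hs | hs
      · refine hvol m (m + (√k)⁻¹) (by ring) fun x hx => ?_
        have := hpt (x - m) (by rw [abs_of_nonneg (by linarith [hx.1])]; linarith [hx.2])
          (mul_nonneg hs (by linarith [hx.1]))
        rwa [add_sub_cancel] at this
      · refine hvol (m - (√k)⁻¹) m (by ring) fun x hx => ?_
        have := hpt (x - m) (by rw [abs_of_nonpos (by linarith [hx.2])]; linarith [hx.1])
          (mul_nonneg_of_nonpos_of_nonpos hs (by linarith [hx.2]))
        rwa [add_sub_cancel] at this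
    have h1 : Real.exp (k * (σ * m - g m) - Λ / 2) * (a / √k) ≤ Real.exp (k * L σ) := by
      rw [hI σ]
      calc _ = a * (Real.exp (k * (σ * m - g m) - Λ / 2) * (√k)⁻¹) := by ring
        _ ≤ _ := by gcongr
    have h2 := Real.log_le_log (by positivity) h1
    rw [Real.log_mul (Real.exp_pos _).ne' (by positivity), Real.log_exp, Real.log_exp] at h2
    have h3 : k⁻¹ * (k * (σ * m - g m) - Λ / 2 + Real.log (a / √k)) ≤ k⁻¹ * (k * L σ) := by gcongr
    have e1 : k⁻¹ * (k * L σ) = L σ := by field_simp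
    have e2 : k⁻¹ * (k * (σ * m - g m) - Λ / 2 + Real.log (a / √k)) =
      σ * m - g m + k⁻¹ * (Real.log (a / √k) - Λ / 2) := by field_simp; ring
    rw [e1, e2] at h3
    rw [hval]; linarith
  -- Upper bound: the mass of the density `exp (k (σ x - g x))` cannot be outside of the ball of
  -- radius `r` about `m`. If `g - φ` were larger than `b + C / k` on this ball, its part of the
  -- total mass would be at most `exp (-1) / 2`, and that of each tail at most `exp (-1)`; these
  -- numbers add up to less than `1`.
  · obtain ⟨σ, hσ, hval⟩ := hφ' m
    set r := (2 * β + 1) / √k with hr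
    have hrpos : 0 < r := by positivity
    by_contra! hcon
    set C := Real.log 4 + 2 * β + 1 + Λ / 2 with hC
    set b := k⁻¹ * (Real.log (a / √k) - Λ / 2) with hb
    set X := Real.exp (k * (L σ - b - C / k)) with hX
    have hball : ∀ x, |x - m| ≤ r → Real.exp (k * (σ * x - g x)) ≤ X := by
      intro x hx
      rw [hX, Real.exp_le_exp]
      refine mul_le_mul_of_nonneg_left ?_ hk.le
      linarith [hcon x hx, hφ x σ]
    set h := 1 / √k with hh
    -- Chernoff bound outside of the ball of radius `r`
    have hpt : ∀ x, Real.exp (k * (σ * x - g x)) ≤ (Icc (m - r) (m + r)).indicator (fun _ => X) x +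
        (Real.exp (-(k * h * (m + r))) * Real.exp (k * ((σ + h) * x - g x)) +
          Real.exp (k * h * (m - r)) * Real.exp (k * ((σ - h) * x - g x))) := by
      intro x
      by_cases hx : x ∈ Icc (m - r) (m + r)
      · rw [indicator_of_mem hx]
        have := hball x (by rw [abs_le]; constructor <;> linarith [hx.1, hx.2])
        have : 0 ≤ Real.exp (-(k * h * (m + r))) * Real.exp (k * ((σ + h) * x - g x)) +
          Real.exp (k * h * (m - r)) * Real.exp (k * ((σ - h) * x - g x)) := by positivity
        linarith
      · rw [indicator_of_notMem hx, zero_add, ← Real.exp_add, ← Real.exp_add]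
        have hkh : 0 < k * h := by positivity
        rw [mem_Icc, not_and_or, not_le, not_le] at hx
        rcases hx with hx | hx
        · have : Real.exp (k * (σ * x - g x)) ≤
              Real.exp (k * h * (m - r) + k * ((σ - h) * x - g x)) := by
            rw [Real.exp_le_exp]; nlinarith
          linarith [Real.exp_pos (-(k * h * (m + r)) + k * ((σ + h) * x - g x))]
        · have : Real.exp (k * (σ * x - g x)) ≤
              Real.exp (-(k * h * (m + r)) + k * ((σ + h) * x - g x)) := by
            rw [Real.exp_le_exp]; nlinarith
          linarith [Real.exp_pos (k * h * (m - r) + k * ((σ - h) * x - g x))]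
    have hind : Integrable ((Icc (m - r) (m + r)).indicator (fun _ : ℝ => X)) :=
      (integrable_indicator_iff measurableSet_Icc).2 (by simp)
    have hii1 := (hi (σ + h)).const_mul (Real.exp (-(k * h * (m + r))))
    have hii2 := (hi (σ - h)).const_mul (Real.exp (k * h * (m - r)))
    have hint := integral_mono (hi σ) (hind.add (hii1.add hii2)) hpt
    have hs1 : ∫ x, ((Icc (m - r) (m + r)).indicator (fun _ => X) + ((fun x =>
        Real.exp (-(k * h * (m + r))) * Real.exp (k * ((σ + h) * x - g x))) + fun x =>
          Real.exp (k * h * (m - r)) * Real.exp (k * ((σ - h) * x - g x)))) x =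
        2 * r * X + (Real.exp (-(k * h * (m + r))) * (∫ x, Real.exp (k * ((σ + h) * x - g x))) +
          Real.exp (k * h * (m - r)) * ∫ x, Real.exp (k * ((σ - h) * x - g x))) := by
      rw [integral_add' hind (hii1.add hii2), integral_add' hii1 hii2, integral_const_mul,
        integral_const_mul, integral_indicator measurableSet_Icc, integral_const]
      congr 1
      rw [measureReal_restrict_apply_univ, Real.volume_real_Icc,
        max_eq_left (by linarith), smul_eq_mul]
      ring
    rw [hs1] at hint
    have hint2 := mul_le_mul_of_nonneg_left hint ha.le
    rw [← hI σ] at hint2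
    have hkh2 : k * h ^ 2 = 1 := by
      rw [hh]; field_simp; rw [Real.sq_sqrt hk.le]
    have hkhr : k * h * r = 2 * β + 1 := by
      rw [hh, hr]; field_simp; rw [Real.sq_sqrt hk.le]
    have hexp1 : Real.exp (-1) < 0.37 := by
      have h2 : Real.exp (-1) * Real.exp 1 = 1 := by rw [← Real.exp_add]; simp
      have h3 := Real.exp_one_gt_d9
      have h4 := Real.exp_pos (-1)
      nlinarith
    have hexp4 : Real.exp (-(2 * β + 1) + β / 2) ≤ Real.exp (-1) :=
      Real.exp_le_exp.2 (by linarith)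
    have hq1 : a * (Real.exp (-(k * h * (m + r))) * ∫ x, Real.exp (k * ((σ + h) * x - g x))) ≤
        Real.exp (k * L σ) * Real.exp (-(2 * β + 1) + β / 2) := by
      rw [mul_left_comm, ← hI, ← Real.exp_add, ← Real.exp_add, Real.exp_le_exp]
      have := mul_le_mul_of_nonneg_left (hL σ h) hk.le
      rw [hσ] at this
      nlinarith
    have hq2 : a * (Real.exp (k * h * (m - r)) * ∫ x, Real.exp (k * ((σ - h) * x - g x))) ≤
        Real.exp (k * L σ) * Real.exp (-(2 * β + 1) + β / 2) := by
      rw [mul_left_comm, ← hI, ← Real.exp_add, ← Real.exp_add, Real.exp_le_exp]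
      have := mul_le_mul_of_nonneg_left (hL σ (-h)) hk.le
      rw [hσ, ← sub_eq_add_neg] at this
      nlinarith
    have hX2 : a * (2 * r * X) ≤ Real.exp (k * L σ) * (1 / 2 * Real.exp (-1)) := by
      have e1 : k * (L σ - b - C / k) = k * L σ + (-Real.log (a / √k) +
          (-Real.log 4 - (2 * β + 1))) := by
        rw [hb, hC]; field_simp; ring
      have e2 : Real.exp (-Real.log (a / √k)) = √k / a := by
        rw [Real.exp_neg, Real.exp_log (by positivity), inv_div]
      have e3 : Real.exp (-Real.log 4 - (2 * β + 1)) = 1 / 4 * Real.exp (-(2 * β + 1)) := by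
        rw [sub_eq_add_neg, Real.exp_add, Real.exp_neg, Real.exp_log (by norm_num)]; norm_num
      have e4 : (2 * β + 1) * Real.exp (-(2 * β + 1)) ≤ Real.exp (-1) := by
        have h1 := Real.add_one_le_exp (2 * β)
        have h2 : Real.exp (-1) = Real.exp (2 * β) * Real.exp (-(2 * β + 1)) := by
          rw [← Real.exp_add]; congr 1; ring
        rw [h2]; gcongr
      rw [hX, e1, Real.exp_add, Real.exp_add, e2, e3, hr]
      have e5 : a * (2 * ((2 * β + 1) / √k) * (Real.exp (k * L σ) *
          (√k / a * (1 / 4 * Real.exp (-(2 * β + 1)))))) =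
          Real.exp (k * L σ) * (1 / 2 * ((2 * β + 1) * Real.exp (-(2 * β + 1)))) := by
        field_simp; ring
      rw [e5]; gcongr
    have hE := Real.exp_pos (k * L σ)
    have hq3 : Real.exp (k * L σ) * Real.exp (-(2 * β + 1) + β / 2) ≤
        Real.exp (k * L σ) * Real.exp (-1) := by gcongr
    nlinarith

/-- In the situation of `laplace_bounds`, the derivatives converge uniformly with rate
`K^{-1/2}`: this only uses that `g` is semiconcave and `φ` convex. -/
theorem abs_deriv_sub_le_of_laplace {g g' φ φ' : ℝ → ℝ} {k Λ b C R : ℝ} (hk : 0 < k) (hΛ : 0 < Λ)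
    (hg : ∀ m h, g (m + h) ≤ g m + g' m * h + Λ / 2 * h ^ 2)
    (hφ : ∀ m h, φ m + φ' m * h ≤ φ (m + h))
    (hlow : ∀ m, φ m + b ≤ g m)
    (hup : ∀ m, ∃ m', |m' - m| ≤ R / √k ∧ g m' ≤ φ m' + b + C / k) (m : ℝ) :
    |g' m - φ' m| ≤ (C + Λ / 2 + 2 * Λ * R) / √k := by
  have hsk : 0 < √k := Real.sqrt_pos.2 hk
  have hsq : √k * √k = k := Real.mul_self_sqrt hk.le
  set δ := 1 / √k with hδ
  have hδpos : 0 < δ := by positivity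
  have hδ2 : δ * δ = 1 / k := by rw [hδ]; field_simp; rw [Real.sq_sqrt hk.le]
  -- where `g - φ` is almost minimal, `g'` is close to `φ'`: compare with the points `x ± 1 / √k`
  have hnear : ∀ x, g x ≤ φ x + b + C / k → |g' x - φ' x| ≤ (C + Λ / 2) * δ := by
    intro x hx
    have hh : ∀ h, (φ' x - g' x) * h ≤ C / k + Λ / 2 * h ^ 2 := by
      intro h
      have h1 := hg x h
      have h2 := hφ x h
      have h3 := hlow (x + h)
      nlinarith
    have e : C / k = C * (δ * δ) := by rw [hδ2]; ring
    have h1 := hh δ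
    have h2 := hh (-δ)
    rw [e] at h1 h2
    rw [abs_le]
    constructor
    · refine le_of_mul_le_mul_right ?_ hδpos
      nlinarith
    · refine le_of_mul_le_mul_right ?_ hδpos
      nlinarith
  have hsemi : ∀ x y, x ≤ y → g' y - g' x ≤ Λ * (y - x) := by
    intro x y hxy
    rcases hxy.eq_or_lt with rfl | hlt
    · simp
    have h1 := hg x (y - x)
    have h2 := hg y (x - y)
    rw [add_sub_cancel] at h1 h2
    refine le_of_mul_le_mul_right ?_ (sub_pos.2 hlt)
    nlinarith
  have hmono : ∀ x y, x ≤ y → φ' x ≤ φ' y := by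
    intro x y hxy
    rcases hxy.eq_or_lt with rfl | hlt
    · rfl
    have h1 := hφ x (y - x)
    have h2 := hφ y (x - y)
    rw [add_sub_cancel] at h1 h2
    refine le_of_mul_le_mul_right ?_ (sub_pos.2 hlt)
    nlinarith
  have eR : R / √k = R * δ := by rw [hδ]; ring
  have efin : (C + Λ / 2 + 2 * Λ * R) / √k = (C + Λ / 2) * δ + Λ * (2 * (R * δ)) := by
    rw [hδ]; ring
  rw [efin]
  -- two such points `x ≤ m ≤ y`: from these, `g'` increases by little and `φ'` is monotone
  obtain ⟨x, hx1, hx2⟩ := hup (m - R * δ)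
  obtain ⟨y, hy1, hy2⟩ := hup (m + R * δ)
  rw [eR, abs_le] at hx1 hy1
  have hxm : x ≤ m := by linarith
  have hmy : m ≤ y := by linarith
  have hx3 := abs_le.1 (hnear x hx2)
  have hy3 := abs_le.1 (hnear y hy2)
  have h1 := hsemi x m hxm
  have h2 := hsemi m y hmy
  have h3 : Λ * (m - x) ≤ Λ * (2 * (R * δ)) := by gcongr; linarith
  have h4 : Λ * (y - m) ≤ Λ * (2 * (R * δ)) := by gcongr; linarith
  have h5 := hmono x m hxm
  have h6 := hmono m y hmy
  rw [abs_le]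
  constructor <;> linarith [hx3.1, hx3.2, hy3.1, hy3.2]

/-- The Cramér transform has a strongly monotone and Lipschitz derivative, and the derivatives of
the coarse-grained potentials converge to it uniformly. -/
theorem exists_cramer_bounds {δψ : ℝ → ℝ} (hδ : ContDiff ℝ 2 δψ) {B : ℝ}
    (hB : ∀ x, |δψ x| ≤ B ∧ |deriv δψ x| ≤ B ∧ |iteratedDeriv 2 δψ x| ≤ B) :
    ∃ lam Λ D : ℝ, 0 < lam ∧ 0 < Λ ∧
      (∀ x y, lam * (x - y) ^ 2 ≤
        (deriv (cramer (potential δψ)) x - deriv (cramer (potential δψ)) y) * (x - y)) ∧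
      (∀ x y, |deriv (cramer (potential δψ)) x - deriv (cramer (potential δψ)) y| ≤
        Λ * |x - y|) ∧
      ∀ K : ℕ, 0 < K → ∀ m,
        |deriv (psiK (potential δψ) K) m - deriv (cramer (potential δψ)) m| ≤ D / √K := by
  have hB0 : 0 ≤ B := (abs_nonneg _).trans (hB 0).1
  have hB1 := fun x => (hB x).1
  set b := Real.exp (2 * B) with hb
  obtain ⟨h1, h2, h3, h4, h5⟩ := legendre_of_uniformly_convex
    (contDiff_logZ hδ.continuous hB1) (Real.exp_pos (-(2 * B)))
    (iteratedDeriv_two_logZ hδ.continuous hB1) (φ := cramer (potential δψ)) rfl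
  set C := Real.log 4 + 2 * b + 1 + (1 + B) / 2 with hC
  have hbpos : 0 < b := Real.exp_pos _
  refine ⟨b⁻¹, (Real.exp (-(2 * B)))⁻¹, C + (1 + B) / 2 + 2 * (1 + B) * (2 * b + 1),
    by positivity, by positivity, h4, h5, fun K hK m => ?_⟩
  have hKr : (0 : ℝ) < K := by exact_mod_cast hK
  obtain ⟨a, ha, hI⟩ := exists_exp_logZ_eq hδ hB hK
  obtain ⟨-, -, -, hT, -, -⟩ := psiK_properties hδ hB hK
  obtain ⟨c, C', hC', hlow, hup⟩ := laplace_bounds hKr ha (by positivity) hbpos hT h3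
    (fun σ => (hI σ).1) (fun σ => (hI σ).2) h1
    (fun m => (h2 m).imp fun σ h => ⟨h.1, h.2.1⟩)
  rw [hC', ← hC] at hup
  refine abs_deriv_sub_le_of_laplace hKr (by positivity) hT
    (fun m h => ?_) hlow hup m
  obtain ⟨σ, -, hv, hd⟩ := h2 m
  rw [hd.deriv, hv]
  have := h1 (m + h) σ
  linarith

/-! ### The `L²` norm -/

/-- The `L²` norm, as a real number. -/
def l2norm {Ω : Type*} [MeasurableSpace Ω] (ρ : Measure Ω) (f : Ω → ℝ) : ℝ :=
  √(∫ x, f x ^ 2 ∂ρ)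

section l2norm
variable {Ω : Type*} [MeasurableSpace Ω] {ρ : Measure Ω} {f g : Ω → ℝ}

theorem l2norm_nonneg : 0 ≤ l2norm ρ f := Real.sqrt_nonneg _

theorem l2norm_sq : l2norm ρ f ^ 2 = ∫ x, f x ^ 2 ∂ρ :=
  Real.sq_sqrt (integral_nonneg fun _ => sq_nonneg _)

theorem l2norm_congr (h : f =ᵐ[ρ] g) : l2norm ρ f = l2norm ρ g := by
  rw [l2norm, l2norm]
  congr 1
  exact integral_congr_ae (h.mono fun x hx => by simp only [hx])

theorem l2norm_neg : l2norm ρ (fun x => -f x) = l2norm ρ f := by simp [l2norm]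

theorem inner_toLp (hf : MemLp f 2 ρ) (hg : MemLp g 2 ρ) :
    ⟪hf.toLp f, hg.toLp g⟫_ℝ = ∫ x, f x * g x ∂ρ := by
  rw [L2.inner_def]
  refine integral_congr_ae ?_
  filter_upwards [hf.coeFn_toLp, hg.coeFn_toLp] with x h1 h2
  rw [h1, h2]; simp [mul_comm]

theorem l2norm_eq_norm (hf : MemLp f 2 ρ) : l2norm ρ f = ‖hf.toLp f‖ := by
  rw [l2norm, norm_eq_sqrt_real_inner, inner_toLp]
  simp only [sq]

theorem l2norm_add_le (hf : MemLp f 2 ρ) (hg : MemLp g 2 ρ) :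
    l2norm ρ (fun x => f x + g x) ≤ l2norm ρ f + l2norm ρ g := by
  have := l2norm_eq_norm (hf.add hg)
  rw [hf.toLp_add hg] at this
  rw [l2norm_eq_norm hf, l2norm_eq_norm hg]
  exact this.trans_le (norm_add_le _ _)

theorem l2norm_sub_le (hf : MemLp f 2 ρ) (hg : MemLp g 2 ρ) :
    l2norm ρ (fun x => f x - g x) ≤ l2norm ρ f + l2norm ρ g := by
  have := l2norm_add_le hf (g := fun x => -g x) hg.neg
  simpa only [← sub_eq_add_neg, l2norm_neg] using this

theorem l2norm_const_mul (c : ℝ) : l2norm ρ (fun x => c * f x) = |c| * l2norm ρ f := by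
  simp only [l2norm, mul_pow, integral_const_mul]
  rw [Real.sqrt_mul (sq_nonneg c), Real.sqrt_sq_eq_abs]

theorem abs_integral_mul_le (hf : MemLp f 2 ρ) (hg : MemLp g 2 ρ) :
    |∫ x, f x * g x ∂ρ| ≤ l2norm ρ f * l2norm ρ g := by
  rw [← inner_toLp hf hg, l2norm_eq_norm hf, l2norm_eq_norm hg]
  exact abs_real_inner_le_norm _ _

theorem l2norm_mono (hg : MemLp g 2 ρ) (h : ∀ᵐ x ∂ρ, |f x| ≤ |g x|) : l2norm ρ f ≤ l2norm ρ g := by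
  refine Real.sqrt_le_sqrt ?_
  refine integral_mono_of_nonneg (ae_of_all _ fun x => sq_nonneg _) hg.integrable_sq ?_
  filter_upwards [h] with x hx using sq_le_sq.2 hx

theorem l2norm_le_of_bound [IsProbabilityMeasure ρ] {C : ℝ} (hC : 0 ≤ C)
    (h : ∀ᵐ x ∂ρ, |f x| ≤ C) : l2norm ρ f ≤ C := by
  have h2 : l2norm ρ (fun _ : Ω => C) = C := by simp [l2norm, Real.sqrt_sq hC]
  rw [← h2]
  exact l2norm_mono (memLp_const C) (h.mono fun x hx => hx.trans (le_abs_self C))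

theorem eLpNorm_eq_ofReal_l2norm (hf : MemLp f 2 ρ) :
    eLpNorm f 2 ρ = ENNReal.ofReal (l2norm ρ f) := by
  rw [l2norm_eq_norm hf, Lp.norm_toLp, ENNReal.ofReal_toReal hf.2.ne]

theorem integral_abs_le_l2norm [IsProbabilityMeasure ρ] (hf : MemLp f 2 ρ) :
    ∫ x, |f x| ∂ρ ≤ l2norm ρ f := by
  have h := abs_integral_mul_le hf.abs (memLp_const (1 : ℝ))
  have h2 : l2norm ρ (fun x => |f x|) = l2norm ρ f := by simp [l2norm, sq_abs]
  have h3 : l2norm ρ (fun _ : Ω => (1 : ℝ)) = 1 := by simp [l2norm]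
  simp only [mul_one] at h
  have h' := h.trans_eq (by rw [show l2norm ρ |f| = l2norm ρ f from h2, h3, mul_one])
  exact (le_abs_self _).trans h'

theorem integrable_mul_of_memLp (hf : MemLp f 2 ρ) (hg : MemLp g 2 ρ) :
    Integrable (fun x => f x * g x) ρ := hf.integrable_mul hg

theorem integral_mul_sub {a b c : Ω → ℝ} (ha : MemLp a 2 ρ) (hb : MemLp b 2 ρ) (hc : MemLp c 2 ρ) :
    ∫ x, a x * (b x - c x) ∂ρ = ∫ x, a x * b x ∂ρ - ∫ x, a x * c x ∂ρ := by
  simp only [mul_sub]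
  exact integral_sub (integrable_mul_of_memLp ha hb) (integrable_mul_of_memLp ha hc)

theorem l2norm_eq_zero_iff (hf : MemLp f 2 ρ) : ∫ x, f x ^ 2 ∂ρ = 0 ↔ f =ᵐ[ρ] 0 := by
  rw [integral_eq_zero_iff_of_nonneg (fun x => sq_nonneg _) hf.integrable_sq]
  refine ⟨fun h => h.mono fun x hx => ?_, fun h => h.mono fun x hx => ?_⟩
  · exact pow_eq_zero_iff two_ne_zero |>.1 hx
  · simp only [hx, Pi.zero_apply]; norm_num

theorem l2norm_sub_sq_le {h : Ω → ℝ} (hf : MemLp f 2 ρ) (hg : MemLp g 2 ρ) (hh : MemLp h 2 ρ) :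
    l2norm ρ (fun x => f x - g x) ^ 2 ≤
      2 * l2norm ρ (fun x => f x - h x) ^ 2 + 2 * l2norm ρ (fun x => g x - h x) ^ 2 := by
  have h1 := l2norm_sub_le (hf.sub hh) (hg.sub hh)
  have h2 : (fun x => (f - h) x - (g - h) x) = fun x => f x - g x := by
    funext x; simp
  rw [h2] at h1
  change _ ≤ l2norm ρ (fun x => f x - h x) + l2norm ρ (fun x => g x - h x) at h1
  have h3 := pow_le_pow_left₀ l2norm_nonneg h1 2
  nlinarith [sq_nonneg (l2norm ρ (fun x => f x - h x) - l2norm ρ (fun x => g x - h x))]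

theorem integral_add_sq_le (hf : MemLp f 2 ρ) (hg : MemLp g 2 ρ) :
    ∫ x, (f x + g x) ^ 2 ∂ρ ≤ 2 * ∫ x, f x ^ 2 ∂ρ + 2 * ∫ x, g x ^ 2 ∂ρ := by
  rw [← integral_const_mul, ← integral_const_mul,
    ← integral_add (hf.integrable_sq.const_mul 2) (hg.integrable_sq.const_mul 2)]
  refine integral_mono (hf.add hg).integrable_sq
    ((hf.integrable_sq.const_mul 2).add (hg.integrable_sq.const_mul 2)) fun x => ?_
  nlinarith [sq_nonneg (f x - g x)]

end l2norm

/-! ### Primitives on the torus -/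

theorem torusMeasure_eq_Ioc : torusMeasure = volume.restrict (Ioc 0 1) :=
  Measure.restrict_congr_set Ico_ae_eq_Ioc

theorem torusMeasure_eq_Icc : torusMeasure = volume.restrict (Icc 0 1) :=
  Measure.restrict_congr_set Ico_ae_eq_Icc

instance : IsProbabilityMeasure torusMeasure := ⟨by simp [torusMeasure]⟩

theorem integral_torus (f : ℝ → ℝ) : ∫ θ, f θ ∂torusMeasure = ∫ θ in (0 : ℝ)..1, f θ := by
  rw [torusMeasure_eq_Ioc, intervalIntegral.integral_of_le zero_le_one]

theorem ae_torus_mem : ∀ᵐ θ ∂torusMeasure, θ ∈ Ico (0 : ℝ) 1 :=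
  ae_restrict_mem measurableSet_Ico

theorem intervalIntegrable_of_torus {w : ℝ → ℝ} (hw : Integrable w torusMeasure) :
    IntervalIntegrable w volume 0 1 := by
  rw [torusMeasure_eq_Ioc] at hw
  exact (intervalIntegrable_iff_integrableOn_Ioc_of_le zero_le_one).2 hw

theorem intervalIntegrable_of_torus' {w : ℝ → ℝ} (hw : Integrable w torusMeasure) {a b : ℝ}
    (ha : a ∈ Icc (0 : ℝ) 1) (hb : b ∈ Icc (0 : ℝ) 1) : IntervalIntegrable w volume a b :=
  (intervalIntegrable_of_torus hw).mono_set
    (by rw [uIcc_of_le zero_le_one]; exact (Set.ordConnected_Icc.uIcc_subset ha hb))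

theorem continuousOn_primitive_torus {w : ℝ → ℝ} (hw : Integrable w torusMeasure) :
    ContinuousOn (fun θ => ∫ s in (0 : ℝ)..θ, w s) (Icc 0 1) := by
  rw [← uIcc_of_le (zero_le_one' ℝ)]
  exact intervalIntegral.continuousOn_primitive_interval' (intervalIntegrable_of_torus hw)
    left_mem_uIcc

theorem continuousOn_prim {w : ℝ → ℝ} (hw : Integrable w torusMeasure) :
    ContinuousOn (prim w) (Icc 0 1) :=
  (continuousOn_primitive_torus hw).sub continuousOn_const

theorem memLp_of_continuousOn {f : ℝ → ℝ} (hf : ContinuousOn f (Icc 0 1)) :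
    MemLp f 2 torusMeasure := by
  obtain ⟨C, hC⟩ := isCompact_Icc.exists_bound_of_continuousOn hf
  refine MemLp.of_bound (C := C) ?_ ?_
  · rw [torusMeasure_eq_Icc]; exact hf.aestronglyMeasurable measurableSet_Icc
  · rw [torusMeasure_eq_Icc]
    exact (ae_restrict_mem measurableSet_Icc).mono hC

theorem memLp_prim {w : ℝ → ℝ} (hw : Integrable w torusMeasure) :
    MemLp (prim w) 2 torusMeasure := memLp_of_continuousOn (continuousOn_prim hw)

theorem integral_prim {w : ℝ → ℝ} (hw : Integrable w torusMeasure) :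
    ∫ θ, prim w θ ∂torusMeasure = 0 := by
  rw [integral_torus]
  simp only [prim]
  rw [intervalIntegral.integral_sub]
  · simp
  · refine ContinuousOn.intervalIntegrable ?_
    rw [uIcc_of_le zero_le_one]; exact continuousOn_primitive_torus hw
  · simp

theorem prim_sub_prim {w : ℝ → ℝ} (hw : Integrable w torusMeasure) {a b : ℝ}
    (ha : a ∈ Icc (0 : ℝ) 1) (hb : b ∈ Icc (0 : ℝ) 1) :
    prim w b - prim w a = ∫ s in a..b, w s := by
  simp only [prim, sub_sub_sub_cancel_right]
  exact intervalIntegral.integral_interval_sub_left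
    (intervalIntegrable_of_torus' hw (by simp) hb) (intervalIntegrable_of_torus' hw (by simp) ha)

theorem abs_primitive_le {w : ℝ → ℝ} (hw : Integrable w torusMeasure) {θ : ℝ}
    (hθ : θ ∈ Icc (0 : ℝ) 1) : |∫ s in (0 : ℝ)..θ, w s| ≤ ∫ s, |w s| ∂torusMeasure := by
  rw [integral_torus]
  refine (intervalIntegral.abs_integral_le_integral_abs hθ.1).trans ?_
  exact intervalIntegral.integral_mono_interval le_rfl hθ.1 hθ.2
    (ae_of_all _ fun x => abs_nonneg _) (intervalIntegrable_of_torus hw.abs)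

theorem abs_prim_le_of_primitive {w : ℝ → ℝ} {C : ℝ}
    (hC : ∀ θ ∈ Icc (0 : ℝ) 1, |∫ s in (0 : ℝ)..θ, w s| ≤ C) {θ : ℝ} (hθ : θ ∈ Icc (0 : ℝ) 1) :
    |prim w θ| ≤ 2 * C := by
  have h2 : |∫ u in (0 : ℝ)..1, ∫ s in (0 : ℝ)..u, w s| ≤ C := by
    have := intervalIntegral.norm_integral_le_of_norm_le_const (a := 0) (b := 1) (C := C)
      (f := fun u => ∫ s in (0 : ℝ)..u, w s) (fun x hx => hC x (by
        rw [uIoc_of_le zero_le_one] at hx; exact ⟨hx.1.le, hx.2⟩))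
    simpa using this
  rw [prim]
  refine (abs_sub _ _).trans ?_
  linarith [hC θ hθ]

theorem abs_prim_le {w : ℝ → ℝ} (hw : MemLp w 2 torusMeasure) {θ : ℝ}
    (hθ : θ ∈ Icc (0 : ℝ) 1) : |prim w θ| ≤ 2 * l2norm torusMeasure w :=
  abs_prim_le_of_primitive (fun _ h => (abs_primitive_le (hw.integrable (by simp)) h).trans
    (integral_abs_le_l2norm hw)) hθ

theorem l2norm_prim_le {w : ℝ → ℝ} (hw : MemLp w 2 torusMeasure) :
    l2norm torusMeasure (prim w) ≤ 2 * l2norm torusMeasure w :=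
  l2norm_le_of_bound (by have := l2norm_nonneg (ρ := torusMeasure) (f := w); positivity)
    (ae_torus_mem.mono fun _ h => abs_prim_le hw (Ico_subset_Icc_self h))

theorem hMinusNorm_eq (w : ℝ → ℝ) : hMinusNorm w = l2norm torusMeasure (prim w) := rfl

theorem primitive_congr {w w' : ℝ → ℝ} (h : w =ᵐ[torusMeasure] w') {θ : ℝ}
    (hθ : θ ∈ Icc (0 : ℝ) 1) : ∫ s in (0 : ℝ)..θ, w s = ∫ s in (0 : ℝ)..θ, w' s := by
  rw [intervalIntegral.integral_of_le hθ.1, intervalIntegral.integral_of_le hθ.1]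
  refine integral_congr_ae ?_
  rw [torusMeasure_eq_Ioc] at h
  exact ae_restrict_of_ae_restrict_of_subset (Ioc_subset_Ioc_right hθ.2) h

theorem prim_congr {w w' : ℝ → ℝ} (h : w =ᵐ[torusMeasure] w') {θ : ℝ}
    (hθ : θ ∈ Icc (0 : ℝ) 1) : prim w θ = prim w' θ := by
  rw [prim, prim, primitive_congr h hθ]
  congr 1
  refine intervalIntegral.integral_congr fun u hu => ?_
  rw [uIcc_of_le zero_le_one] at hu
  exact primitive_congr h hu

theorem prim_sub {w w' : ℝ → ℝ} (hw : Integrable w torusMeasure) (hw' : Integrable w' torusMeasure)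
    {θ : ℝ} (hθ : θ ∈ Icc (0 : ℝ) 1) :
    prim (fun x => w x - w' x) θ = prim w θ - prim w' θ := by
  have h : ∀ u ∈ Icc (0 : ℝ) 1, ∫ s in (0 : ℝ)..u, (w s - w' s) =
      (∫ s in (0 : ℝ)..u, w s) - ∫ s in (0 : ℝ)..u, w' s := fun u hu =>
    intervalIntegral.integral_sub (intervalIntegrable_of_torus' hw (by simp) hu)
      (intervalIntegrable_of_torus' hw' (by simp) hu)
  have hi : ∀ {w : ℝ → ℝ}, Integrable w torusMeasure →
      IntervalIntegrable (fun θ => ∫ s in (0 : ℝ)..θ, w s) volume 0 1 := fun hw =>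
    ContinuousOn.intervalIntegrable (by
      rw [uIcc_of_le zero_le_one]; exact continuousOn_primitive_torus hw)
  rw [prim, prim, prim, h θ hθ]
  have h2 : ∫ u in (0 : ℝ)..1, ∫ s in (0 : ℝ)..u, (w s - w' s) =
      (∫ u in (0 : ℝ)..1, ∫ s in (0 : ℝ)..u, w s) - ∫ u in (0 : ℝ)..1, ∫ s in (0 : ℝ)..u, w' s := by
    rw [← intervalIntegral.integral_sub (hi hw) (hi hw')]
    refine intervalIntegral.integral_congr fun u hu => ?_
    rw [uIcc_of_le zero_le_one] at hu
    exact h u hu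
  rw [h2]; ring

/-- Integration by parts for primitives of integrable functions. -/
theorem integral_primitive_mul {v q : ℝ → ℝ} {a b : ℝ} (hv : IntervalIntegrable v volume a b)
    (hq : IntervalIntegrable q volume a b) (c d : ℝ) :
    ∫ x in a..b, (c + ∫ s in a..x, v s) * q x =
      (c + ∫ s in a..b, v s) * (d + ∫ s in a..b, q s) - c * d -
        ∫ x in a..b, v x * (d + ∫ s in a..x, q s) := by
  have hac : ∀ {v : ℝ → ℝ}, IntervalIntegrable v volume a b → ∀ c : ℝ,
      AbsolutelyContinuousOnInterval (fun x => c + ∫ s in a..x, v s) a b := fun hv c =>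
    ((LipschitzWith.const c).lipschitzOnWith.absolutelyContinuousOnInterval).add
      (hv.absolutelyContinuousOnInterval_intervalIntegral left_mem_uIcc)
  have hder : ∀ {v : ℝ → ℝ}, IntervalIntegrable v volume a b → ∀ c : ℝ,
      ∀ᵐ x, x ∈ uIoc a b → deriv (fun x => c + ∫ s in a..x, v s) x = v x := by
    intro v hv c
    filter_upwards [hv.ae_hasDerivAt_integral] with x hx hxm
    exact ((hx (uIoc_subset_uIcc hxm) a left_mem_uIcc).const_add c).deriv
  have h := AbsolutelyContinuousOnInterval.integral_mul_deriv_eq_deriv_mul (hac hv c) (hac hq d)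
  have e1 : ∫ x in a..b, (c + ∫ s in a..x, v s) * deriv (fun x => d + ∫ s in a..x, q s) x =
      ∫ x in a..b, (c + ∫ s in a..x, v s) * q x :=
    intervalIntegral.integral_congr_ae ((hder hq d).mono fun x hx hm => by rw [hx hm])
  have e2 : ∫ x in a..b, deriv (fun x => c + ∫ s in a..x, v s) x * (d + ∫ s in a..x, q s) =
      ∫ x in a..b, v x * (d + ∫ s in a..x, q s) :=
    intervalIntegral.integral_congr_ae ((hder hv c).mono fun x hx hm => by rw [hx hm])
  rw [e1, e2] at h
  simpa using h

/-- `prim` is skew-adjoint on functions of average `0`. -/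
theorem integral_prim_mul {w g : ℝ → ℝ} (hw : MemL20 w) (hg : MemL20 g) :
    ∫ θ, prim w θ * g θ ∂torusMeasure = -∫ θ, w θ * prim g θ ∂torusMeasure := by
  have hwi := intervalIntegrable_of_torus (hw.1.integrable (by simp))
  have hgi := intervalIntegrable_of_torus (hg.1.integrable (by simp))
  have h1 := hw.2
  have h2 := hg.2
  rw [integral_torus] at h1 h2
  have h := integral_primitive_mul hwi hgi (-∫ u in (0 : ℝ)..1, ∫ s in (0 : ℝ)..u, w s)
    (-∫ u in (0 : ℝ)..1, ∫ s in (0 : ℝ)..u, g s)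
  rw [h1, h2] at h
  simp only [neg_add_eq_sub] at h
  rw [integral_torus, integral_torus]
  simp only [prim]
  rw [h]; ring

theorem MemL20.integrable {w : ℝ → ℝ} (hw : MemL20 w) : Integrable w torusMeasure :=
  hw.1.integrable (by simp)

theorem MemL20.sub {v w : ℝ → ℝ} (hv : MemL20 v) (hw : MemL20 w) : MemL20 fun θ => v θ - w θ :=
  ⟨hv.1.sub hw.1, by rw [integral_sub hv.integrable hw.integrable, hv.2, hw.2, sub_zero]⟩

theorem MemL20.const_mul {w : ℝ → ℝ} (hw : MemL20 w) (c : ℝ) : MemL20 fun θ => c * w θ :=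
  ⟨hw.1.const_mul c, by rw [integral_const_mul, hw.2, mul_zero]⟩

theorem MemL20.prim {w : ℝ → ℝ} (hw : MemL20 w) : MemL20 (prim w) :=
  ⟨memLp_prim hw.integrable, integral_prim hw.integrable⟩

/-! ### Step functions -/

theorem cell_subset {n : ℕ} (i : Fin n) :
    (i : ℝ) / n ∈ Icc (0 : ℝ) 1 ∧ ((i : ℝ) + 1) / n ∈ Icc (0 : ℝ) 1 ∧
      ((i : ℝ) + 1) / n - i / n = (n : ℝ)⁻¹ := by
  have hn : (0 : ℝ) < n := by exact_mod_cast i.pos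
  have hi : (i : ℝ) + 1 ≤ n := by exact_mod_cast i.isLt
  have hi0 : (0 : ℝ) ≤ i := by positivity
  refine ⟨⟨by positivity, ?_⟩, ⟨by positivity, ?_⟩, by field_simp; ring⟩
  · rw [div_le_one hn]; linarith
  · rw [div_le_one hn]; linarith

theorem cell_le {n : ℕ} (i : Fin n) : (i : ℝ) / n ≤ ((i : ℝ) + 1) / n := by
  gcongr; linarith

theorem stepFun_eq {n : ℕ} (x : EuclideanSpace ℝ (Fin n)) (i : Fin n) {θ : ℝ}
    (hθ : θ ∈ Ico ((i : ℝ) / n) (((i : ℝ) + 1) / n)) : stepFun x θ = x i := by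
  have hn : (0 : ℝ) < n := by exact_mod_cast i.pos
  rw [stepFun, Finset.sum_eq_single i, indicator_of_mem hθ]
  · intro j _ hj
    refine indicator_of_notMem (fun hθ' => hj ?_) _
    rw [mem_Ico, div_le_iff₀ hn, lt_div_iff₀ hn] at hθ hθ'
    have h1 : (i : ℝ) < j + 1 := by linarith
    have h2 : (j : ℝ) < i + 1 := by linarith
    have h1' : (i : ℕ) < j + 1 := by exact_mod_cast h1
    have h2' : (j : ℕ) < i + 1 := by exact_mod_cast h2
    exact Fin.ext (by omega)
  · simp

theorem exists_cell {n : ℕ} (hn : 0 < n) {θ : ℝ} (hθ : θ ∈ Ico (0 : ℝ) 1) :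
    ∃ i : Fin n, θ ∈ Ico ((i : ℝ) / n) (((i : ℝ) + 1) / n) := by
  have hn' : (0 : ℝ) < n := by exact_mod_cast hn
  have h0 : 0 ≤ n * θ := mul_nonneg hn'.le hθ.1
  have h1 : n * θ < n := by nlinarith [hθ.2]
  refine ⟨⟨⌊n * θ⌋₊, (Nat.floor_lt h0).2 h1⟩, ?_⟩
  rw [mem_Ico, div_le_iff₀ hn', lt_div_iff₀ hn', mul_comm θ]
  exact ⟨Nat.floor_le h0, Nat.lt_floor_add_one _⟩

theorem measurable_stepFun {n : ℕ} (x : EuclideanSpace ℝ (Fin n)) : Measurable (stepFun x) := by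
  unfold stepFun
  exact Finset.measurable_sum _ fun i _ => measurable_const.indicator measurableSet_Ico

theorem abs_stepFun_le {n : ℕ} (x : EuclideanSpace ℝ (Fin n)) (θ : ℝ) :
    |stepFun x θ| ≤ ∑ i, |x i| := by
  refine (Finset.abs_sum_le_sum_abs _ _).trans (Finset.sum_le_sum fun i _ => ?_)
  by_cases h : θ ∈ Ico ((i : ℝ) / n) (((i : ℝ) + 1) / n)
  · rw [indicator_of_mem h]
  · rw [indicator_of_notMem h]; simp

theorem memLp_stepFun {n : ℕ} (x : EuclideanSpace ℝ (Fin n)) : MemLp (stepFun x) 2 torusMeasure :=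
  MemLp.of_bound (measurable_stepFun x).aestronglyMeasurable _
    (ae_of_all _ fun θ => abs_stepFun_le x θ)

theorem integral_torus_eq_sum_cells {n : ℕ} (hn : 0 < n) {f : ℝ → ℝ}
    (hf : Integrable f torusMeasure) :
    ∫ θ, f θ ∂torusMeasure = ∑ i : Fin n, ∫ θ in ((i : ℝ) / n)..(((i : ℝ) + 1) / n), f θ := by
  have hn' : (n : ℝ) ≠ 0 := by positivity
  have h := intervalIntegral.sum_integral_adjacent_intervals (μ := volume) (f := f)
    (a := fun k : ℕ => (k : ℝ) / n) (n := n) fun k hk => by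
      have := cell_subset (⟨k, hk⟩ : Fin n)
      simp only at this
      rw [Nat.cast_add, Nat.cast_one]
      exact intervalIntegrable_of_torus' hf this.1 this.2.1
  rw [Finset.sum_range] at h
  simp only [Nat.cast_add, Nat.cast_one, Nat.cast_zero, zero_div, div_self hn'] at h
  rw [integral_torus, h]

theorem integral_cell_congr {n : ℕ} (i : Fin n) {f g : ℝ → ℝ}
    (h : ∀ θ ∈ Ico ((i : ℝ) / n) (((i : ℝ) + 1) / n), f θ = g θ) :
    ∫ θ in ((i : ℝ) / n)..(((i : ℝ) + 1) / n), f θ =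
      ∫ θ in ((i : ℝ) / n)..(((i : ℝ) + 1) / n), g θ := by
  rw [intervalIntegral.integral_of_le (cell_le i), intervalIntegral.integral_of_le (cell_le i),
    ← integral_Ico_eq_integral_Ioc, ← integral_Ico_eq_integral_Ioc]
  exact setIntegral_congr_fun measurableSet_Ico h

theorem integrable_comp_stepFun_mul {n : ℕ} (x : EuclideanSpace ℝ (Fin n)) {w : ℝ → ℝ}
    (hw : Integrable w torusMeasure) : Integrable (fun θ => stepFun x θ * w θ) torusMeasure :=
  hw.bdd_mul (measurable_stepFun x).aestronglyMeasurable (ae_of_all _ (abs_stepFun_le x))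

theorem integral_stepFun_mul {n : ℕ} (hn : 0 < n) (x : EuclideanSpace ℝ (Fin n)) {w : ℝ → ℝ}
    (hw : Integrable w torusMeasure) :
    ∫ θ, stepFun x θ * w θ ∂torusMeasure =
      ∑ i, x i * ∫ θ in ((i : ℝ) / n)..(((i : ℝ) + 1) / n), w θ := by
  rw [integral_torus_eq_sum_cells hn (integrable_comp_stepFun_mul x hw)]
  refine Finset.sum_congr rfl fun i _ => ?_
  rw [integral_cell_congr i (g := fun θ => x i * w θ) fun θ hθ => by simp only [stepFun_eq x i hθ]]
  exact intervalIntegral.integral_const_mul _ _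

theorem integral_stepFun {n : ℕ} (hn : 0 < n) (x : EuclideanSpace ℝ (Fin n)) :
    ∫ θ, stepFun x θ ∂torusMeasure = (n : ℝ)⁻¹ * ∑ i, x i := by
  have h := integral_stepFun_mul hn x (w := fun _ => 1) (integrable_const _)
  simp only [mul_one, intervalIntegral.integral_const, (cell_subset _).2.2, smul_eq_mul] at h
  rw [h, ← Finset.sum_mul, mul_comm]

/-- Applying a function to a step function gives the step function of the image vector. -/
theorem comp_stepFun {n : ℕ} (hn : 0 < n) (F : ℝ → ℝ) (x : EuclideanSpace ℝ (Fin n)) {θ : ℝ}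
    (hθ : θ ∈ Ico (0 : ℝ) 1) : F (stepFun x θ) = stepFun (WithLp.toLp 2 fun i => F (x i)) θ := by
  obtain ⟨i, hi⟩ := exists_cell hn hθ
  rw [stepFun_eq x i hi, stepFun_eq _ i hi]

theorem comp_stepFun_ae {n : ℕ} (hn : 0 < n) (F : ℝ → ℝ) (x : EuclideanSpace ℝ (Fin n)) :
    (fun θ => F (stepFun x θ)) =ᵐ[torusMeasure] stepFun (WithLp.toLp 2 fun i => F (x i)) :=
  ae_torus_mem.mono fun _ h => comp_stepFun hn F x h

theorem memL20_stepFun {n : ℕ} (y : meanZero n) : MemL20 (stepFun y.1) := by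
  refine ⟨memLp_stepFun _, ?_⟩
  rcases n.eq_zero_or_pos with rfl | hn
  · simp [stepFun]
  · rw [integral_stepFun hn, mem_meanZero.1 y.2, mul_zero]

theorem integral_stepFun_mul_stepFun {n : ℕ} (hn : 0 < n) (x y : EuclideanSpace ℝ (Fin n)) :
    ∫ θ, stepFun x θ * stepFun y θ ∂torusMeasure = (n : ℝ)⁻¹ * ∑ i, x i * y i := by
  rw [integral_stepFun_mul hn x ((memLp_stepFun y).integrable (by simp)), Finset.mul_sum]
  refine Finset.sum_congr rfl fun i _ => ?_
  rw [integral_cell_congr i (g := fun _ => y i) fun θ hθ => stepFun_eq y i hθ,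
    intervalIntegral.integral_const, (cell_subset i).2.2, smul_eq_mul]
  ring

/-! ### The discrete operators in terms of primitives of step functions -/

/-- The value of the primitive of a step function at the left end of a cell. -/
def primNode {n : ℕ} (x : meanZero n) (i : Fin n) : ℝ := prim (stepFun x.1) ((i : ℝ) / n)

theorem integrable_stepFun {n : ℕ} (x : EuclideanSpace ℝ (Fin n)) :
    Integrable (stepFun x) torusMeasure := (memLp_stepFun x).integrable (by simp)

theorem prim_one_eq_prim_zero {w : ℝ → ℝ} (hw : MemL20 w) : prim w 1 = prim w 0 := by
  have := prim_sub_prim (hw.1.integrable (by simp)) (a := 0) (b := 1) (by simp) (by simp)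
  rw [← integral_torus, hw.2] at this
  linarith

theorem prim_stepFun_eq {n : ℕ} (x : meanZero n) (i : Fin n) {θ : ℝ}
    (hθ : θ ∈ Icc ((i : ℝ) / n) (((i : ℝ) + 1) / n)) :
    prim (stepFun x.1) θ = primNode x i + x.1 i * (θ - i / n) := by
  obtain ⟨h1, h2, -⟩ := cell_subset i
  have h := prim_sub_prim (integrable_stepFun x.1) h1
    (show θ ∈ Icc (0 : ℝ) 1 from ⟨h1.1.trans hθ.1, hθ.2.trans h2.2⟩)
  have h3 : ∫ s in ((i : ℝ) / n)..θ, stepFun x.1 s = ∫ s in ((i : ℝ) / n)..θ, x.1 i := by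
    rw [intervalIntegral.integral_of_le hθ.1, intervalIntegral.integral_of_le hθ.1,
      ← integral_Ico_eq_integral_Ioc, ← integral_Ico_eq_integral_Ioc]
    exact setIntegral_congr_fun measurableSet_Ico fun s hs =>
      stepFun_eq x.1 i ⟨hs.1, hs.2.trans_le hθ.2⟩
  rw [h3, intervalIntegral.integral_const, smul_eq_mul] at h
  rw [primNode]; linarith

theorem prim_stepFun_right {n : ℕ} (x : meanZero n) (i : Fin n) :
    prim (stepFun x.1) (((i : ℝ) + 1) / n) = primNode x (finRotate n i) := by
  rcases n with _ | n
  · exact i.elim0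
  rw [primNode]
  by_cases hi : i = Fin.last n
  · have hn : ((n + 1 : ℕ) : ℝ) ≠ 0 := by positivity
    rw [hi, finRotate_last]
    have : ((Fin.last n : Fin (n + 1)) : ℝ) + 1 = ((n + 1 : ℕ) : ℝ) := by simp
    rw [this, div_self hn]
    simpa using prim_one_eq_prim_zero (memL20_stepFun x)
  · rw [coe_finRotate_of_ne_last hi]
    push_cast; rfl

theorem eq_mul_primNode_sub {n : ℕ} (x : meanZero n) (i : Fin n) :
    x.1 i = n * (primNode x (finRotate n i) - primNode x i) := by
  have hn : (n : ℝ) ≠ 0 := by have := i.pos; positivity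
  rw [← prim_stepFun_right, prim_stepFun_eq x i (right_mem_Icc.2 (cell_le i)), (cell_subset i).2.2]
  field_simp; ring

theorem integral_cell_prim {n : ℕ} (x : meanZero n) (i : Fin n) :
    ∫ θ in ((i : ℝ) / n)..(((i : ℝ) + 1) / n), prim (stepFun x.1) θ =
      (n : ℝ)⁻¹ * ((primNode x i + primNode x (finRotate n i)) / 2) := by
  have hn : (n : ℝ) ≠ 0 := by have := i.pos; positivity
  have hb : ((i : ℝ) + 1) / n = i / n + (n : ℝ)⁻¹ := by field_simp
  rw [integral_cell_congr i (g := fun θ => primNode x i + x.1 i * (θ - i / n)) fun θ hθ =>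
    prim_stepFun_eq x i (Ico_subset_Icc_self hθ),
    intervalIntegral.integral_comp_sub_right (fun θ => primNode x i + x.1 i * θ), sub_self,
    (cell_subset i).2.2, intervalIntegral.integral_add (by simp) (by
      apply Continuous.intervalIntegrable; fun_prop), intervalIntegral.integral_const,
    intervalIntegral.integral_const_mul, integral_id, eq_mul_primNode_sub]
  simp only [smul_eq_mul]
  field_simp; ring

/-- The integral of a product of two affine functions over a cell. -/
theorem integral_cell_prim_mul_prim {n : ℕ} (x y : meanZero n) (i : Fin n) :
    ∫ θ in ((i : ℝ) / n)..(((i : ℝ) + 1) / n), prim (stepFun x.1) θ * prim (stepFun y.1) θ =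
      (n : ℝ)⁻¹ * ((primNode x i * primNode y i +
        primNode x (finRotate n i) * primNode y (finRotate n i)) / 2 -
          (6 * (n : ℝ) ^ 2)⁻¹ * (x.1 i * y.1 i)) := by
  have hn : (n : ℝ) ≠ 0 := by have := i.pos; positivity
  rw [integral_cell_congr i (g := fun θ => (primNode x i + x.1 i * (θ - i / n)) *
    (primNode y i + y.1 i * (θ - i / n))) fun θ hθ => by
      rw [prim_stepFun_eq x i (Ico_subset_Icc_self hθ),
        prim_stepFun_eq y i (Ico_subset_Icc_self hθ)],
    intervalIntegral.integral_comp_sub_right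
      (fun θ => (primNode x i + x.1 i * θ) * (primNode y i + y.1 i * θ)), sub_self,
    (cell_subset i).2.2]
  have e : ∀ θ : ℝ, (primNode x i + x.1 i * θ) * (primNode y i + y.1 i * θ) =
      primNode x i * primNode y i + (primNode x i * y.1 i + primNode y i * x.1 i) * θ +
        x.1 i * y.1 i * θ ^ 2 := fun θ => by ring
  simp only [e]
  rw [intervalIntegral.integral_add (by apply Continuous.intervalIntegrable; fun_prop) (by
      apply Continuous.intervalIntegrable; fun_prop),
    intervalIntegral.integral_add (by simp) (by apply Continuous.intervalIntegrable; fun_prop),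
    intervalIntegral.integral_const, intervalIntegral.integral_const_mul,
    intervalIntegral.integral_const_mul, integral_id, integral_pow, eq_mul_primNode_sub x,
    eq_mul_primNode_sub y]
  simp only [smul_eq_mul]
  norm_num
  field_simp
  ring

theorem sum_primNode {n : ℕ} (x : meanZero n) : ∑ i, primNode x i = 0 := by
  rcases n.eq_zero_or_pos with rfl | hn
  · simp
  have hn' : (n : ℝ) ≠ 0 := by positivity
  have h := integral_prim (integrable_stepFun x.1)
  rw [integral_torus_eq_sum_cells hn ((memLp_prim (integrable_stepFun x.1)).integrable (by simp))]
    at h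
  simp only [integral_cell_prim] at h
  rw [← Finset.mul_sum, ← Finset.sum_div, Finset.sum_add_distrib,
    Equiv.sum_comp (finRotate n) (primNode x)] at h
  simpa [hn'] using h

/-- The scalar product of primitives of step functions, by the exact error formula of the
trapezoidal rule for products of affine functions. -/
theorem integral_prim_mul_prim {n : ℕ} (hn : 0 < n) (x y : meanZero n) :
    ∫ θ, prim (stepFun x.1) θ * prim (stepFun y.1) θ ∂torusMeasure +
      (6 * (n : ℝ) ^ 2)⁻¹ * ∫ θ, stepFun x.1 θ * stepFun y.1 θ ∂torusMeasure =
      (n : ℝ)⁻¹ * ∑ i, primNode x i * primNode y i := by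
  have hi : Integrable (fun θ => prim (stepFun x.1) θ * prim (stepFun y.1) θ) torusMeasure :=
    (memLp_prim (integrable_stepFun x.1)).integrable_mul (memLp_prim (integrable_stepFun y.1))
  rw [integral_torus_eq_sum_cells hn hi, integral_stepFun_mul_stepFun hn]
  simp only [integral_cell_prim_mul_prim]
  rw [← Finset.mul_sum, Finset.sum_sub_distrib, ← Finset.mul_sum, ← Finset.sum_div,
    Finset.sum_add_distrib, Equiv.sum_comp (finRotate n) (fun i => primNode x i * primNode y i)]
  ring

/-- A function on the discrete torus which is invariant under the shift is constant. -/
theorem eq_of_finRotate_invariant {n : ℕ} {f : Fin n → ℝ} (h : ∀ i, f (finRotate n i) = f i)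
    (i j : Fin n) : f i = f j := by
  rcases n with _ | n
  · exact i.elim0
  have hc : ∀ i : Fin (n + 1), f i = f 0 := by
    intro i
    induction i using Fin.induction with
    | zero => rfl
    | succ i ih =>
      have := h i.castSucc
      rw [finRotate_apply, Fin.coeSucc_eq_succ] at this
      rw [this, ih]
  rw [hc i, hc j]

/-- The discrete gradient of `A⁻¹ x` is minus the primitive of `x`. -/
theorem discreteGradient_eq {n : ℕ} (x w : meanZero n) (hw : opA n w = x) (i : Fin n) :
    n * (w.1 (finRotate n i) - w.1 i) = -primNode x (finRotate n i) := by
  have hn : (n : ℝ) ≠ 0 := by have := i.pos; positivity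
  set f : Fin n → ℝ := fun i =>
    n * (w.1 (finRotate n i) - w.1 i) + primNode x (finRotate n i) with hf
  have hinv : ∀ i, f (finRotate n i) = f i := by
    intro i
    set j := finRotate n i with hj
    have h1 : x.1 j = (n : ℝ) ^ 2 * (2 * w.1 j - w.1 (finRotate n j) - w.1 i) := by
      have h0 : (finRotate n).symm j = i := by rw [hj, Equiv.symm_apply_apply]
      rw [← hw]
      simp only [opA, LinearMap.coe_mk, AddHom.coe_mk, h0]
    have h2 := eq_mul_primNode_sub x j
    have h3 : (n : ℝ) * (f j - f i) = 0 := by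
      simp only [hf, ← hj]
      rw [h2] at h1
      linear_combination h1
    have := (mul_eq_zero.1 h3).resolve_left hn
    linarith
  have hsum : ∑ j, f j = 0 := by
    simp only [hf]
    rw [Finset.sum_add_distrib, ← Finset.mul_sum, Finset.sum_sub_distrib,
      Equiv.sum_comp (finRotate n) (fun i => w.1 i), Equiv.sum_comp (finRotate n) (primNode x),
      sum_primNode]
    simp
  have hconst : ∑ j, f j = n * f i := by
    rw [Finset.sum_congr rfl fun j _ => eq_of_finRotate_invariant hinv j i]
    simp
  have hfi : f i = 0 := by
    rw [hsum] at hconst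
    exact (mul_eq_zero.1 hconst.symm).resolve_left hn
  simp only [hf] at hfi
  linarith

theorem opA_inverse {n : ℕ} (x : meanZero n) : opA n (Ring.inverse (opA n) x) = x := by
  rw [← Module.End.mul_apply, Ring.mul_inverse_cancel _ (isUnit_opA _)]; rfl

theorem inner_meanZero {n : ℕ} (x y : meanZero n) : ⟪x, y⟫_ℝ = ∑ i, x.1 i * y.1 i := by
  simp [Submodule.coe_inner, PiLp.inner_apply, mul_comm]

/-- The discrete analogue of the `H⁻¹` scalar product, by summation by parts. -/
theorem inner_inverse_opA {n : ℕ} (x y : meanZero n) :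
    ⟪Ring.inverse (opA n) x, y⟫_ℝ = ∑ i, primNode x i * primNode y i := by
  set w := Ring.inverse (opA n) x with hw
  have hd := discreteGradient_eq x w (opA_inverse x)
  rw [inner_meanZero]
  have h1 : ∀ i, w.1 i * y.1 i = n * (w.1 i * primNode y (finRotate n i)) -
      n * (w.1 i * primNode y i) := fun i => by rw [eq_mul_primNode_sub y]; ring
  simp only [h1]
  rw [Finset.sum_sub_distrib, ← Equiv.sum_comp (finRotate n) (fun i => n * (w.1 i * primNode y i)),
    ← Equiv.sum_comp (finRotate n) (fun i => primNode x i * primNode y i),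
    ← Finset.sum_sub_distrib]
  refine Finset.sum_congr rfl fun i _ => ?_
  linear_combination (-primNode y (finRotate n i)) * hd i

theorem inner_inverse_opA_symm {n : ℕ} (x y : meanZero n) :
    ⟪Ring.inverse (opA n) x, y⟫_ℝ = ⟪x, Ring.inverse (opA n) y⟫_ℝ := by
  rw [inner_inverse_opA, real_inner_comm, inner_inverse_opA]
  simp only [mul_comm]

/-- The drift term involves no discretization error: after summation by parts, the centred
difference turns into the mean of the primitive at the two ends of a cell, which is its integral. -/
theorem inner_inverse_opA_opJ {n : ℕ} (hn : 0 < n) (x y : meanZero n) :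
    (n : ℝ)⁻¹ * ⟪Ring.inverse (opA n) (opJ n x), y⟫_ℝ =
      ∫ θ, stepFun x.1 θ * prim (stepFun y.1) θ ∂torusMeasure := by
  set w := Ring.inverse (opA n) y with hw
  have hd := discreteGradient_eq y w (opA_inverse y)
  rw [inner_inverse_opA_symm, ← hw, inner_meanZero, integral_stepFun_mul hn _
    ((memLp_prim (integrable_stepFun y.1)).integrable (by simp))]
  simp only [integral_cell_prim]
  have h1 : ∑ i, (opJ n x).1 i * w.1 i = ∑ i, x.1 i *
      ((primNode y i + primNode y (finRotate n i)) / 2) := by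
    have h2 : ∀ i, (opJ n x).1 i * w.1 i = (n : ℝ) / 2 * (x.1 (finRotate n i) * w.1 i) -
        (n : ℝ) / 2 * (x.1 ((finRotate n).symm i) * w.1 i) := fun i => by simp [opJ]; ring
    simp only [h2]
    rw [Finset.sum_sub_distrib,
      ← Equiv.sum_comp (finRotate n) (fun i => (n : ℝ) / 2 * (x.1 ((finRotate n).symm i) * w.1 i)),
      ← Equiv.sum_comp (finRotate n).symm (fun i => (n : ℝ) / 2 * (x.1 (finRotate n i) * w.1 i))]
    simp only [Equiv.apply_symm_apply, Equiv.symm_apply_apply]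
    rw [← Finset.sum_sub_distrib]
    refine Finset.sum_congr rfl fun i _ => ?_
    have h3 := hd i
    have h4 := hd ((finRotate n).symm i)
    rw [Equiv.apply_symm_apply] at h4
    linear_combination (-x.1 i / 2) * h3 - (x.1 i / 2) * h4
  rw [h1, Finset.mul_sum]
  exact Finset.sum_congr rfl fun i _ => by ring

/-- The extension of a macroscopic vector to a microscopic one which is constant on the blocks. -/
def blockExt {M : ℕ} (K : ℕ) (y : meanZero M) : meanZero (M * K) :=
  ⟨WithLp.toLp 2 fun j => y.1 (finProdFinEquiv.symm j).1, by
    rw [mem_meanZero, ← Equiv.sum_comp finProdFinEquiv, Fintype.sum_prod_type]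
    simp [← Finset.mul_sum, mem_meanZero.1 y.2]⟩

theorem blockExt_apply {M K : ℕ} (y : meanZero M) (i : Fin M) (r : Fin K) :
    (blockExt K y).1 (finProdFinEquiv (i, r)) = y.1 i := by
  simp only [blockExt, Equiv.symm_apply_apply]

theorem inner_smul_meanZero {n : ℕ} (c : ℝ) (x y : meanZero n) : ⟪x, c • y⟫_ℝ = c * ⟪x, y⟫_ℝ := by
  simp only [inner_meanZero, Submodule.coe_smul, PiLp.smul_apply, smul_eq_mul, Finset.mul_sum]
  exact Finset.sum_congr rfl fun i _ => by ring

/-- `N Pᵗ` extends a macroscopic vector to one that is constant on the blocks, which has the same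
step function. -/
theorem smul_opPt {M K : ℕ} (hM : 0 < M) (hK : 0 < K) (y : meanZero M) :
    ((M * K : ℕ) : ℝ) • opPt M K y = blockExt K y := by
  refine ext_inner_left ℝ fun x => ?_
  have hMr : (M : ℝ) ≠ 0 := by positivity
  have hKr : (K : ℝ) ≠ 0 := by positivity
  rw [inner_smul_meanZero, ← innerY_opP, inner_meanZero, innerY,
    ← Equiv.sum_comp finProdFinEquiv, Fintype.sum_prod_type, Finset.mul_sum, Finset.mul_sum]
  refine Finset.sum_congr rfl fun i _ => ?_
  simp only [blockExt_apply, opP, LinearMap.coe_mk, AddHom.coe_mk]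
  rw [← Finset.sum_mul]
  push_cast
  field_simp

theorem innerY_opP_eq {M K : ℕ} (hM : 0 < M) (hK : 0 < K) (x : meanZero (M * K)) (y : meanZero M) :
    innerY (opP M K x) y = ((M * K : ℕ) : ℝ)⁻¹ * ⟪x, blockExt K y⟫_ℝ := by
  have hN : ((M * K : ℕ) : ℝ) ≠ 0 := by
    have := Nat.mul_pos hM hK
    positivity
  rw [innerY_opP, ← smul_opPt hM hK, inner_smul_meanZero]
  field_simp

theorem stepFun_blockExt {M K : ℕ} (hM : 0 < M) (hK : 0 < K) (y : meanZero M) {θ : ℝ}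
    (hθ : θ ∈ Ico (0 : ℝ) 1) : stepFun (blockExt K y).1 θ = stepFun y.1 θ := by
  obtain ⟨j, hj⟩ := exists_cell (Nat.mul_pos hM hK) hθ
  obtain ⟨⟨i, r⟩, rfl⟩ := finProdFinEquiv.surjective j
  have hMr : (0 : ℝ) < M := by exact_mod_cast hM
  have hKr : (0 : ℝ) < K := by exact_mod_cast hK
  rw [stepFun_eq _ _ hj, blockExt_apply, stepFun_eq y.1 i]
  have hr0 : (0 : ℝ) ≤ r := by positivity
  have hr1 : (r : ℝ) + 1 ≤ K := by exact_mod_cast r.isLt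
  simp only [finProdFinEquiv_apply_val, Nat.cast_mul, Nat.cast_add, mem_Ico] at hj
  rw [div_le_iff₀ (by positivity), lt_div_iff₀ (by positivity)] at hj
  rw [mem_Ico, div_le_iff₀ hMr, lt_div_iff₀ hMr]
  constructor
  · refine le_of_mul_le_mul_right ?_ hKr
    nlinarith
  · refine lt_of_mul_lt_mul_right ?_ hKr.le
    nlinarith

theorem stepFun_blockExt_ae {M K : ℕ} (hM : 0 < M) (hK : 0 < K) (y : meanZero M) :
    stepFun (blockExt K y).1 =ᵐ[torusMeasure] stepFun y.1 :=
  ae_torus_mem.mono fun _ h => stepFun_blockExt hM hK y h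

theorem prim_blockExt_ae {M K : ℕ} (hM : 0 < M) (hK : 0 < K) (y : meanZero M) :
    prim (stepFun (blockExt K y).1) =ᵐ[torusMeasure] prim (stepFun y.1) :=
  ae_torus_mem.mono fun _ h => prim_congr (stepFun_blockExt_ae hM hK y) (Ico_subset_Icc_self h)

/-- The quadratic form of `Ā⁻¹` is the `H⁻¹` scalar product of step functions plus a multiple of
order `N⁻²` of their `L²` scalar product. -/
theorem innerY_macroAInv {M K : ℕ} (hM : 0 < M) (hK : 0 < K) (y v : meanZero M) :
    innerY (macroAInv M K y) v =
      ∫ θ, prim (stepFun y.1) θ * prim (stepFun v.1) θ ∂torusMeasure +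
        (6 * ((M * K : ℕ) : ℝ) ^ 2)⁻¹ * ∫ θ, stepFun y.1 θ * stepFun v.1 θ ∂torusMeasure := by
  have h1 : macroAInv M K y = opP M K (Ring.inverse (opA (M * K)) (blockExt K y)) := by
    rw [← smul_opPt hM hK, map_smul, map_smul]; rfl
  rw [h1, innerY_opP_eq hM hK, inner_inverse_opA, ← integral_prim_mul_prim (Nat.mul_pos hM hK)]
  congr 1
  · refine integral_congr_ae ?_
    filter_upwards [prim_blockExt_ae hM hK y, prim_blockExt_ae hM hK v] with θ h1 h2
    rw [h1, h2]
  · congr 1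
    refine integral_congr_ae ?_
    filter_upwards [stepFun_blockExt_ae hM hK y, stepFun_blockExt_ae hM hK v] with θ h1 h2
    rw [h1, h2]

/-- The drift term in `Ā⁻¹ J̄`, in terms of step functions. -/
theorem innerY_drift {M K : ℕ} (hM : 0 < M) (hK : 0 < K) (u v : meanZero M) :
    innerY (((M * K : ℕ) : ℝ) • opP M K (Ring.inverse (opA (M * K)) (opJ (M * K) (opPt M K u)))) v =
      ∫ θ, stepFun u.1 θ * prim (stepFun v.1) θ ∂torusMeasure := by
  rw [← map_smul, ← map_smul, ← map_smul, smul_opPt hM hK, innerY_opP_eq hM hK,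
    inner_inverse_opA_opJ (Nat.mul_pos hM hK)]
  refine integral_congr_ae ?_
  filter_upwards [stepFun_blockExt_ae hM hK u, prim_blockExt_ae hM hK v] with θ h1 h2
  rw [h1, h2]

theorem innerY_add_left {M : ℕ} (x y z : meanZero M) :
    innerY (x + y) z = innerY x z + innerY y z := by
  simp only [innerY_eq, inner_add_left, mul_add]

theorem innerY_neg_left {M : ℕ} (x z : meanZero M) : innerY (-x) z = -innerY x z := by
  simp only [innerY_eq, inner_neg_left, mul_neg]

theorem innerY_smul_left {M : ℕ} (c : ℝ) (x z : meanZero M) :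
    innerY (c • x) z = c * innerY x z := by
  rw [innerY_eq, innerY_eq, real_inner_comm, inner_smul_meanZero, real_inner_comm]; ring

/-- The image of the vector field `-(Ā + s J̄) u` under `Ā⁻¹`, tested against `v`. -/
theorem innerY_macroAInv_field {M K : ℕ} (hM : 0 < M) (hK : 0 < K) (s : ℝ) (u v : meanZero M) :
    innerY (macroAInv M K (-((macroA M K + macroJ s M K) u))) v =
      -innerY u v - s * ∫ θ, stepFun u.1 θ * prim (stepFun v.1) θ ∂torusMeasure := by
  have hinv : ∀ z, macroAInv M K (macroA M K z) = z := by
    intro z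
    rw [macroA, ← Module.End.mul_apply, Ring.mul_inverse_cancel _ (isUnit_macroAInv hM hK)]; rfl
  have h1 : macroAInv M K (-((macroA M K + macroJ s M K) u)) =
      -(u + s • (((M * K : ℕ) : ℝ) •
        opP M K (Ring.inverse (opA (M * K)) (opJ (M * K) (opPt M K u))))) := by
    rw [map_neg, LinearMap.add_apply, map_add, hinv, macroJ, LinearMap.comp_apply, hinv]
    simp only [LinearMap.smul_apply, LinearMap.comp_apply, map_smul]
    rw [smul_comm]
  rw [h1, innerY_neg_left, innerY_add_left, innerY_smul_left, innerY_drift hM hK]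
  ring

/-! ### The equation of motion in weak form -/

/-- The derivative of the coarse-grained Hamiltonian. -/
theorem hasFDerivAt_macroH {δψ : ℝ → ℝ} (hδ : ContDiff ℝ 2 δψ) {B : ℝ}
    (hB : ∀ x, |δψ x| ≤ B ∧ |deriv δψ x| ≤ B ∧ |iteratedDeriv 2 δψ x| ≤ B) {M K : ℕ} (hK : 0 < K)
    (y : meanZero M) :
    ∃ f' : meanZero M →L[ℝ] ℝ, HasFDerivAt (macroH (potential δψ) M K) f' y ∧
      ∀ v, f' v = (M : ℝ)⁻¹ * ∑ i, deriv (psiK (potential δψ) K) (y.1 i) * v.1 i := by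
  have hd := (psiK_properties hδ hB hK).1
  let p : Fin M → meanZero M →L[ℝ] ℝ := fun i =>
    (EuclideanSpace.proj i : EuclideanSpace ℝ (Fin M) →L[ℝ] ℝ) ∘L (meanZero M).subtypeL
  have hp : ∀ i (y : meanZero M), p i y = y.1 i := fun i y => rfl
  have h1 : ∀ i, HasFDerivAt (fun y : meanZero M => psiK (potential δψ) K (y.1 i))
      (deriv (psiK (potential δψ) K) (y.1 i) • p i) y := fun i => by
    have := (hd (p i y)).comp_hasFDerivAt y (p i).hasFDerivAt
    simpa only [hp] using! this
  have h2 := ((HasFDerivAt.fun_sum fun i (_ : i ∈ Finset.univ) => h1 i).const_mul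
    (M : ℝ)⁻¹).add_const (((M * K : ℕ) : ℝ)⁻¹ * Real.log (macroZ (potential δψ) M K))
  refine ⟨_, h2, fun v => ?_⟩
  simp [hp]

theorem innerY_ext {M : ℕ} (hM : 0 < M) {x y : meanZero M} (h : ∀ v, innerY x v = innerY y v) :
    x = y := by
  refine ext_inner_right ℝ fun v => ?_
  have := h v
  rw [innerY_eq, innerY_eq] at this
  have hMr : (M : ℝ)⁻¹ ≠ 0 := by positivity
  exact mul_left_cancel₀ hMr this

/-- The gradient of the coarse-grained Hamiltonian has the entries `ψ_K'(y_i)`, up to an additive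
constant which makes their mean vanish. -/
theorem gradY_macroH {δψ : ℝ → ℝ} (hδ : ContDiff ℝ 2 δψ) {B : ℝ}
    (hB : ∀ x, |δψ x| ≤ B ∧ |deriv δψ x| ≤ B ∧ |iteratedDeriv 2 δψ x| ≤ B) {M K : ℕ} (hM : 0 < M)
    (hK : 0 < K) (y : meanZero M) (i : Fin M) :
    (gradY (macroH (potential δψ) M K) y).1 i = deriv (psiK (potential δψ) K) (y.1 i) -
      (M : ℝ)⁻¹ * ∑ j, deriv (psiK (potential δψ) K) (y.1 j) := by
  have hMr : (M : ℝ) ≠ 0 := by positivity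
  set g := deriv (psiK (potential δψ) K) with hg
  set u : meanZero M := ⟨WithLp.toLp 2 fun i => g (y.1 i) - (M : ℝ)⁻¹ * ∑ j, g (y.1 j), by
    rw [mem_meanZero]
    simp only [Finset.sum_sub_distrib, Finset.sum_const, Finset.card_univ, Fintype.card_fin,
      nsmul_eq_mul]
    field_simp; simp⟩ with hu
  have : gradY (macroH (potential δψ) M K) y = u := by
    refine innerY_ext hM fun v => ?_
    obtain ⟨f', hf', hv⟩ := hasFDerivAt_macroH hδ hB (M := M) hK y
    rw [innerY_gradY hM, hf'.fderiv, hv, innerY]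
    congr 1
    simp only [hu, sub_mul, Finset.sum_sub_distrib, ← Finset.mul_sum, mem_meanZero.1 v.2, mul_zero,
      sub_zero, hg]
  rw [this]

/-- The equation of motion in weak form: it is an approximation of the weak formulation of the
limit equation, exact up to a term of order `N⁻²`, for test functions that are step functions. -/
theorem weak_form_macro {δψ : ℝ → ℝ} (hδ : ContDiff ℝ 2 δψ) {B : ℝ}
    (hB : ∀ x, |δψ x| ≤ B ∧ |deriv δψ x| ≤ B ∧ |iteratedDeriv 2 δψ x| ≤ B) {M K : ℕ} (hM : 0 < M)
    (hK : 0 < K) (s : ℝ) (y z v : meanZero M)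
    (hz : z = -((macroA M K + macroJ s M K) (gradY (macroH (potential δψ) M K) y))) :
    ∫ θ, prim (stepFun v.1) θ * prim (stepFun z.1) θ ∂torusMeasure +
        (6 * ((M * K : ℕ) : ℝ) ^ 2)⁻¹ * ∫ θ, stepFun v.1 θ * stepFun z.1 θ ∂torusMeasure =
      -(∫ θ, stepFun v.1 θ * deriv (psiK (potential δψ) K) (stepFun y.1 θ) ∂torusMeasure) -
        s * ∫ θ, prim (stepFun v.1) θ * deriv (psiK (potential δψ) K) (stepFun y.1 θ)
          ∂torusMeasure := by
  have h1 := innerY_macroAInv hM hK z v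
  rw [hz, innerY_macroAInv_field hM hK, ← hz] at h1
  simp only [mul_comm (prim (stepFun v.1) _) (prim (stepFun z.1) _),
    mul_comm (stepFun v.1 _) (stepFun z.1 _)]
  rw [← h1]
  set g := deriv (psiK (potential δψ) K) with hg
  set c := (M : ℝ)⁻¹ * ∑ j, g (y.1 j) with hc
  have hu := gradY_macroH hδ hB hM hK y
  rw [← hg] at hu
  set u := gradY (macroH (potential δψ) M K) y with hud
  congr 1
  · congr 1
    rw [integral_congr_ae
      (g := fun θ => stepFun v.1 θ * stepFun (WithLp.toLp 2 fun i => g (y.1 i)) θ)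
      ((comp_stepFun_ae hM g y.1).mono fun θ h => by simp only at h ⊢; rw [h]),
      integral_stepFun_mul_stepFun hM, innerY]
    congr 1
    simp only [hu, sub_mul, Finset.sum_sub_distrib, ← Finset.mul_sum, mem_meanZero.1 v.2, mul_zero,
      sub_zero]
    exact Finset.sum_congr rfl fun i _ => mul_comm _ _
  · congr 1
    have hpi := (memLp_prim (integrable_stepFun v.1)).integrable (by simp)
    have h3 : ∫ θ, stepFun u.1 θ * prim (stepFun v.1) θ ∂torusMeasure =
        ∫ θ, stepFun (WithLp.toLp 2 fun i => g (y.1 i)) θ * prim (stepFun v.1) θ -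
          c * prim (stepFun v.1) θ ∂torusMeasure := by
      refine integral_congr_ae (ae_torus_mem.mono fun θ hθ => ?_)
      obtain ⟨i, hi⟩ := exists_cell hM hθ
      simp only
      rw [stepFun_eq u.1 i hi, stepFun_eq _ i hi, hu]
      simp only [hc]; ring
    rw [h3, integral_sub (integrable_comp_stepFun_mul _ hpi) (hpi.const_mul c), integral_const_mul,
      integral_prim (integrable_stepFun v.1), mul_zero, sub_zero]
    refine integral_congr_ae ((comp_stepFun_ae hM g y.1).mono fun θ h => ?_)
    simp only at h ⊢
    rw [h, mul_comm]

/-! ### Functions of time and space -/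

/-- Lebesgue measure on the time interval `[0,T]`. -/
abbrev timeMeasure (T : ℝ) : Measure ℝ := volume.restrict (Icc 0 T)

theorem timeMeasure_eq_Ioc (T : ℝ) : timeMeasure T = volume.restrict (Ioc 0 T) :=
  (Measure.restrict_congr_set Ioc_ae_eq_Icc).symm

theorem integral_time {T : ℝ} (hT : 0 ≤ T) (f : ℝ → ℝ) :
    ∫ t, f t ∂timeMeasure T = ∫ t in (0 : ℝ)..T, f t := by
  rw [timeMeasure_eq_Ioc, intervalIntegral.integral_of_le hT]

theorem intervalIntegrable_of_time {T : ℝ} {f : ℝ → ℝ} (hf : Integrable f (timeMeasure T)) {a b : ℝ}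
    (ha : a ∈ Icc 0 T) (hb : b ∈ Icc 0 T) : IntervalIntegrable f volume a b := by
  have h : IntegrableOn f (Icc 0 T) := hf
  exact (h.mono_set (ordConnected_Icc.uIcc_subset ha hb)).intervalIntegrable

instance (T : ℝ) : IsFiniteMeasure (spaceTime T) := by unfold spaceTime; infer_instance

section Fubini
variable {T : ℝ} {f g : ℝ → ℝ → ℝ}

theorem memLp_slice_time (hf : MemLp (fun q : ℝ × ℝ => f q.1 q.2) 2 (spaceTime T)) :
    ∀ᵐ t ∂timeMeasure T, MemLp (f t) 2 torusMeasure := by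
  have h1 := (memLp_two_iff_integrable_sq hf.1).1 hf
  filter_upwards [h1.prod_right_ae, hf.1.prodMk_left] with t h2 h3
  exact (memLp_two_iff_integrable_sq h3).2 h2

theorem memLp_slice_torus (hf : MemLp (fun q : ℝ × ℝ => f q.1 q.2) 2 (spaceTime T)) :
    ∀ᵐ θ ∂torusMeasure, MemLp (fun t => f t θ) 2 (timeMeasure T) := by
  have h1 := (memLp_two_iff_integrable_sq hf.1).1 hf
  have h4 : AEStronglyMeasurable (fun q : ℝ × ℝ => f q.2 q.1) (torusMeasure.prod (timeMeasure T)) :=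
    hf.1.prod_swap
  filter_upwards [h1.prod_left_ae, h4.prodMk_left] with t h2 h3
  exact (memLp_two_iff_integrable_sq h3).2 h2

theorem integral_spaceTime {h : ℝ × ℝ → ℝ} (hh : Integrable h (spaceTime T)) :
    ∫ q, h q ∂spaceTime T = ∫ t, ∫ θ, h (t, θ) ∂torusMeasure ∂timeMeasure T :=
  integral_prod _ hh

theorem integral_spaceTime_symm {h : ℝ × ℝ → ℝ} (hh : Integrable h (spaceTime T)) :
    ∫ q, h q ∂spaceTime T = ∫ θ, ∫ t, h (t, θ) ∂timeMeasure T ∂torusMeasure :=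
  integral_prod_symm _ hh

theorem integrable_l2norm_sq (hf : MemLp (fun q : ℝ × ℝ => f q.1 q.2) 2 (spaceTime T)) :
    Integrable (fun t => l2norm torusMeasure (f t) ^ 2) (timeMeasure T) := by
  simp only [l2norm_sq]
  exact hf.integrable_sq.integral_prod_left

theorem integral_l2norm_sq (hf : MemLp (fun q : ℝ × ℝ => f q.1 q.2) 2 (spaceTime T)) :
    ∫ t, l2norm torusMeasure (f t) ^ 2 ∂timeMeasure T =
      ∫ q : ℝ × ℝ, f q.1 q.2 ^ 2 ∂spaceTime T := by
  simp only [l2norm_sq]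
  exact (integral_spaceTime hf.integrable_sq).symm

theorem ae_ae_of_ae_spaceTime {p : ℝ × ℝ → Prop} (h : ∀ᵐ q ∂spaceTime T, p q) :
    ∀ᵐ t ∂timeMeasure T, ∀ᵐ θ ∂torusMeasure, p (t, θ) := Measure.ae_ae_of_ae_prod h

theorem ae_spaceTime_mem : ∀ᵐ q ∂spaceTime T, q.1 ∈ Icc 0 T ∧ q.2 ∈ Ico (0 : ℝ) 1 := by
  rw [spaceTime, torusMeasure, Measure.prod_restrict]
  filter_upwards [ae_restrict_mem (measurableSet_Icc.prod measurableSet_Ico)] with q hq using hq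

end Fubini

/-- Measurability of an integral with variable end point, depending on a parameter. -/
theorem measurable_parametric_primitive {f : ℝ → ℝ → ℝ}
    (hf : Measurable fun q : ℝ × ℝ => f q.1 q.2) :
    Measurable fun q : ℝ × ℝ => ∫ x in (0 : ℝ)..q.1, f q.2 x := by
  have h : ∀ S : Set (ℝ × ℝ), MeasurableSet S →
      Measurable fun q : ℝ × ℝ => ∫ x in {x | (q.1, x) ∈ S}, f q.2 x := by
    intro S hS
    have h1 : Measurable fun p : (ℝ × ℝ) × ℝ =>
        ({p : (ℝ × ℝ) × ℝ | (p.1.1, p.2) ∈ S}).indicator (fun p => f p.1.2 p.2) p := by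
      refine Measurable.indicator ?_ ?_
      · exact hf.comp (by fun_prop : Measurable fun p : (ℝ × ℝ) × ℝ => (p.1.2, p.2))
      · exact hS.preimage (by fun_prop : Measurable fun p : (ℝ × ℝ) × ℝ => (p.1.1, p.2))
    have h2 := (h1.stronglyMeasurable.integral_prod_right' (ν := volume)).measurable
    convert h2 using 2 with q
    exact (integral_indicator
      (hS.preimage (by fun_prop : Measurable fun x : ℝ => (q.1, x)))).symm
  simp only [intervalIntegral]
  refine Measurable.sub ?_ ?_
  · exact h {p | p.2 ∈ Ioc 0 p.1} ((measurableSet_lt measurable_const measurable_snd).inter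
      (measurableSet_le measurable_snd measurable_fst))
  · exact h {p | p.2 ∈ Ioc p.1 0} ((measurableSet_lt measurable_fst measurable_snd).inter
      (measurableSet_le measurable_snd measurable_const))

theorem measurable_timeIntegral {V : ℝ → ℝ → ℝ} (hV : Measurable fun q : ℝ × ℝ => V q.1 q.2) :
    Measurable fun q : ℝ × ℝ => ∫ τ in (0 : ℝ)..q.1, V τ q.2 :=
  measurable_parametric_primitive (f := fun θ τ => V τ θ)
    (hV.comp (by fun_prop : Measurable fun q : ℝ × ℝ => (q.2, q.1)))

theorem measurable_prim {ζ : ℝ → ℝ → ℝ} (hζ : Measurable fun q : ℝ × ℝ => ζ q.1 q.2) :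
    Measurable fun q : ℝ × ℝ => prim (ζ q.1) q.2 := by
  have h1 : Measurable fun q : ℝ × ℝ => ∫ x in (0 : ℝ)..q.2, ζ q.1 x :=
    (measurable_parametric_primitive hζ).comp
      (by fun_prop : Measurable fun q : ℝ × ℝ => (q.2, q.1))
  have h2 : Measurable fun q : ℝ × ℝ => ∫ u in (0 : ℝ)..1, ∫ x in (0 : ℝ)..u, ζ q.1 x :=
    (measurable_parametric_primitive (f := fun t u => ∫ x in (0 : ℝ)..u, ζ t x) h1).comp
      (by fun_prop : Measurable fun q : ℝ × ℝ => ((1 : ℝ), q.1))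
  exact h1.sub h2

theorem memLp_prim_spaceTime {T : ℝ} {ζ : ℝ → ℝ → ℝ} (hζ : Measurable fun q : ℝ × ℝ => ζ q.1 q.2)
    (hL : MemLp (fun q : ℝ × ℝ => ζ q.1 q.2) 2 (spaceTime T)) :
    MemLp (fun q : ℝ × ℝ => prim (ζ q.1) q.2) 2 (spaceTime T) := by
  have hm := (measurable_prim hζ).aestronglyMeasurable (μ := spaceTime T)
  rw [memLp_two_iff_integrable_sq hm]
  have hm2 : AEStronglyMeasurable (fun q : ℝ × ℝ => prim (ζ q.1) q.2 ^ 2) (spaceTime T) := hm.pow 2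
  refine (integrable_prod_iff hm2).2 ⟨?_, ?_⟩
  · filter_upwards [memLp_slice_time hL] with t ht
    exact (memLp_prim (ht.integrable (by simp))).integrable_sq
  · refine ((integrable_l2norm_sq hL).const_mul 4).mono' hm2.norm.integral_prod_right' ?_
    filter_upwards [memLp_slice_time hL] with t ht
    have h1 := l2norm_prim_le ht
    have h2 : ∫ θ, ‖prim (ζ t) θ ^ 2‖ ∂torusMeasure = l2norm torusMeasure (prim (ζ t)) ^ 2 := by
      rw [l2norm_sq]; simp
    rw [h2, Real.norm_of_nonneg (sq_nonneg _)]
    nlinarith [l2norm_nonneg (ρ := torusMeasure) (f := prim (ζ t))]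

theorem sq_timeIntegral_le {T t : ℝ} {v : ℝ → ℝ} (hv : MemLp v 2 (timeMeasure T))
    (ht : t ∈ Icc 0 T) :
    (∫ τ in (0 : ℝ)..t, v τ) ^ 2 ≤ t * ∫ τ, v τ ^ 2 ∂timeMeasure T := by
  set ρ : Measure ℝ := volume.restrict (Ioc 0 t)
  have hle : ρ ≤ timeMeasure T :=
    Measure.restrict_mono (Ioc_subset_Icc_self.trans (Icc_subset_Icc_right ht.2)) le_rfl
  have h1 := abs_integral_mul_le (hv.mono_measure hle) (memLp_const (μ := ρ) (1 : ℝ))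
  have h2 : l2norm ρ (fun _ => (1 : ℝ)) = √t := by simp [l2norm, ρ, ht.1]
  simp only [mul_one, h2] at h1
  rw [intervalIntegral.integral_of_le ht.1, ← sq_abs]
  have h3 := pow_le_pow_left₀ (abs_nonneg _) h1 2
  rw [mul_pow, Real.sq_sqrt ht.1, l2norm_sq, mul_comm] at h3
  refine h3.trans (mul_le_mul_of_nonneg_left ?_ ht.1)
  exact integral_mono_measure hle (ae_of_all _ fun x => sq_nonneg _) hv.integrable_sq

section TimeIntegral
variable {T : ℝ} {V : ℝ → ℝ → ℝ}

theorem l2norm_timeIntegral_le (hVm : Measurable fun q : ℝ × ℝ => V q.1 q.2)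
    (hV : MemLp (fun q : ℝ × ℝ => V q.1 q.2) 2 (spaceTime T)) {t : ℝ} (ht : t ∈ Icc 0 T) :
    MemLp (fun θ => ∫ τ in (0 : ℝ)..t, V τ θ) 2 torusMeasure ∧
    l2norm torusMeasure (fun θ => ∫ τ in (0 : ℝ)..t, V τ θ) ^ 2 ≤
      t * ∫ q : ℝ × ℝ, V q.1 q.2 ^ 2 ∂spaceTime T := by
  have hm : AEStronglyMeasurable (fun θ => ∫ τ in (0 : ℝ)..t, V τ θ) torusMeasure :=
    ((measurable_timeIntegral hVm).comp
      (by fun_prop : Measurable fun θ : ℝ => (t, θ))).aestronglyMeasurable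
  have hint : Integrable (fun θ => t * ∫ τ, V τ θ ^ 2 ∂timeMeasure T) torusMeasure :=
    (hV.integrable_sq.integral_prod_right).const_mul t
  have hle : ∀ᵐ θ ∂torusMeasure, (∫ τ in (0 : ℝ)..t, V τ θ) ^ 2 ≤
      t * ∫ τ, V τ θ ^ 2 ∂timeMeasure T := by
    filter_upwards [memLp_slice_torus hV] with θ hθ
    exact sq_timeIntegral_le hθ ht
  have hi : Integrable (fun θ => (∫ τ in (0 : ℝ)..t, V τ θ) ^ 2) torusMeasure :=
    hint.mono' (hm.pow 2) (hle.mono fun θ h => by rwa [Real.norm_of_nonneg (sq_nonneg _)])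
  refine ⟨(memLp_two_iff_integrable_sq hm).2 hi, ?_⟩
  rw [l2norm_sq, integral_spaceTime_symm hV.integrable_sq, ← integral_const_mul]
  exact integral_mono_ae hi hint hle

theorem memLp_timeIntegral (hVm : Measurable fun q : ℝ × ℝ => V q.1 q.2)
    (hV : MemLp (fun q : ℝ × ℝ => V q.1 q.2) 2 (spaceTime T)) :
    MemLp (fun q : ℝ × ℝ => ∫ τ in (0 : ℝ)..q.1, V τ q.2) 2 (spaceTime T) := by
  have hm := (measurable_timeIntegral hVm).aestronglyMeasurable (μ := spaceTime T)
  rw [memLp_two_iff_integrable_sq hm]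
  have hm2 : AEStronglyMeasurable (fun q : ℝ × ℝ => (∫ τ in (0 : ℝ)..q.1, V τ q.2) ^ 2)
    (spaceTime T) := hm.pow 2
  refine (integrable_prod_iff hm2).2 ⟨?_, ?_⟩
  · filter_upwards [ae_restrict_mem measurableSet_Icc] with t ht
    exact (l2norm_timeIntegral_le hVm hV ht).1.integrable_sq
  · refine Integrable.of_bound hm2.norm.integral_prod_right'
      (T * ∫ q : ℝ × ℝ, V q.1 q.2 ^ 2 ∂spaceTime T) ?_
    filter_upwards [ae_restrict_mem measurableSet_Icc] with t ht
    have h2 := (l2norm_timeIntegral_le hVm hV ht).2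
    rw [l2norm_sq] at h2
    simp only [norm_pow, Real.norm_eq_abs, sq_abs]
    rw [abs_of_nonneg (integral_nonneg fun _ => sq_nonneg _)]
    refine h2.trans (mul_le_mul_of_nonneg_right ht.2 (integral_nonneg fun _ => sq_nonneg _))

/-- The time primitive `R(t) = R₀ + ∫₀ᵗ V` satisfies `‖R(t)‖² = ‖R₀‖² + 2 ∫₀ᵗ ∫ R V`. -/
theorem l2norm_sq_timePrimitive (hVm : Measurable fun q : ℝ × ℝ => V q.1 q.2)
    (hV : MemLp (fun q : ℝ × ℝ => V q.1 q.2) 2 (spaceTime T)) {R₀ : ℝ → ℝ}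
    (hR₀ : MemLp R₀ 2 torusMeasure) :
    Integrable (fun t => ∫ θ, (R₀ θ + ∫ τ in (0 : ℝ)..t, V τ θ) * V t θ ∂torusMeasure)
      (timeMeasure T) ∧
    ∀ t ∈ Icc 0 T, l2norm torusMeasure (fun θ => R₀ θ + ∫ τ in (0 : ℝ)..t, V τ θ) ^ 2 =
      l2norm torusMeasure R₀ ^ 2 + 2 * ∫ τ in (0 : ℝ)..t,
        ∫ θ, (R₀ θ + ∫ σ in (0 : ℝ)..τ, V σ θ) * V τ θ ∂torusMeasure := by
  have hR0' : MemLp (fun q : ℝ × ℝ => R₀ q.2) 2 (spaceTime T) := hR₀.comp_snd _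
  have hR : MemLp (fun q : ℝ × ℝ => R₀ q.2 + ∫ τ in (0 : ℝ)..q.1, V τ q.2) 2 (spaceTime T) :=
    hR0'.add (memLp_timeIntegral hVm hV)
  have hRV := integrable_mul_of_memLp hR hV
  refine ⟨hRV.integral_prod_left, fun t ht => ?_⟩
  have hpt : ∀ᵐ θ ∂torusMeasure, (R₀ θ + ∫ τ in (0 : ℝ)..t, V τ θ) ^ 2 =
      R₀ θ ^ 2 + 2 * ∫ τ in (0 : ℝ)..t, (R₀ θ + ∫ σ in (0 : ℝ)..τ, V σ θ) * V τ θ := by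
    filter_upwards [memLp_slice_torus hV] with θ hθ
    have hi := intervalIntegrable_of_time (hθ.integrable (by simp))
      (⟨le_rfl, ht.1.trans ht.2⟩ : (0 : ℝ) ∈ Icc 0 T) ht
    have h := integral_primitive_mul hi hi (R₀ θ) (R₀ θ)
    have h2 : ∫ x in (0 : ℝ)..t, V x θ * (R₀ θ + ∫ s in (0 : ℝ)..x, V s θ) =
        ∫ x in (0 : ℝ)..t, (R₀ θ + ∫ s in (0 : ℝ)..x, V s θ) * V x θ := by simp only [mul_comm]
    rw [h2] at h
    linarith
  have hle : (timeMeasure t).prod torusMeasure ≤ spaceTime T := by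
    rw [spaceTime, torusMeasure, Measure.prod_restrict, Measure.prod_restrict]
    exact Measure.restrict_mono (prod_mono (Icc_subset_Icc_right ht.2) le_rfl) le_rfl
  have hRVt : Integrable (fun q : ℝ × ℝ => (R₀ q.2 + ∫ τ in (0 : ℝ)..q.1, V τ q.2) * V q.1 q.2)
      (spaceTime t) := hRV.mono_measure hle
  have e1 : ∫ θ, (∫ τ in (0 : ℝ)..t, (R₀ θ + ∫ σ in (0 : ℝ)..τ, V σ θ) * V τ θ) ∂torusMeasure =
      ∫ τ in (0 : ℝ)..t, ∫ θ, (R₀ θ + ∫ σ in (0 : ℝ)..τ, V σ θ) * V τ θ ∂torusMeasure := by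
    simp only [← integral_time ht.1]
    rw [← integral_spaceTime hRVt, ← integral_spaceTime_symm hRVt]
  rw [l2norm_sq, l2norm_sq, integral_congr_ae hpt, integral_add hR₀.integrable_sq,
    integral_const_mul,
    e1]
  simp only [← integral_time ht.1]
  exact (hRVt.integral_prod_right).const_mul 2

end TimeIntegral

/-- Grönwall's inequality in integral form. -/
theorem le_exp_of_le_add_integral {ρ : ℝ → ℝ} {A C T : ℝ} (hC : 0 ≤ C)
    (hρ : ContinuousOn ρ (Icc 0 T))
    (h0 : ∀ t ∈ Icc 0 T, 0 ≤ ρ t) (h : ∀ t ∈ Icc 0 T, ρ t ≤ A + C * ∫ τ in (0 : ℝ)..t, ρ τ) :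
    ∀ t ∈ Icc 0 T, ρ t ≤ A * Real.exp (C * t) := by
  intro t ht
  have hT : 0 ≤ T := ht.1.trans ht.2
  have hA : 0 ≤ A := by
    have := h 0 ⟨le_rfl, hT⟩
    simp at this
    exact (h0 0 ⟨le_rfl, hT⟩).trans this
  set r := IccExtend hT (domRestrict (Icc 0 T) ρ) with hr
  have hrc : Continuous r := (continuousOn_iff_continuous_domRestrict.1 hρ).Icc_extend'
  have hre : ∀ x ∈ Icc 0 T, r x = ρ x := fun x hx => by
    rw [hr, IccExtend_of_mem _ _ hx]; rfl
  have hri : ∀ x ∈ Icc 0 T, ∫ τ in (0 : ℝ)..x, r τ = ∫ τ in (0 : ℝ)..x, ρ τ := fun x hx =>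
    intervalIntegral.integral_congr fun y hy => by
      rw [uIcc_of_le hx.1] at hy
      exact hre y ⟨hy.1, hy.2.trans hx.2⟩
  set H : ℝ → ℝ := fun t => A + C * ∫ τ in (0 : ℝ)..t, r τ with hH
  have hHd : ∀ x, HasDerivAt H (C * r x) x := fun x =>
    ((hrc.integral_hasStrictDerivAt 0 x).hasDerivAt.const_mul C).const_add A
  have hHr : ∀ x ∈ Icc 0 T, 0 ≤ r x ∧ r x ≤ H x := fun x hx => by
    rw [hre x hx, hH]
    simp only
    rw [hri x hx]
    exact ⟨h0 x hx, h x hx⟩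
  have := norm_le_gronwallBound_of_norm_deriv_right_le (f := H) (f' := fun x => C * r x)
    (δ := A) (K := C) (ε := 0) (a := 0) (b := T)
    (fun x _ => (hHd x).continuousAt.continuousWithinAt) (fun x _ => (hHd x).hasDerivWithinAt)
    (by simp [hH, abs_of_nonneg hA]) (fun x hx => by
      obtain ⟨h1, h2⟩ := hHr x (Ico_subset_Icc_self hx)
      rw [add_zero, Real.norm_of_nonneg (by positivity), Real.norm_of_nonneg (h1.trans h2)]
      gcongr) t ht
  rw [gronwallBound_ε0, sub_zero] at this
  obtain ⟨h1, h2⟩ := hHr t ht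
  rw [← hre t ht]
  exact h2.trans ((le_abs_self _).trans this)

/-! ### Approximate solutions and their stability -/

theorem continuous_of_lipschitz_bound {Φ : ℝ → ℝ} {Λ : ℝ} (hΛ : 0 < Λ)
    (hLip : ∀ x y, |Φ x - Φ y| ≤ Λ * |x - y|) : Continuous Φ := by
  refine LipschitzWith.continuous (K := ⟨Λ, hΛ.le⟩) (LipschitzWith.of_dist_le_mul fun x y => ?_)
  rw [Real.dist_eq, Real.dist_eq]; exact hLip x y

theorem memLp_comp_lipschitz {Ω : Type*} [MeasurableSpace Ω] {ρ : Measure Ω} [IsFiniteMeasure ρ]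
    {Φ : ℝ → ℝ} {Λ : ℝ} (hΛ : 0 < Λ) (hLip : ∀ x y, |Φ x - Φ y| ≤ Λ * |x - y|) {f : Ω → ℝ}
    (hf : MemLp f 2 ρ) : MemLp (fun x => Φ (f x)) 2 ρ := by
  refine ((hf.norm.const_mul Λ).add (memLp_const |Φ 0|)).of_le
    ((continuous_of_lipschitz_bound hΛ hLip).comp_aestronglyMeasurable hf.1)
    (ae_of_all _ fun θ => ?_)
  have := hLip (f θ) 0
  rw [sub_zero] at this
  simp only [Pi.add_apply, Real.norm_eq_abs]
  refine le_trans ?_ (le_abs_self _)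
  have h5 := abs_sub_abs_le_abs_sub (Φ (f θ)) (Φ 0)
  linarith

/-- Approximate solutions of `∂ζ/∂t = ∂²Φ(ζ)/∂θ² - s ∂Φ(ζ)/∂θ` on `[0,T] × 𝕋`. The time derivative
enters through `V`, the primitive of `∂ζ/∂t` in `θ` of average `0`: the primitive of `ζ` in `θ` is
the time primitive of `V` started from `R₀`, and `⟨g, ∂ζ/∂t⟩` in `H⁻¹` is `∫ G V` with `G' = g`. The
weak formulation holds with the flux `F` up to an error `e`, and `F` is `e`-close to `Φ(ζ)` in `L²`,
at almost every time. Both the weak solutions (with `e = 0`)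
and the step functions of the macroscopic dynamics are of this form. -/
structure ApproxSol (Φ : ℝ → ℝ) (s T : ℝ) (R₀ : ℝ → ℝ) (ζ V F : ℝ → ℝ → ℝ) (e : ℝ → ℝ) : Prop where
  measurable_ζ : Measurable fun q : ℝ × ℝ => ζ q.1 q.2
  measurable_V : Measurable fun q : ℝ × ℝ => V q.1 q.2
  memLp_ζ : MemLp (fun q : ℝ × ℝ => ζ q.1 q.2) 2 (spaceTime T)
  memLp_V : MemLp (fun q : ℝ × ℝ => V q.1 q.2) 2 (spaceTime T)
  memLp_F : MemLp (fun q : ℝ × ℝ => F q.1 q.2) 2 (spaceTime T)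
  memLp_e : MemLp e 2 (timeMeasure T)
  memLp_R₀ : MemLp R₀ 2 torusMeasure
  mean_ζ : ∀ᵐ t ∂timeMeasure T, ∫ θ, ζ t θ ∂torusMeasure = 0
  mean_V : ∀ᵐ t ∂timeMeasure T, ∫ θ, V t θ ∂torusMeasure = 0
  prim_eq : ∀ᵐ q ∂spaceTime T, prim (ζ q.1) q.2 = R₀ q.2 + ∫ τ in (0 : ℝ)..q.1, V τ q.2
  weak : ∀ᵐ t ∂timeMeasure T, ∀ g, MemL20 g →
    |∫ θ, prim g θ * V t θ ∂torusMeasure + ∫ θ, g θ * F t θ ∂torusMeasure +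
      s * ∫ θ, prim g θ * F t θ ∂torusMeasure| ≤ e t * l2norm torusMeasure g
  flux : ∀ᵐ t ∂timeMeasure T, l2norm torusMeasure (fun θ => F t θ - Φ (ζ t θ)) ≤ e t

/-- The differential inequality behind the comparison of approximate solutions, at a fixed time.
Here `w = ζ₁ - ζ₂`, `W = V₁ - V₂`, and the strong monotonicity of `Φ` absorbs all the terms
containing the `L²` norm of `w`. -/
theorem integral_prim_mul_le {Φ : ℝ → ℝ} {lam Λ s : ℝ} (hlam : 0 < lam) (hΛ : 0 < Λ)
    (hs : |s| = 1) (hmono : ∀ x y, lam * (x - y) ^ 2 ≤ (Φ x - Φ y) * (x - y))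
    (hLip : ∀ x y, |Φ x - Φ y| ≤ Λ * |x - y|) {z₁ z₂ v₁ v₂ f₁ f₂ : ℝ → ℝ} {e₁ e₂ : ℝ}
    (hz₁ : MemL20 z₁) (hz₂ : MemL20 z₂) (hv₁ : MemLp v₁ 2 torusMeasure)
    (hv₂ : MemLp v₂ 2 torusMeasure) (hf₁ : MemLp f₁ 2 torusMeasure) (hf₂ : MemLp f₂ 2 torusMeasure)
    (hw₁ : ∀ g, MemL20 g → |∫ θ, prim g θ * v₁ θ ∂torusMeasure + ∫ θ, g θ * f₁ θ ∂torusMeasure +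
      s * ∫ θ, prim g θ * f₁ θ ∂torusMeasure| ≤ e₁ * l2norm torusMeasure g)
    (hw₂ : ∀ g, MemL20 g → |∫ θ, prim g θ * v₂ θ ∂torusMeasure + ∫ θ, g θ * f₂ θ ∂torusMeasure +
      s * ∫ θ, prim g θ * f₂ θ ∂torusMeasure| ≤ e₂ * l2norm torusMeasure g)
    (hr₁ : l2norm torusMeasure (fun θ => f₁ θ - Φ (z₁ θ)) ≤ e₁)
    (hr₂ : l2norm torusMeasure (fun θ => f₂ θ - Φ (z₂ θ)) ≤ e₂) :
    ∫ θ, prim (fun θ => z₁ θ - z₂ θ) θ * (v₁ θ - v₂ θ) ∂torusMeasure ≤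
      -(lam / 2) * l2norm torusMeasure (fun θ => z₁ θ - z₂ θ) ^ 2 +
        (Λ ^ 2 / lam + 1 / 2) * l2norm torusMeasure (prim (fun θ => z₁ θ - z₂ θ)) ^ 2 +
        (4 / lam + 1 / 2) * (e₁ + e₂) ^ 2 := by
  have hΦz₁ : MemLp (fun θ => Φ (z₁ θ)) 2 torusMeasure := memLp_comp_lipschitz hΛ hLip hz₁.1
  have hΦz₂ : MemLp (fun θ => Φ (z₂ θ)) 2 torusMeasure := memLp_comp_lipschitz hΛ hLip hz₂.1
  set w : ℝ → ℝ := fun θ => z₁ θ - z₂ θ with hw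
  have hwL : MemLp w 2 torusMeasure := hz₁.1.sub hz₂.1
  have hw0 : MemL20 w := hz₁.sub hz₂
  have hp : MemLp (prim w) 2 torusMeasure := memLp_prim (hwL.integrable (by simp))
  set φ : ℝ → ℝ := fun θ => Φ (z₁ θ) - Φ (z₂ θ) with hφ
  have hφL : MemLp φ 2 torusMeasure := hΦz₁.sub hΦz₂
  set ρ : ℝ → ℝ := fun θ => f₁ θ - f₂ θ - φ θ with hρ
  have hρL : MemLp ρ 2 torusMeasure := (hf₁.sub hf₂).sub hφL
  have hφn : l2norm torusMeasure φ ≤ Λ * l2norm torusMeasure w := by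
    have e : l2norm torusMeasure (fun θ => Λ * w θ) = Λ * l2norm torusMeasure w := by
      rw [l2norm_const_mul, abs_of_pos hΛ]
    rw [← e]
    refine l2norm_mono (hwL.const_mul Λ) (ae_of_all _ fun θ => ?_)
    rw [abs_mul, abs_of_pos hΛ]; exact hLip _ _
  have hρn : l2norm torusMeasure ρ ≤ e₁ + e₂ := by
    have h3 := l2norm_sub_le (hf₁.sub hΦz₁) (hf₂.sub hΦz₂)
    have h4 : (fun θ => (f₁ - fun θ => Φ (z₁ θ)) θ - (f₂ - fun θ => Φ (z₂ θ)) θ) = ρ := by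
      funext θ; simp only [hρ, hφ, Pi.sub_apply]; ring
    rw [h4] at h3
    exact h3.trans (add_le_add hr₁ hr₂)
  -- the two weak formulations, tested with `w`
  have hweak : ∫ θ, prim w θ * (v₁ θ - v₂ θ) ∂torusMeasure ≤
      -(∫ θ, w θ * (f₁ θ - f₂ θ) ∂torusMeasure) - s * ∫ θ, prim w θ * (f₁ θ - f₂ θ) ∂torusMeasure +
        (e₁ + e₂) * l2norm torusMeasure w := by
    rw [integral_mul_sub hp hv₁ hv₂, integral_mul_sub hwL hf₁ hf₂, integral_mul_sub hp hf₁ hf₂]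
    have h1 := (abs_le.1 (hw₁ w hw0)).2
    have h2 := (abs_le.1 (hw₂ w hw0)).1
    nlinarith
  have hsplit : ∀ {a : ℝ → ℝ}, MemLp a 2 torusMeasure → ∫ θ, a θ * (f₁ θ - f₂ θ) ∂torusMeasure =
      ∫ θ, a θ * φ θ ∂torusMeasure + ∫ θ, a θ * ρ θ ∂torusMeasure := by
    intro a ha
    refine Eq.trans ?_ (integral_add (ha.integrable_mul hφL) (ha.integrable_mul hρL))
    refine integral_congr_ae (ae_of_all _ fun θ => ?_)
    simp only [hρ]; ring
  rw [hsplit hwL, hsplit hp] at hweak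
  have hm : lam * l2norm torusMeasure w ^ 2 ≤ ∫ θ, w θ * φ θ ∂torusMeasure := by
    rw [l2norm_sq, ← integral_const_mul]
    refine integral_mono (hwL.integrable_sq.const_mul lam) (hwL.integrable_mul hφL) fun θ => ?_
    have := hmono (z₁ θ) (z₂ θ)
    simp only [hw, hφ]; linarith
  set n := l2norm torusMeasure w with hn
  set r := l2norm torusMeasure (prim w) with hr
  have hn0 : 0 ≤ n := l2norm_nonneg
  have hr0 : 0 ≤ r := l2norm_nonneg
  set ε := e₁ + e₂ with hε
  have hε0 : 0 ≤ ε := l2norm_nonneg.trans hρn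
  have b1 : |∫ θ, w θ * ρ θ ∂torusMeasure| ≤ n * ε :=
    (abs_integral_mul_le hwL hρL).trans (by gcongr)
  have b2 : |s * (∫ θ, prim w θ * φ θ ∂torusMeasure + ∫ θ, prim w θ * ρ θ ∂torusMeasure)| ≤
      r * (Λ * n) + r * ε := by
    rw [abs_mul, hs, one_mul]
    refine (abs_add_le _ _).trans (add_le_add ?_ ?_)
    · exact (abs_integral_mul_le hp hφL).trans (by gcongr)
    · exact (abs_integral_mul_le hp hρL).trans (by gcongr)
  have hmain : ∫ θ, prim w θ * (v₁ θ - v₂ θ) ∂torusMeasure ≤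
      -lam * n ^ 2 + 2 * (n * ε) + r * (Λ * n) + r * ε := by
    have c1 := (abs_le.1 b1).1
    have c2 := (abs_le.1 b2).1
    linarith
  refine hmain.trans ?_
  -- Young's inequality, which leaves half of the coercive term `-lam * n ^ 2`
  have y1 : 2 * (n * ε) ≤ lam / 4 * n ^ 2 + 4 / lam * ε ^ 2 := by
    have : lam / 4 * n ^ 2 + 4 / lam * ε ^ 2 - 2 * (n * ε) = lam / 4 * (n - 4 / lam * ε) ^ 2 := by
      field_simp; ring
    nlinarith [mul_nonneg hlam.le (sq_nonneg (n - 4 / lam * ε))]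
  have y2 : r * (Λ * n) ≤ lam / 4 * n ^ 2 + Λ ^ 2 / lam * r ^ 2 := by
    have : lam / 4 * n ^ 2 + Λ ^ 2 / lam * r ^ 2 - r * (Λ * n) =
        lam / 4 * (n - 2 * Λ / lam * r) ^ 2 := by
      field_simp; ring
    nlinarith [mul_nonneg hlam.le (sq_nonneg (n - 2 * Λ / lam * r))]
  nlinarith [sq_nonneg (r - ε)]

/-- Stability: the distance of two approximate solutions, uniformly in time in `H⁻¹` and in
space-time in `L²`, is controlled by the distance of the initial data and by the errors. -/
theorem ApproxSol.stability {Φ : ℝ → ℝ} {lam Λ s T : ℝ} (hT : 0 < T) (hlam : 0 < lam) (hΛ : 0 < Λ)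
    (hs : |s| = 1) (hmono : ∀ x y, lam * (x - y) ^ 2 ≤ (Φ x - Φ y) * (x - y))
    (hLip : ∀ x y, |Φ x - Φ y| ≤ Λ * |x - y|) {R₁ R₂ : ℝ → ℝ} {ζ₁ V₁ F₁ ζ₂ V₂ F₂ : ℝ → ℝ → ℝ}
    {e₁ e₂ : ℝ → ℝ} (h₁ : ApproxSol Φ s T R₁ ζ₁ V₁ F₁ e₁) (h₂ : ApproxSol Φ s T R₂ ζ₂ V₂ F₂ e₂)
    {A C : ℝ} (hC : C = 2 * (Λ ^ 2 / lam + 1 / 2))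
    (hA : A = l2norm torusMeasure (fun θ => R₁ θ - R₂ θ) ^ 2 +
      2 * (4 / lam + 1 / 2) * ∫ t, (e₁ t + e₂ t) ^ 2 ∂timeMeasure T) :
    (∀ᵐ t ∂timeMeasure T,
      l2norm torusMeasure (prim fun θ => ζ₁ t θ - ζ₂ t θ) ^ 2 ≤ A * Real.exp (C * T)) ∧
    lam * ∫ q : ℝ × ℝ, (ζ₁ q.1 q.2 - ζ₂ q.1 q.2) ^ 2 ∂spaceTime T ≤
      A + C * (T * (A * Real.exp (C * T))) := by
  set w : ℝ → ℝ → ℝ := fun t θ => ζ₁ t θ - ζ₂ t θ with hw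
  set W : ℝ → ℝ → ℝ := fun t θ => V₁ t θ - V₂ t θ with hW
  set R₀ : ℝ → ℝ := fun θ => R₁ θ - R₂ θ with hR₀
  have hWm : Measurable fun q : ℝ × ℝ => W q.1 q.2 := h₁.measurable_V.sub h₂.measurable_V
  have hWL : MemLp (fun q : ℝ × ℝ => W q.1 q.2) 2 (spaceTime T) := h₁.memLp_V.sub h₂.memLp_V
  have hwL : MemLp (fun q : ℝ × ℝ => w q.1 q.2) 2 (spaceTime T) := h₁.memLp_ζ.sub h₂.memLp_ζ
  have hRL : MemLp R₀ 2 torusMeasure := h₁.memLp_R₀.sub h₂.memLp_R₀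
  set R : ℝ → ℝ → ℝ := fun t θ => R₀ θ + ∫ τ in (0 : ℝ)..t, W τ θ with hR
  have hCpos : 0 ≤ C := by rw [hC]; positivity
  -- the primitive of `w` is almost everywhere equal to the continuous version `R`
  have hprim : ∀ᵐ t ∂timeMeasure T, prim (w t) =ᵐ[torusMeasure] R t := by
    have hVs : ∀ᵐ q ∂spaceTime T, (∫ τ in (0 : ℝ)..q.1, W τ q.2) =
        (∫ τ in (0 : ℝ)..q.1, V₁ τ q.2) - ∫ τ in (0 : ℝ)..q.1, V₂ τ q.2 := by
      have hsw : ∀ᵐ θ ∂torusMeasure, MemLp (fun t => V₁ t θ) 2 (timeMeasure T) ∧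
          MemLp (fun t => V₂ t θ) 2 (timeMeasure T) :=
        (memLp_slice_torus h₁.memLp_V).and (memLp_slice_torus h₂.memLp_V)
      have hsw2 : ∀ᵐ q ∂spaceTime T, MemLp (fun t => V₁ t q.2) 2 (timeMeasure T) ∧
          MemLp (fun t => V₂ t q.2) 2 (timeMeasure T) :=
        Measure.quasiMeasurePreserving_snd.ae hsw
      filter_upwards [hsw2, ae_spaceTime_mem] with q hq hm
      have h0 : (0 : ℝ) ∈ Icc 0 T := ⟨le_rfl, hT.le⟩
      exact intervalIntegral.integral_sub
        (intervalIntegrable_of_time (hq.1.integrable (by simp)) h0 hm.1)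
        (intervalIntegrable_of_time (hq.2.integrable (by simp)) h0 hm.1)
    filter_upwards [ae_ae_of_ae_spaceTime (h₁.prim_eq.and (h₂.prim_eq.and hVs)),
      memLp_slice_time h₁.memLp_ζ, memLp_slice_time h₂.memLp_ζ] with t ht ht1 ht2
    filter_upwards [ht, ae_torus_mem] with θ hθ hθm
    simp only [hw, hR, hR₀]
    rw [prim_sub (ht1.integrable (by simp)) (ht2.integrable (by simp)) (Ico_subset_Icc_self hθm),
      hθ.2.2, hθ.1, hθ.2.1]
    ring
  obtain ⟨hki, henergy⟩ := l2norm_sq_timePrimitive hWm hWL hRL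
  set k : ℝ → ℝ := fun t => ∫ θ, (R₀ θ + ∫ τ in (0 : ℝ)..t, W τ θ) * W t θ ∂torusMeasure with hk
  set ρ : ℝ → ℝ := fun t => l2norm torusMeasure (R t) ^ 2 with hρ
  have hρeq : ∀ t ∈ Icc 0 T, ρ t = l2norm torusMeasure R₀ ^ 2 + 2 * ∫ τ in (0 : ℝ)..t, k τ :=
    henergy
  have hρc : ContinuousOn ρ (Icc 0 T) := by
    refine ContinuousOn.congr ?_ hρeq
    refine continuousOn_const.add (continuousOn_const.mul ?_)
    rw [← uIcc_of_le hT.le]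
    exact intervalIntegral.continuousOn_primitive_interval'
      (intervalIntegrable_of_time hki ⟨le_rfl, hT.le⟩ ⟨hT.le, le_rfl⟩) left_mem_uIcc
  set n2 : ℝ → ℝ := fun t => l2norm torusMeasure (w t) ^ 2 with hn2
  set E : ℝ → ℝ := fun t => (e₁ t + e₂ t) ^ 2 with hE
  have hn2i : Integrable n2 (timeMeasure T) := integrable_l2norm_sq hwL
  have hEi : Integrable E (timeMeasure T) := (h₁.memLp_e.add h₂.memLp_e).integrable_sq
  have hρi : Integrable ρ (timeMeasure T) := hρc.integrableOn_Icc
  have hkle : ∀ᵐ t ∂timeMeasure T, k t ≤ -(lam / 2) * n2 t + (Λ ^ 2 / lam + 1 / 2) * ρ t +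
      (4 / lam + 1 / 2) * E t := by
    filter_upwards [hprim, memLp_slice_time h₁.memLp_ζ, memLp_slice_time h₂.memLp_ζ,
      memLp_slice_time h₁.memLp_V, memLp_slice_time h₂.memLp_V, memLp_slice_time h₁.memLp_F,
      memLp_slice_time h₂.memLp_F, h₁.mean_ζ, h₂.mean_ζ, h₁.weak, h₂.weak, h₁.flux, h₂.flux]
      with t hp hz1 hz2 hv1 hv2 hf1 hf2 hm1 hm2 hw1 hw2 hr1 hr2
    have := integral_prim_mul_le hlam hΛ hs hmono hLip ⟨hz1, hm1⟩ ⟨hz2, hm2⟩ hv1 hv2 hf1 hf2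
      hw1 hw2 hr1 hr2
    have e1 : k t = ∫ θ, prim (w t) θ * (V₁ t θ - V₂ t θ) ∂torusMeasure :=
      integral_congr_ae (hp.mono fun θ hθ => by simp only [hθ, hR, hW])
    have e2 : ρ t = l2norm torusMeasure (prim (w t)) ^ 2 := by
      rw [hρ]; simp only; rw [l2norm_congr hp]
    rw [e1, e2]
    exact this
  have hineq : ∀ t ∈ Icc 0 T, ρ t + lam * ∫ τ in (0 : ℝ)..t, n2 τ ≤
      A + C * ∫ τ in (0 : ℝ)..t, ρ τ := by
    intro t ht
    have h0 : (0 : ℝ) ∈ Icc 0 T := ⟨le_rfl, hT.le⟩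
    have ii : ∀ {f : ℝ → ℝ}, Integrable f (timeMeasure T) → IntervalIntegrable f volume 0 t :=
      fun hf => intervalIntegrable_of_time hf h0 ht
    have i1 : ∫ τ in (0 : ℝ)..t, k τ ≤ ∫ τ in (0 : ℝ)..t, (-(lam / 2) * n2 τ +
        (Λ ^ 2 / lam + 1 / 2) * ρ τ + (4 / lam + 1 / 2) * E τ) := by
      refine intervalIntegral.integral_mono_ae_restrict ht.1 (ii hki)
        ((((ii hn2i).const_mul _).add ((ii hρi).const_mul _)).add ((ii hEi).const_mul _)) ?_
      exact ae_restrict_of_ae_restrict_of_subset (Icc_subset_Icc_right ht.2) hkle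
    rw [intervalIntegral.integral_add (((ii hn2i).const_mul _).add ((ii hρi).const_mul _))
        ((ii hEi).const_mul _), intervalIntegral.integral_add ((ii hn2i).const_mul _)
        ((ii hρi).const_mul _), intervalIntegral.integral_const_mul,
      intervalIntegral.integral_const_mul, intervalIntegral.integral_const_mul] at i1
    have i2 : ∫ τ in (0 : ℝ)..t, E τ ≤ ∫ t, (e₁ t + e₂ t) ^ 2 ∂timeMeasure T := by
      rw [integral_time hT.le]
      exact intervalIntegral.integral_mono_interval le_rfl ht.1 ht.2
        (ae_of_all _ fun x => sq_nonneg _) (intervalIntegrable_of_time hEi h0 ⟨hT.le, le_rfl⟩)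
    have i3 := mul_le_mul_of_nonneg_left i2 (by positivity : 0 ≤ 2 * (4 / lam + 1 / 2))
    rw [hρeq t ht, hA, hC]
    linarith
  have hn2nonneg : ∀ t ∈ Icc 0 T, 0 ≤ ∫ τ in (0 : ℝ)..t, n2 τ := fun t ht =>
    intervalIntegral.integral_nonneg ht.1 fun _ _ => sq_nonneg _
  have hA0 : 0 ≤ A := by
    have : 0 ≤ ∫ t, (e₁ t + e₂ t) ^ 2 ∂timeMeasure T := integral_nonneg fun _ => sq_nonneg _
    rw [hA]; positivity
  have hgron := le_exp_of_le_add_integral (A := A) (C := C) hCpos hρc (fun t _ => sq_nonneg _)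
    fun t ht => by
      have := mul_nonneg hlam.le (hn2nonneg t ht)
      linarith [hineq t ht]
  have hbound : ∀ t ∈ Icc 0 T, ρ t ≤ A * Real.exp (C * T) := fun t ht =>
    (hgron t ht).trans (by gcongr; exact ht.2)
  constructor
  · filter_upwards [hprim, ae_restrict_mem measurableSet_Icc] with t hp ht
    rw [l2norm_congr hp]
    exact hbound t ht
  · have hTm : T ∈ Icc 0 T := ⟨hT.le, le_rfl⟩
    have h3 := hineq T hTm
    rw [← integral_time hT.le, ← integral_time hT.le, integral_l2norm_sq hwL] at h3
    have h4 : ∫ τ, ρ τ ∂timeMeasure T ≤ T * (A * Real.exp (C * T)) := by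
      have := integral_mono_ae hρi (integrable_const (A * Real.exp (C * T)))
        ((ae_restrict_mem measurableSet_Icc).mono hbound)
      simpa [hT.le] using this
    have h5 : 0 ≤ ρ T := sq_nonneg _
    have h6 := mul_le_mul_of_nonneg_left h4 hCpos
    linarith

/-! ### Averages over cells -/

/-- The vector of the averages of `g` over the cells `[i/n, (i+1)/n)`. -/
def cellAverage (n : ℕ) (g : ℝ → ℝ) : EuclideanSpace ℝ (Fin n) :=
  WithLp.toLp 2 fun i => n * ∫ θ in ((i : ℝ) / n)..(((i : ℝ) + 1) / n), g θ

theorem cellAverage_mem_meanZero {n : ℕ} (hn : 0 < n) {g : ℝ → ℝ} (hg : MemL20 g) :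
    cellAverage n g ∈ meanZero n := by
  rw [mem_meanZero]
  simp only [cellAverage, ← Finset.mul_sum]
  rw [← integral_torus_eq_sum_cells hn (hg.1.integrable (by simp)), hg.2, mul_zero]

theorem integral_cellAverage_mul {n : ℕ} (hn : 0 < n) {g : ℝ → ℝ} (hg : MemLp g 2 torusMeasure)
    (x : EuclideanSpace ℝ (Fin n)) :
    ∫ θ, stepFun (cellAverage n g) θ * stepFun x θ ∂torusMeasure =
      ∫ θ, g θ * stepFun x θ ∂torusMeasure := by
  have hn' : (n : ℝ) ≠ 0 := by positivity
  simp only [mul_comm _ (stepFun x _)]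
  rw [integral_stepFun_mul_stepFun hn, integral_stepFun_mul hn x (hg.integrable (by simp)),
    Finset.mul_sum]
  refine Finset.sum_congr rfl fun i _ => ?_
  simp only [cellAverage]
  field_simp

theorem l2norm_cellAverage_le {n : ℕ} (hn : 0 < n) {g : ℝ → ℝ} (hg : MemLp g 2 torusMeasure) :
    l2norm torusMeasure (stepFun (cellAverage n g)) ≤ l2norm torusMeasure g := by
  have h1 := integral_cellAverage_mul hn hg (cellAverage n g)
  have h2 := le_of_abs_le (abs_integral_mul_le hg (memLp_stepFun (cellAverage n g)))
  have h3 := l2norm_sq (ρ := torusMeasure) (f := stepFun (cellAverage n g))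
  simp only [sq] at h3
  rw [← h1, ← h3] at h2
  rcases (l2norm_nonneg (ρ := torusMeasure) (f := stepFun (cellAverage n g))).eq_or_lt with h | h
  · rw [← h]; exact l2norm_nonneg
  · exact le_of_mul_le_mul_right h2 h

/-- The Cauchy-Schwarz bound of an integral over a subinterval of the torus. -/
theorem abs_integral_le_sqrt_mul_l2norm {h : ℝ → ℝ} (hh : MemLp h 2 torusMeasure) {a b : ℝ}
    (ha : 0 ≤ a) (hab : a ≤ b) (hb : b ≤ 1) :
    |∫ θ in a..b, h θ| ≤ √(b - a) * l2norm torusMeasure h := by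
  have hle : volume.restrict (Ioc a b) ≤ torusMeasure := by
    rw [torusMeasure_eq_Ioc]
    exact Measure.restrict_mono (Ioc_subset_Ioc ha hb) le_rfl
  have h1 := abs_integral_mul_le (memLp_const (μ := volume.restrict (Ioc a b)) (1 : ℝ))
    (hh.mono_measure hle)
  simp only [one_mul] at h1
  rw [intervalIntegral.integral_of_le hab]
  refine h1.trans (mul_le_mul ?_ ?_ l2norm_nonneg (Real.sqrt_nonneg _))
  · simp [l2norm, hab]
  · exact Real.sqrt_le_sqrt (integral_mono_measure hle (ae_of_all _ fun x => sq_nonneg _)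
      hh.integrable_sq)

/-- The difference of `g` and its cell averages has a small primitive, because this primitive
vanishes at all the nodes `i/n`. -/
theorem abs_prim_sub_prim_cellAverage_le {n : ℕ} (hn : 0 < n) {g : ℝ → ℝ} (hg : MemL20 g) {θ : ℝ}
    (hθ : θ ∈ Icc (0 : ℝ) 1) :
    |prim g θ - prim (stepFun (cellAverage n g)) θ| ≤ 4 / √n * l2norm torusMeasure g := by
  have hn' : (0 : ℝ) < n := by exact_mod_cast hn
  set x := cellAverage n g with hx
  set h : ℝ → ℝ := fun θ => g θ - stepFun x θ with hh
  have hL : MemLp h 2 torusMeasure := hg.1.sub (memLp_stepFun x)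
  have hi : Integrable h torusMeasure := hL.integrable (by simp)
  have hgi : Integrable g torusMeasure := hg.1.integrable (by simp)
  have hhn : l2norm torusMeasure h ≤ 2 * l2norm torusMeasure g := by
    have := l2norm_sub_le hg.1 (memLp_stepFun x)
    have := l2norm_cellAverage_le hn hg.1
    linarith
  have hcell : ∀ i : Fin n, ∫ θ in ((i : ℝ) / n)..(((i : ℝ) + 1) / n), h θ = 0 := by
    intro i
    obtain ⟨h1, h2, h3⟩ := cell_subset i
    rw [intervalIntegral.integral_sub (intervalIntegrable_of_torus' hgi h1 h2)
      (intervalIntegrable_of_torus' (integrable_stepFun x) h1 h2),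
      integral_cell_congr i (g := fun _ => x i) fun θ hθ => stepFun_eq x i hθ,
      intervalIntegral.integral_const, h3, hx]
    simp only [cellAverage, smul_eq_mul]
    field_simp
    simp
  -- the primitive of `h` vanishes at the nodes, so only the last, incomplete cell contributes
  have hnode : ∀ k : ℕ, k ≤ n → ∫ θ in (0 : ℝ)..(k : ℝ) / n, h θ = 0 := by
    intro k
    induction k with
    | zero => intro _; simp
    | succ k ih =>
      intro hk
      have h1 := cell_subset (⟨k, hk⟩ : Fin n)
      have h2 := hcell ⟨k, hk⟩
      simp only at h1 h2
      rw [Nat.cast_succ, ← intervalIntegral.integral_add_adjacent_intervals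
        (intervalIntegrable_of_torus' hi ⟨le_rfl, zero_le_one⟩ h1.1)
        (intervalIntegrable_of_torus' hi h1.1 h1.2.1), h2, ih (by omega), add_zero]
  have hprim : ∀ u ∈ Icc (0 : ℝ) 1, |∫ s in (0 : ℝ)..u, h s| ≤
      2 / √n * l2norm torusMeasure g := by
    intro u hu
    have hpos : 0 ≤ 2 / √n * l2norm torusMeasure g := mul_nonneg (by positivity) l2norm_nonneg
    rcases hu.2.eq_or_lt with rfl | hu1
    · have := hnode n le_rfl
      rw [div_self hn'.ne'] at this
      rwa [this, abs_zero]
    · obtain ⟨i, hiu⟩ := exists_cell hn ⟨hu.1, hu1⟩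
      obtain ⟨h1, h2, h3⟩ := cell_subset i
      rw [← intervalIntegral.integral_add_adjacent_intervals
        (intervalIntegrable_of_torus' hi ⟨le_rfl, zero_le_one⟩ h1)
        (intervalIntegrable_of_torus' hi h1 hu), hnode i i.isLt.le, zero_add]
      refine (abs_integral_le_sqrt_mul_l2norm hL h1.1 hiu.1 hu.2).trans ?_
      have h4 : √(u - i / n) ≤ 1 / √n := by
        rw [← Real.sqrt_one, ← Real.sqrt_div zero_le_one]
        refine Real.sqrt_le_sqrt ?_
        rw [one_div, ← h3]; linarith [hiu.2]
      calc √(u - i / n) * l2norm torusMeasure h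
          ≤ 1 / √n * (2 * l2norm torusMeasure g) :=
            mul_le_mul h4 hhn l2norm_nonneg (by positivity)
        _ = _ := by ring
  rw [← prim_sub hgi (integrable_stepFun x) hθ]
  refine (abs_prim_le_of_primitive hprim hθ).trans (le_of_eq ?_)
  ring

/-- The weak formulation of the macroscopic dynamics, with an arbitrary test function `g`: testing
with the cell averages of `g` instead produces a small error only. -/
theorem abs_weak_form_macro_le {δψ : ℝ → ℝ} (hδ : ContDiff ℝ 2 δψ) {B : ℝ}
    (hB : ∀ x, |δψ x| ≤ B ∧ |deriv δψ x| ≤ B ∧ |iteratedDeriv 2 δψ x| ≤ B) {M K : ℕ} (hM : 0 < M)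
    (hK : 0 < K) {s : ℝ} (hs : |s| = 1) {y z : meanZero M}
    (hz : z = -((macroA M K + macroJ s M K) (gradY (macroH (potential δψ) M K) y)))
    {g : ℝ → ℝ} (hg : MemL20 g) :
    |∫ θ, prim g θ * prim (stepFun z.1) θ ∂torusMeasure +
      ∫ θ, g θ * deriv (psiK (potential δψ) K) (stepFun y.1 θ) ∂torusMeasure +
      s * ∫ θ, prim g θ * deriv (psiK (potential δψ) K) (stepFun y.1 θ) ∂torusMeasure| ≤
    (4 / √M * (l2norm torusMeasure (prim (stepFun z.1)) +
      l2norm torusMeasure (fun θ => deriv (psiK (potential δψ) K) (stepFun y.1 θ))) +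
      (6 * ((M * K : ℕ) : ℝ) ^ 2)⁻¹ * l2norm torusMeasure (stepFun z.1)) *
      l2norm torusMeasure g := by
  set F : ℝ → ℝ := fun θ => deriv (psiK (potential δψ) K) (stepFun y.1 θ) with hF
  set v : meanZero M := ⟨cellAverage M g, cellAverage_mem_meanZero hM hg⟩ with hv
  have hFx := comp_stepFun_ae hM (deriv (psiK (potential δψ) K)) y.1
  have hFL : MemLp F 2 torusMeasure := (memLp_stepFun _).ae_eq hFx.symm
  have hVL : MemLp (prim (stepFun z.1)) 2 torusMeasure := memLp_prim (integrable_stepFun _)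
  have hpg : MemLp (prim g) 2 torusMeasure := memLp_prim (hg.1.integrable (by simp))
  have hpv : MemLp (prim (stepFun v.1)) 2 torusMeasure := memLp_prim (integrable_stepFun _)
  have hw := weak_form_macro hδ hB hM hK s y z v hz
  have hgF : ∫ θ, stepFun v.1 θ * F θ ∂torusMeasure = ∫ θ, g θ * F θ ∂torusMeasure := by
    refine Eq.trans ?_ ((integral_cellAverage_mul hM hg.1
      (WithLp.toLp 2 fun i => deriv (psiK (potential δψ) K) (y.1 i))).trans ?_)
    · exact integral_congr_ae (hFx.mono fun θ h => by simp only [hF, hv, h])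
    · exact integral_congr_ae (hFx.mono fun θ h => by simp only [hF, h])
  set d : ℝ → ℝ := fun θ => prim g θ - prim (stepFun v.1) θ with hd
  have hdL : MemLp d 2 torusMeasure := hpg.sub hpv
  have hdn : l2norm torusMeasure d ≤ 4 / √M * l2norm torusMeasure g :=
    l2norm_le_of_bound (mul_nonneg (by positivity) l2norm_nonneg) (ae_torus_mem.mono fun θ hθ =>
      abs_prim_sub_prim_cellAverage_le hM hg (Ico_subset_Icc_self hθ))
  have hsplit : ∀ {a : ℝ → ℝ}, MemLp a 2 torusMeasure → ∫ θ, prim g θ * a θ ∂torusMeasure =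
      ∫ θ, d θ * a θ ∂torusMeasure + ∫ θ, prim (stepFun v.1) θ * a θ ∂torusMeasure := by
    intro a ha
    refine Eq.trans ?_ (integral_add (hdL.integrable_mul ha) (hpv.integrable_mul ha))
    refine integral_congr_ae (ae_of_all _ fun θ => ?_)
    simp only [hd]; ring
  have e1 : ∫ θ, prim g θ * prim (stepFun z.1) θ ∂torusMeasure + ∫ θ, g θ * F θ ∂torusMeasure +
      s * ∫ θ, prim g θ * F θ ∂torusMeasure =
      ∫ θ, d θ * prim (stepFun z.1) θ ∂torusMeasure + s * ∫ θ, d θ * F θ ∂torusMeasure -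
      (6 * ((M * K : ℕ) : ℝ) ^ 2)⁻¹ * ∫ θ, stepFun v.1 θ * stepFun z.1 θ ∂torusMeasure := by
    rw [hsplit hVL, hsplit hFL, ← hgF]
    linarith
  rw [e1]
  have b1 := (abs_integral_mul_le hdL hVL).trans
    (mul_le_mul_of_nonneg_right hdn l2norm_nonneg)
  have b2 := (abs_integral_mul_le hdL hFL).trans
    (mul_le_mul_of_nonneg_right hdn l2norm_nonneg)
  have b3 := (abs_integral_mul_le (memLp_stepFun v.1) (memLp_stepFun z.1)).trans
    (mul_le_mul_of_nonneg_right (l2norm_cellAverage_le hM hg.1) l2norm_nonneg)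
  have b4 := mul_le_mul_of_nonneg_left b3
    (by positivity : 0 ≤ (6 * ((M * K : ℕ) : ℝ) ^ 2)⁻¹)
  refine (abs_sub _ _).trans ?_
  have b5 := abs_add_le (∫ θ, d θ * prim (stepFun z.1) θ ∂torusMeasure)
    (s * ∫ θ, d θ * F θ ∂torusMeasure)
  rw [abs_mul s, hs, one_mul] at b5
  rw [abs_mul (6 * ((M * K : ℕ) : ℝ) ^ 2)⁻¹, abs_of_nonneg (a := (6 * ((M * K : ℕ) : ℝ) ^ 2)⁻¹)
    (by positivity)]
  linarith

/-! ### Energy estimate for the macroscopic dynamics -/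

theorem memLp_mul_spaceTime {T : ℝ} {a b : ℝ → ℝ} (ha : MemLp a 2 (timeMeasure T))
    (hb : MemLp b 2 torusMeasure) : MemLp (fun q : ℝ × ℝ => a q.1 * b q.2) 2 (spaceTime T) := by
  have hm : AEStronglyMeasurable (fun q : ℝ × ℝ => a q.1 * b q.2) (spaceTime T) :=
    ha.1.comp_fst.mul hb.1.comp_snd
  rw [memLp_two_iff_integrable_sq hm]
  simp only [mul_pow]
  exact ha.integrable_sq.mul_prod hb.integrable_sq

theorem memLp_l2norm {T : ℝ} {f : ℝ → ℝ → ℝ}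
    (hf : MemLp (fun q : ℝ × ℝ => f q.1 q.2) 2 (spaceTime T)) :
    MemLp (fun t => l2norm torusMeasure (f t)) 2 (timeMeasure T) := by
  have hm : AEStronglyMeasurable (fun t => l2norm torusMeasure (f t)) (timeMeasure T) :=
    Real.continuous_sqrt.comp_aestronglyMeasurable hf.integrable_sq.integral_prod_left.1
  rw [memLp_two_iff_integrable_sq hm]
  exact integrable_l2norm_sq hf

theorem memLp_time_of_continuous {T : ℝ} {a : ℝ → ℝ} (ha : Continuous a) :
    MemLp a 2 (timeMeasure T) := by
  obtain ⟨C, hC⟩ := isCompact_Icc.exists_bound_of_continuousOn (s := Icc 0 T) ha.continuousOn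
  exact MemLp.of_bound ha.aestronglyMeasurable C ((ae_restrict_mem measurableSet_Icc).mono hC)

/-- The step function of the `i`-th basis vector. -/
def cellIndicator (n : ℕ) (i : Fin n) : ℝ → ℝ :=
  (Ico ((i : ℝ) / n) (((i : ℝ) + 1) / n)).indicator fun _ => 1

theorem stepFun_eq_sum {n : ℕ} (x : EuclideanSpace ℝ (Fin n)) (θ : ℝ) :
    stepFun x θ = ∑ i, x i * cellIndicator n i θ := by
  refine Finset.sum_congr rfl fun i _ => ?_
  by_cases h : θ ∈ Ico ((i : ℝ) / n) (((i : ℝ) + 1) / n) <;> simp [cellIndicator, h]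

theorem measurable_cellIndicator {n : ℕ} (i : Fin n) : Measurable (cellIndicator n i) :=
  measurable_const.indicator measurableSet_Ico

theorem memLp_cellIndicator {n : ℕ} (i : Fin n) : MemLp (cellIndicator n i) 2 torusMeasure :=
  (memLp_const (1 : ℝ)).indicator measurableSet_Ico

theorem prim_stepFun_eq_sum {n : ℕ} (x : EuclideanSpace ℝ (Fin n)) (θ : ℝ) :
    prim (stepFun x) θ = ∑ i, x i * prim (cellIndicator n i) θ := by
  have hI : ∀ (i : Fin n) (a b : ℝ), IntervalIntegrable (cellIndicator n i) volume a b :=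
    fun i a b =>
    ⟨(integrable_const (μ := volume.restrict (Ioc a b)) (1 : ℝ)).indicator measurableSet_Ico,
      (integrable_const (μ := volume.restrict (Ioc b a)) (1 : ℝ)).indicator measurableSet_Ico⟩
  have h1 : ∀ u, ∫ s in (0 : ℝ)..u, stepFun x s =
      ∑ i, x i * ∫ s in (0 : ℝ)..u, cellIndicator n i s := by
    intro u
    simp only [stepFun_eq_sum]
    rw [intervalIntegral.integral_finsetSum fun i _ => (hI i 0 u).const_mul (x i)]
    simp only [intervalIntegral.integral_const_mul]
  simp only [prim, h1]
  rw [intervalIntegral.integral_finsetSum fun i _ => ?_]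
  · simp only [intervalIntegral.integral_const_mul, ← Finset.sum_sub_distrib, mul_sub]
  · refine Continuous.intervalIntegrable ?_ 0 1
    exact (intervalIntegral.continuous_primitive (fun a b => hI i a b) 0).const_mul (x i)

section Curves
variable {M : ℕ} {y : ℝ → meanZero M}

theorem continuous_coord (hy : Continuous y) (i : Fin M) : Continuous fun t => (y t).1 i :=
  ((EuclideanSpace.proj (𝕜 := ℝ) i).continuous.comp continuous_subtype_val).comp hy

theorem hasDerivWithinAt_coord {z : meanZero M} {s : Set ℝ} {t : ℝ} (h : HasDerivWithinAt y z s t)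
    (i : Fin M) : HasDerivWithinAt (fun t => (y t).1 i) (z.1 i) s t :=
  (((EuclideanSpace.proj (𝕜 := ℝ) i).comp (meanZero M).subtypeL).hasFDerivAt).comp_hasDerivWithinAt
    t h

theorem measurable_stepFun_curve (hy : Continuous y) :
    Measurable fun q : ℝ × ℝ => stepFun (y q.1).1 q.2 := by
  simp only [stepFun_eq_sum]
  exact Finset.measurable_sum _ fun i _ =>
    ((continuous_coord hy i).measurable.comp measurable_fst).mul
    ((measurable_cellIndicator i).comp measurable_snd)

theorem memLp_stepFun_curve (hy : Continuous y) (T : ℝ) :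
    MemLp (fun q : ℝ × ℝ => stepFun (y q.1).1 q.2) 2 (spaceTime T) := by
  simp only [stepFun_eq_sum]
  exact memLp_finsetSum _ fun i _ => memLp_mul_spaceTime
    (memLp_time_of_continuous (continuous_coord hy i)) (memLp_cellIndicator i)

/-- A differentiable curve and its velocity: the primitives of the associated step functions. -/
theorem prim_stepFun_curve {z : ℝ → meanZero M} {T : ℝ} (hz : Continuous z)
    (h : ∀ t ∈ Icc 0 T, HasDerivWithinAt y (z t) (Icc 0 T) t) {t : ℝ} (ht : t ∈ Icc 0 T) (θ : ℝ) :
    prim (stepFun (y t).1) θ = prim (stepFun (y 0).1) θ +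
      ∫ τ in (0 : ℝ)..t, prim (stepFun (z τ).1) θ := by
  simp only [prim_stepFun_eq_sum]
  have hsub : Icc 0 t ⊆ Icc 0 T := Icc_subset_Icc_right ht.2
  have hd : ∀ τ ∈ Icc 0 T, HasDerivWithinAt (fun τ => ∑ i, (y τ).1 i * prim (cellIndicator M i) θ)
      (∑ i, (z τ).1 i * prim (cellIndicator M i) θ) (Icc 0 T) τ := fun τ hτ =>
    HasDerivWithinAt.fun_sum fun i _ => (hasDerivWithinAt_coord (h τ hτ) i).mul_const _
  rw [intervalIntegral.integral_eq_sub_of_hasDerivAt_of_le ht.1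
    (fun τ hτ => ((hd τ (hsub hτ)).continuousWithinAt).mono hsub)
    (fun τ hτ => (hd τ (hsub (Ioo_subset_Icc_self hτ))).hasDerivAt
      (Icc_mem_nhds hτ.1 (hτ.2.trans_le ht.2)))
    ((continuous_finsetSum _ fun i _ =>
      (continuous_coord hz i).mul_const _).intervalIntegrable 0 t)]
  ring

end Curves

/-- The right-hand side of the equation of motion depends continuously on the state. -/
theorem continuous_field {δψ : ℝ → ℝ} (hδ : ContDiff ℝ 2 δψ) {B : ℝ}
    (hB : ∀ x, |δψ x| ≤ B ∧ |deriv δψ x| ≤ B ∧ |iteratedDeriv 2 δψ x| ≤ B) {M K : ℕ} (hM : 0 < M)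
    (hK : 0 < K) (s : ℝ) :
    Continuous fun y => -((macroA M K + macroJ s M K) (gradY (macroH (potential δψ) M K) y)) := by
  obtain ⟨-, hc, -⟩ := psiK_properties hδ hB hK
  refine ((LinearMap.continuous_of_finiteDimensional (macroA M K + macroJ s M K)).comp ?_).neg
  have h1 : (fun y : meanZero M => (gradY (macroH (potential δψ) M K) y).1) = fun y =>
      WithLp.toLp 2 fun i => deriv (psiK (potential δψ) K) (y.1 i) -
        (M : ℝ)⁻¹ * ∑ j, deriv (psiK (potential δψ) K) (y.1 j) := by
    funext y; ext i; exact gradY_macroH hδ hB hM hK y i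
  rw [continuous_induced_rng]
  refine Eq.mpr (congrArg Continuous h1) ?_
  refine (PiLp.continuous_toLp 2 _).comp (continuous_pi fun i => ?_)
  have hi : ∀ i : Fin M, Continuous fun y : meanZero M => deriv (psiK (potential δψ) K) (y.1 i) :=
    fun i => hc.comp ((EuclideanSpace.proj (𝕜 := ℝ) i).continuous.comp continuous_subtype_val)
  exact (hi i).sub (continuous_const.mul (continuous_finsetSum _ fun j _ => hi j))

section Energy
variable {δψ : ℝ → ℝ} {B s T : ℝ} {M K : ℕ} {y z : ℝ → meanZero M}

theorem memLp_deriv_psiK (hM : 0 < M) (x : EuclideanSpace ℝ (Fin M)) :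
    MemLp (fun θ => deriv (psiK (potential δψ) K) (stepFun x θ)) 2 torusMeasure :=
  (memLp_stepFun _).ae_eq (comp_stepFun_ae hM (deriv (psiK (potential δψ) K)) x).symm

theorem l2norm_deriv_psiK_le (hδ : ContDiff ℝ 2 δψ)
    (hB : ∀ x, |δψ x| ≤ B ∧ |deriv δψ x| ≤ B ∧ |iteratedDeriv 2 δψ x| ≤ B) (hM : 0 < M)
    (hK : 0 < K) (x : EuclideanSpace ℝ (Fin M)) :
    l2norm torusMeasure (fun θ => deriv (psiK (potential δψ) K) (stepFun x θ)) ≤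
      l2norm torusMeasure (stepFun x) + B := by
  set F : ℝ → ℝ := fun θ => deriv (psiK (potential δψ) K) (stepFun x θ) with hF
  have h1 := l2norm_add_le (memLp_stepFun x)
    ((memLp_deriv_psiK (δψ := δψ) (K := K) hM x).sub (memLp_stepFun x))
  have h2 : l2norm torusMeasure (F - stepFun x) ≤ B :=
    l2norm_le_of_bound ((abs_nonneg _).trans (hB 0).1)
      (ae_of_all _ fun θ => (psiK_properties hδ hB hK).2.2.1 _)
  have h3 : (fun θ => stepFun x θ + (F - stepFun x) θ) = F := by
    funext θ; simp
  rw [h3] at h1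
  linarith

/-- The energy dissipation at a fixed time: the derivative `∫ z ψ_K'(y)` of the free energy along
the macroscopic dynamics is estimated by testing the weak formulation with `z` itself. -/
theorem integral_mul_deriv_psiK_le (hδ : ContDiff ℝ 2 δψ)
    (hB : ∀ x, |δψ x| ≤ B ∧ |deriv δψ x| ≤ B ∧ |iteratedDeriv 2 δψ x| ≤ B) (hM : 0 < M)
    (hK : 0 < K) (hs : |s| = 1) {y z : meanZero M}
    (hz : z = -((macroA M K + macroJ s M K) (gradY (macroH (potential δψ) M K) y))) :
    ∫ θ, stepFun z.1 θ * deriv (psiK (potential δψ) K) (stepFun y.1 θ) ∂torusMeasure ≤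
      -(l2norm torusMeasure (prim (stepFun z.1)) ^ 2 +
        (6 * ((M * K : ℕ) : ℝ) ^ 2)⁻¹ * l2norm torusMeasure (stepFun z.1) ^ 2) / 2 +
      l2norm torusMeasure (stepFun y.1) ^ 2 + B ^ 2 := by
  set F : ℝ → ℝ := fun θ => deriv (psiK (potential δψ) K) (stepFun y.1 θ) with hF
  have hFL : MemLp F 2 torusMeasure := memLp_deriv_psiK hM y.1
  have hVL : MemLp (prim (stepFun z.1)) 2 torusMeasure := memLp_prim (integrable_stepFun _)
  have hFn := l2norm_deriv_psiK_le hδ hB hM hK y.1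
  have hw := weak_form_macro hδ hB hM hK s y z z hz
  have e1 : ∫ θ, prim (stepFun z.1) θ * prim (stepFun z.1) θ ∂torusMeasure =
      l2norm torusMeasure (prim (stepFun z.1)) ^ 2 := by rw [l2norm_sq]; simp only [sq]
  have e2 : ∫ θ, stepFun z.1 θ * stepFun z.1 θ ∂torusMeasure =
      l2norm torusMeasure (stepFun z.1) ^ 2 := by rw [l2norm_sq]; simp only [sq]
  rw [e1, e2] at hw
  have b1 : |s * ∫ θ, prim (stepFun z.1) θ * F θ ∂torusMeasure| ≤
      l2norm torusMeasure (prim (stepFun z.1)) * l2norm torusMeasure F := by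
    rw [abs_mul, hs, one_mul]; exact abs_integral_mul_le hVL hFL
  have b2 := (abs_le.1 b1).1
  have hV0 := l2norm_nonneg (ρ := torusMeasure) (f := prim (stepFun z.1))
  have hF0 := l2norm_nonneg (ρ := torusMeasure) (f := F)
  have hy0 := l2norm_nonneg (ρ := torusMeasure) (f := stepFun y.1)
  have hz0 : 0 ≤ (6 * ((M * K : ℕ) : ℝ) ^ 2)⁻¹ * l2norm torusMeasure (stepFun z.1) ^ 2 := by
    positivity
  have b3 : l2norm torusMeasure F ^ 2 ≤ 2 * l2norm torusMeasure (stepFun y.1) ^ 2 + 2 * B ^ 2 := by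
    nlinarith [sq_nonneg (l2norm torusMeasure (stepFun y.1) - B)]
  nlinarith [sq_nonneg (l2norm torusMeasure (prim (stepFun z.1)) - l2norm torusMeasure F)]

/-- The free energy per site, normalised, is comparable to the squared norm. -/
theorem sum_psiK_bounds (hM : 0 < M) {c : ℝ}
    (hc : ∀ m, |psiK (potential δψ) K m - m ^ 2 / 2 - c| ≤ B) (x : EuclideanSpace ℝ (Fin M)) :
    |(M : ℝ)⁻¹ * ∑ i, psiK (potential δψ) K (x i) - c - l2norm torusMeasure (stepFun x) ^ 2 / 2| ≤
      B := by
  have hMr : (0 : ℝ) < M := by exact_mod_cast hM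
  have h1 : l2norm torusMeasure (stepFun x) ^ 2 = (M : ℝ)⁻¹ * ∑ i, x i * x i := by
    rw [l2norm_sq, ← integral_stepFun_mul_stepFun hM]; simp only [sq]
  have h2 : (M : ℝ)⁻¹ * ∑ i, psiK (potential δψ) K (x i) - c - (M : ℝ)⁻¹ * (∑ i, x i * x i) / 2 =
      (M : ℝ)⁻¹ * ∑ i, (psiK (potential δψ) K (x i) - x i ^ 2 / 2 - c) := by
    simp only [Finset.sum_sub_distrib, Finset.sum_const, Finset.card_univ, Fintype.card_fin,
      nsmul_eq_mul, ← Finset.sum_div, ← sq]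
    field_simp
    ring
  rw [h1, h2, abs_mul, abs_of_pos (inv_pos.2 hMr)]
  calc (M : ℝ)⁻¹ * |∑ i, (psiK (potential δψ) K (x i) - x i ^ 2 / 2 - c)|
      ≤ (M : ℝ)⁻¹ * ∑ _i : Fin M, B := by
        gcongr
        exact (Finset.abs_sum_le_sum_abs _ _).trans (Finset.sum_le_sum fun i _ => hc _)
    _ = B := by simp [hMr.ne']

/-- The energy estimate for the macroscopic dynamics `dy/dt = z`: the `L²` norm of `y` is bounded
uniformly in time, and the `H⁻¹` norm of `z` in mean square. The `L²` norm of `z` is controlled only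
with the factor `N⁻²`, which is what the error term in the weak formulation requires. -/
theorem energy_estimate (hδ : ContDiff ℝ 2 δψ)
    (hB : ∀ x, |δψ x| ≤ B ∧ |deriv δψ x| ≤ B ∧ |iteratedDeriv 2 δψ x| ≤ B) (hM : 0 < M)
    (hK : 0 < K) (hs : |s| = 1) (hT : 0 < T) (hy : Continuous y)
    (hz : ∀ t, z t = -((macroA M K + macroJ s M K) (gradY (macroH (potential δψ) M K) (y t))))
    (h : ∀ t ∈ Icc 0 T, HasDerivWithinAt y (z t) (Icc 0 T) t) {A : ℝ}
    (hA : A = l2norm torusMeasure (stepFun (y 0).1) ^ 2 / 2 + 2 * B + B ^ 2 * T) :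
    (∀ t ∈ Icc 0 T, l2norm torusMeasure (stepFun (y t).1) ^ 2 ≤ 2 * (A * Real.exp (2 * T))) ∧
    ∫ t, (l2norm torusMeasure (prim (stepFun (z t).1)) ^ 2 +
      (6 * ((M * K : ℕ) : ℝ) ^ 2)⁻¹ * l2norm torusMeasure (stepFun (z t).1) ^ 2) ∂timeMeasure T ≤
      2 * (A + 2 * (T * (A * Real.exp (2 * T)))) := by
  obtain ⟨hpd, hpc, hpB, -, ⟨c, hc⟩, -⟩ := psiK_properties hδ hB hK
  have hzc : Continuous z := by
    have := (continuous_field hδ hB hM hK s).comp hy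
    refine this.congr fun t => (hz t).symm
  set q : ℝ → ℝ := fun t => l2norm torusMeasure (prim (stepFun (z t).1)) ^ 2 +
      (6 * ((M * K : ℕ) : ℝ) ^ 2)⁻¹ * l2norm torusMeasure (stepFun (z t).1) ^ 2 with hq
  have hq0 : ∀ t, 0 ≤ q t := fun t => by positivity
  have hzL := memLp_stepFun_curve hzc T
  have hqi : Integrable q (timeMeasure T) :=
    (integrable_l2norm_sq (f := fun t => prim (stepFun (z t).1))
      (memLp_prim_spaceTime (ζ := fun t => stepFun (z t).1) (measurable_stepFun_curve hzc) hzL)).add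
      ((integrable_l2norm_sq (f := fun t => stepFun (z t).1) hzL).const_mul _)
  -- the energy, normalised so that it dominates half of the squared `L²` norm
  set E : ℝ → ℝ := fun t => (M : ℝ)⁻¹ * ∑ i, psiK (potential δψ) K ((y t).1 i) - c + B with hE
  set E' : ℝ → ℝ := fun t =>
    (M : ℝ)⁻¹ * ∑ i, deriv (psiK (potential δψ) K) ((y t).1 i) * (z t).1 i with hE'
  have hbd := fun t => abs_le.1 (sum_psiK_bounds hM hc (y t).1)
  have hE0 : ∀ t, l2norm torusMeasure (stepFun (y t).1) ^ 2 / 2 ≤ E t := fun t => by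
    have := (hbd t).1
    simp only [hE]; linarith
  have hEd : ∀ t ∈ Icc 0 T, HasDerivWithinAt E (E' t) (Icc 0 T) t := by
    intro t ht
    refine ((HasDerivWithinAt.const_mul _
      (HasDerivWithinAt.fun_sum fun i _ => ?_)).sub_const c).add_const B
    exact (hpd _).comp_hasDerivWithinAt t (hasDerivWithinAt_coord (h t ht) i)
  have hE'c : Continuous E' := continuous_const.mul (continuous_finsetSum _ fun i _ =>
    (hpc.comp (continuous_coord hy i)).mul (continuous_coord hzc i))
  have hEc : ContinuousOn E (Icc 0 T) := fun t ht => (hEd t ht).continuousWithinAt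
  have hEi : Integrable E (timeMeasure T) := hEc.integrableOn_Icc
  have hE'le : ∀ t, E' t ≤ -(q t) / 2 + 2 * E t + B ^ 2 := by
    intro t
    have h1 := integral_mul_deriv_psiK_le hδ hB hM hK hs (hz t)
    have h2 : ∫ θ, stepFun (z t).1 θ * deriv (psiK (potential δψ) K) (stepFun (y t).1 θ)
        ∂torusMeasure = E' t := by
      rw [integral_congr_ae ((comp_stepFun_ae hM (deriv (psiK (potential δψ) K)) (y t).1).mono
        fun θ hθ => by simp only [hθ]; rfl), integral_stepFun_mul_stepFun hM]
      simp only [hE', mul_comm]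
    rw [h2] at h1
    linarith [hE0 t]
  have hineq : ∀ t ∈ Icc 0 T, E t + (∫ τ in (0 : ℝ)..t, q τ) / 2 ≤
      A + 2 * ∫ τ in (0 : ℝ)..t, E τ := by
    intro t ht
    have h0 : (0 : ℝ) ∈ Icc 0 T := ⟨le_rfl, hT.le⟩
    have hsub : Icc 0 t ⊆ Icc 0 T := Icc_subset_Icc_right ht.2
    have h1 := intervalIntegral.integral_eq_sub_of_hasDerivAt_of_le ht.1 (hEc.mono hsub)
      (fun τ hτ => (hEd τ (hsub (Ioo_subset_Icc_self hτ))).hasDerivAt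
        (Icc_mem_nhds hτ.1 (hτ.2.trans_le ht.2))) (hE'c.intervalIntegrable 0 t)
    have iq := intervalIntegrable_of_time hqi h0 ht
    have iE := intervalIntegrable_of_time hEi h0 ht
    have h2 := intervalIntegral.integral_mono_on ht.1 (hE'c.intervalIntegrable 0 t)
      (((iq.const_mul (-(1 / 2))).add (iE.const_mul 2)).add
        (intervalIntegrable_const (c := B ^ 2))) fun τ _ => by
          show E' τ ≤ -(1 / 2) * q τ + 2 * E τ + B ^ 2
          linarith [hE'le τ]
    rw [h1, intervalIntegral.integral_add ((iq.const_mul (-(1 / 2))).add (iE.const_mul 2))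
      intervalIntegrable_const, intervalIntegral.integral_add (iq.const_mul (-(1 / 2)))
      (iE.const_mul 2), intervalIntegral.integral_const_mul (-(1 / 2)) q,
      intervalIntegral.integral_const_mul 2 E, intervalIntegral.integral_const, smul_eq_mul,
      sub_zero] at h2
    have h3 := (hbd 0).2
    have h4 : E 0 ≤ l2norm torusMeasure (stepFun (y 0).1) ^ 2 / 2 + 2 * B := by
      simp only [hE]; linarith
    have h5 : t * B ^ 2 ≤ T * B ^ 2 := mul_le_mul_of_nonneg_right ht.2 (sq_nonneg B)
    rw [hA]
    linarith
  have hEnn : ∀ t, 0 ≤ E t := fun t => (by positivity : (0 : ℝ) ≤ _).trans (hE0 t)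
  have hgron := le_exp_of_le_add_integral (A := A) (C := 2) zero_le_two hEc (fun t _ => hEnn t)
    fun t ht => by
      have := intervalIntegral.integral_nonneg (μ := volume) ht.1 fun τ _ => hq0 τ
      linarith [hineq t ht]
  have hA0 : 0 ≤ A := by
    have := (hEnn 0).trans (hgron 0 ⟨le_rfl, hT.le⟩)
    simpa using this
  have hbound : ∀ t ∈ Icc 0 T, E t ≤ A * Real.exp (2 * T) := fun t ht =>
    (hgron t ht).trans (by gcongr; exact ht.2)
  refine ⟨fun t ht => by linarith [hE0 t, hbound t ht], ?_⟩
  have h1 := hineq T ⟨hT.le, le_rfl⟩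
  rw [← integral_time hT.le, ← integral_time hT.le] at h1
  have h2 : ∫ τ, E τ ∂timeMeasure T ≤ T * (A * Real.exp (2 * T)) := by
    have := integral_mono_ae hEi (integrable_const (A * Real.exp (2 * T)))
      ((ae_restrict_mem measurableSet_Icc).mono hbound)
    simpa [hT.le] using this
  linarith [hEnn T]

end Energy

/-! ### The macroscopic dynamics as approximate solutions -/

/-- The square of the error term, where `v` and `w` are the norms of the velocity in `H⁻¹` and in
`L²`, and `a` is the factor `(6N²)⁻¹`. -/
theorem sq_error_le {a m k v f w D G : ℝ} (ha : 0 ≤ a) (ham : a ≤ m ^ 2) (hf : f ^ 2 ≤ G) :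
    (4 * m * (v + f) + a * w + D * k) ^ 2 ≤
      64 * m ^ 2 * (v ^ 2 + a * w ^ 2) + (64 * m ^ 2 * G + 4 * D ^ 2 * k ^ 2) := by
  have h4 : (4 * m * (v + f) + a * w + D * k) ^ 2 ≤
      4 * ((4 * m * v) ^ 2 + (4 * m * f) ^ 2 + (a * w) ^ 2 + (D * k) ^ 2) := by
    nlinarith [sq_nonneg (4 * m * v - 4 * m * f), sq_nonneg (4 * m * v - a * w),
      sq_nonneg (4 * m * v - D * k), sq_nonneg (4 * m * f - a * w),
      sq_nonneg (4 * m * f - D * k), sq_nonneg (a * w - D * k)]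
  have h7 : 0 ≤ a * w ^ 2 := by positivity
  have h8 := mul_le_mul_of_nonneg_right ham h7
  have h9 := mul_le_mul_of_nonneg_left hf (sq_nonneg m)
  have h10 := mul_nonneg (sq_nonneg m) h7
  linarith

/-- The error is of order `M^{-1/2} + K^{-1/2}` in `L²` in time: the dissipation bounds the terms
containing the velocity, as `a ≤ M⁻¹`. -/
theorem integral_sq_error_le {T a G C D : ℝ} {M K : ℕ} {v f w : ℝ → ℝ} (hT : 0 ≤ T) (ha : 0 ≤ a)
    (haM : a ≤ (M : ℝ)⁻¹) (hv : MemLp v 2 (timeMeasure T)) (hw : MemLp w 2 (timeMeasure T))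
    (he : MemLp (fun t => 4 / √M * (v t + f t) + a * w t + D / √K) 2 (timeMeasure T))
    (hC : ∫ t, (v t ^ 2 + a * w t ^ 2) ∂timeMeasure T ≤ C) (hf : ∀ t ∈ Icc 0 T, f t ^ 2 ≤ G) :
    ∫ t, (4 / √M * (v t + f t) + a * w t + D / √K) ^ 2 ∂timeMeasure T ≤
      (64 * C + 64 * T * G) * (M : ℝ)⁻¹ + 4 * D ^ 2 * T * (K : ℝ)⁻¹ := by
  have hM0 : (0 : ℝ) ≤ (M : ℝ)⁻¹ := by positivity
  have hsM : (√M)⁻¹ ^ 2 = (M : ℝ)⁻¹ := by rw [inv_pow, Real.sq_sqrt M.cast_nonneg]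
  have hsK : (√K)⁻¹ ^ 2 = (K : ℝ)⁻¹ := by rw [inv_pow, Real.sq_sqrt K.cast_nonneg]
  set q : ℝ → ℝ := fun t => v t ^ 2 + a * w t ^ 2 with hq
  have hqi : Integrable q (timeMeasure T) := hv.integrable_sq.add (hw.integrable_sq.const_mul a)
  have hpt : ∀ t ∈ Icc 0 T, (4 / √M * (v t + f t) + a * w t + D / √K) ^ 2 ≤
      64 * (M : ℝ)⁻¹ * q t + (64 * (M : ℝ)⁻¹ * G + 4 * D ^ 2 * (K : ℝ)⁻¹) := fun t ht => by
    have := sq_error_le (m := (√M)⁻¹) (k := (√K)⁻¹) (v := v t) (w := w t) (D := D) ha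
      (by rwa [hsM]) (hf t ht)
    rwa [hsM, hsK, ← div_eq_mul_inv, ← div_eq_mul_inv] at this
  have h1 := integral_mono_ae he.integrable_sq ((hqi.const_mul (64 * (M : ℝ)⁻¹)).add
    (integrable_const (64 * (M : ℝ)⁻¹ * G + 4 * D ^ 2 * (K : ℝ)⁻¹)))
    ((ae_restrict_mem measurableSet_Icc).mono hpt)
  refine h1.trans ?_
  simp only [Pi.add_apply]
  rw [integral_add (hqi.const_mul (64 * (M : ℝ)⁻¹)) (integrable_const _), integral_const_mul]
  have h2 : ∀ c : ℝ, ∫ _, c ∂timeMeasure T = T * c := fun c => by simp [hT]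
  rw [h2]
  have h3 := mul_le_mul_of_nonneg_left hC (mul_nonneg (by norm_num : (0 : ℝ) ≤ 64) hM0)
  linarith

set_option maxHeartbeats 800000 in
/-- The step functions of the macroscopic dynamics are approximate solutions, with bounds which are
uniform in the numbers of blocks and of sites per block. -/
theorem exists_approxSol_macro {δψ : ℝ → ℝ} (hδ : ContDiff ℝ 2 δψ) {B : ℝ}
    (hB : ∀ x, |δψ x| ≤ B ∧ |deriv δψ x| ≤ B ∧ |iteratedDeriv 2 δψ x| ≤ B) {s T : ℝ}
    (hs : |s| = 1) (hT : 0 < T) (Φ : ℝ → ℝ) (D R : ℝ)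
    (hD : ∀ K : ℕ, 0 < K → ∀ m, |deriv (psiK (potential δψ) K) m - Φ m| ≤ D / √K) :
    ∃ C, 0 ≤ C ∧ ∀ M K : ℕ, 0 < M → 0 < K → ∀ η : ℝ → meanZero M,
      l2norm torusMeasure (stepFun (η 0).1) ≤ R →
      (∀ t ∈ Icc 0 T, HasDerivWithinAt η (-((macroA M K + macroJ s M K)
        (gradY (macroH (potential δψ) M K) (η t)))) (Icc 0 T) t) →
      ∃ (ζ V F : ℝ → ℝ → ℝ) (e : ℝ → ℝ), ApproxSol Φ s T (prim (stepFun (η 0).1)) ζ V F e ∧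
        (∀ t ∈ Icc 0 T, ζ t = stepFun (η t).1) ∧
        (∀ t ∈ Icc 0 T, l2norm torusMeasure (ζ t) ≤ C) ∧
        ∫ q : ℝ × ℝ, V q.1 q.2 ^ 2 ∂spaceTime T ≤ C ∧
        ∫ t, e t ^ 2 ∂timeMeasure T ≤ C * ((M : ℝ)⁻¹ + (K : ℝ)⁻¹) := by
  have hB0 : 0 ≤ B := (abs_nonneg _).trans (hB 0).1
  set A := R ^ 2 / 2 + 2 * B + B ^ 2 * T with hA
  have hA0 : 0 ≤ A := by positivity
  set C₁ := 2 * (A * Real.exp (2 * T)) with hC₁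
  set C₂ := 2 * (A + 2 * (T * (A * Real.exp (2 * T)))) with hC₂
  have hC₁0 : 0 ≤ C₁ := by positivity
  have hC₂0 : 0 ≤ C₂ := by positivity
  set C₃ := 64 * C₂ + 64 * T * (2 * C₁ + 2 * B ^ 2) + 4 * D ^ 2 * T with hC₃
  have hC₃0 : 0 ≤ C₃ := by positivity
  have hD0 : 0 ≤ D := by simpa using (abs_nonneg _).trans (hD 1 one_pos 0)
  refine ⟨√C₁ + C₂ + C₃, by positivity, fun M K hM hK η hR hη => ?_⟩
  have hMr : (0 : ℝ) < M := by exact_mod_cast hM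
  have hKr : (0 : ℝ) < K := by exact_mod_cast hK
  -- outside of `[0,T]` the trajectory is replaced by its end points
  set y : ℝ → meanZero M := IccExtend hT.le (domRestrict (Icc 0 T) η) with hy
  have hyη : ∀ t ∈ Icc 0 T, y t = η t := fun t ht => by rw [hy, IccExtend_of_mem _ _ ht]; rfl
  have h0T : (0 : ℝ) ∈ Icc 0 T := ⟨le_rfl, hT.le⟩
  have hyc : Continuous y :=
    (continuousOn_iff_continuous_domRestrict.1 fun t ht =>
      (hη t ht).continuousWithinAt).Icc_extend'
  set z : ℝ → meanZero M := fun t =>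
    -((macroA M K + macroJ s M K) (gradY (macroH (potential δψ) M K) (y t))) with hz
  have hzc : Continuous z := (continuous_field hδ hB hM hK s).comp hyc
  have hyd : ∀ t ∈ Icc 0 T, HasDerivWithinAt y (z t) (Icc 0 T) t := fun t ht => by
    rw [hz]; simp only
    rw [hyη t ht]
    exact (hη t ht).congr hyη (hyη t ht)
  obtain ⟨hen1, hen2⟩ := energy_estimate hδ hB hM hK hs hT hyc (fun t => rfl) hyd rfl
  rw [hyη 0 h0T] at hen1 hen2
  have hAle : l2norm torusMeasure (stepFun (η 0).1) ^ 2 / 2 + 2 * B + B ^ 2 * T ≤ A := by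
    have := pow_le_pow_left₀ l2norm_nonneg hR 2
    rw [hA]; linarith
  have hy1 : ∀ t ∈ Icc 0 T, l2norm torusMeasure (stepFun (y t).1) ^ 2 ≤ C₁ := fun t ht =>
    (hen1 t ht).trans (by rw [hC₁]; gcongr)
  set a : ℝ := (6 * ((M * K : ℕ) : ℝ) ^ 2)⁻¹ with ha
  have hz2 := hen2.trans (show _ ≤ C₂ by rw [hC₂]; gcongr)
  have ha0 : 0 ≤ a := by positivity
  have haM : a ≤ (M : ℝ)⁻¹ := by
    rw [ha, Nat.cast_mul]
    refine inv_anti₀ hMr ?_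
    have h1 : (1 : ℝ) ≤ M := by exact_mod_cast hM
    have h2 : (1 : ℝ) ≤ K := by exact_mod_cast hK
    have h3 : (M : ℝ) ≤ M * K := by nlinarith
    nlinarith
  set ζ : ℝ → ℝ → ℝ := fun t => stepFun (y t).1 with hζ
  set V : ℝ → ℝ → ℝ := fun t => prim (stepFun (z t).1) with hV
  set F : ℝ → ℝ → ℝ := fun t θ => deriv (psiK (potential δψ) K) (stepFun (y t).1 θ) with hF
  set e : ℝ → ℝ := fun t => 4 / √M * (l2norm torusMeasure (V t) + l2norm torusMeasure (F t)) +
    a * l2norm torusMeasure (stepFun (z t).1) + D / √K with he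
  have hpsi := psiK_properties hδ hB hK
  have hζm : Measurable fun q : ℝ × ℝ => ζ q.1 q.2 := measurable_stepFun_curve hyc
  have hζL : MemLp (fun q : ℝ × ℝ => ζ q.1 q.2) 2 (spaceTime T) := memLp_stepFun_curve hyc T
  have hzm : Measurable fun q : ℝ × ℝ => stepFun (z q.1).1 q.2 := measurable_stepFun_curve hzc
  have hzL : MemLp (fun q : ℝ × ℝ => stepFun (z q.1).1 q.2) 2 (spaceTime T) :=
    memLp_stepFun_curve hzc T
  have hVL : MemLp (fun q : ℝ × ℝ => V q.1 q.2) 2 (spaceTime T) :=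
    memLp_prim_spaceTime (ζ := fun t => stepFun (z t).1) hzm hzL
  have hFL : MemLp (fun q : ℝ × ℝ => F q.1 q.2) 2 (spaceTime T) := by
    refine (hζL.norm.add (memLp_const B)).of_le
      (hpsi.2.1.measurable.comp hζm).aestronglyMeasurable (ae_of_all _ fun q => ?_)
    simp only [Pi.add_apply, Real.norm_eq_abs]
    refine le_trans ?_ (le_abs_self _)
    have h1 := hpsi.2.2.1 (stepFun (y q.1).1 q.2)
    have h2 := abs_sub_abs_le_abs_sub (F q.1 q.2) (ζ q.1 q.2)
    simp only [hζ, hF] at h2 ⊢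
    linarith
  have heL : MemLp e 2 (timeMeasure T) :=
    ((((memLp_l2norm hVL).add (memLp_l2norm hFL)).const_mul _).add
      ((memLp_l2norm (f := fun t => stepFun (z t).1) hzL).const_mul a)).add (memLp_const _)
  have hDK : 0 ≤ D / √K := by positivity
  have hmain0 : ∀ t, 0 ≤ 4 / √M * (l2norm torusMeasure (V t) + l2norm torusMeasure (F t)) +
      a * l2norm torusMeasure (stepFun (z t).1) := fun t => by
    have h1 := l2norm_nonneg (ρ := torusMeasure) (f := V t)
    have h2 := l2norm_nonneg (ρ := torusMeasure) (f := F t)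
    have h3 := l2norm_nonneg (ρ := torusMeasure) (f := stepFun (z t).1)
    positivity
  refine ⟨ζ, V, F, e, ⟨hζm, measurable_prim (ζ := fun t => stepFun (z t).1) hzm, hζL, hVL, hFL, heL,
    memLp_prim (integrable_stepFun _), ?_, ?_, ?_, ?_, ?_⟩, ?_, ?_, ?_, ?_⟩
  · exact ae_of_all _ fun t => (memL20_stepFun (y t)).2
  · exact ae_of_all _ fun t => integral_prim (integrable_stepFun _)
  · filter_upwards [ae_spaceTime_mem] with q hq
    rw [← hyη 0 h0T]
    exact prim_stepFun_curve hzc hyd hq.1 q.2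
  · refine ae_of_all _ fun t g hg => ?_
    refine (abs_weak_form_macro_le hδ hB hM hK hs (z := z t) rfl hg).trans ?_
    refine mul_le_mul_of_nonneg_right ?_ l2norm_nonneg
    exact le_add_of_nonneg_right hDK
  · refine ae_of_all _ fun t => ?_
    refine (l2norm_le_of_bound hDK (ae_of_all _ fun θ => hD K hK _)).trans ?_
    exact le_add_of_nonneg_left (hmain0 t)
  · exact fun t ht => by simp only [hζ, hyη t ht]
  · intro t ht
    have h1 := Real.le_sqrt_of_sq_le (hy1 t ht)
    linarith
  · rw [← integral_l2norm_sq hVL]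
    refine le_trans ?_ (hz2.trans (by linarith [Real.sqrt_nonneg C₁]))
    refine integral_mono (integrable_l2norm_sq hVL) ((integrable_l2norm_sq hVL).add
      ((integrable_l2norm_sq (f := fun t => stepFun (z t).1) hzL).const_mul a)) fun t => ?_
    exact le_add_of_nonneg_right (by positivity)
  · refine (integral_sq_error_le (G := 2 * C₁ + 2 * B ^ 2) hT.le ha0 haM (memLp_l2norm hVL)
      (memLp_l2norm (f := fun t => stepFun (z t).1) hzL) heL hz2 fun t ht => ?_).trans ?_
    · have h1 := l2norm_deriv_psiK_le hδ hB hM hK (y t).1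
      have h2 : l2norm torusMeasure (F t) ^ 2 ≤ _ := pow_le_pow_left₀ l2norm_nonneg h1 2
      have h3 := hy1 t ht
      nlinarith [sq_nonneg (l2norm torusMeasure (stepFun (y t).1) - B)]
    have h4 : C₃ * ((M : ℝ)⁻¹ + (K : ℝ)⁻¹) ≤ (√C₁ + C₂ + C₃) * ((M : ℝ)⁻¹ + (K : ℝ)⁻¹) := by
      gcongr; linarith [Real.sqrt_nonneg C₁]
    refine le_trans ?_ h4
    have h5 : 0 ≤ 4 * D ^ 2 * T * (M : ℝ)⁻¹ := by positivity
    have h6 : 0 ≤ (64 * C₂ + 64 * T * (2 * C₁ + 2 * B ^ 2)) * (K : ℝ)⁻¹ := by positivity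
    rw [hC₃]
    linarith

/-! ### Strong and weak limits in `L²` -/

section HilbertLimits
variable {Ω : Type*} [MeasurableSpace Ω] {ρ : Measure Ω}

/-- Completeness of `L²`, for a Cauchy condition as given by a stability estimate. -/
theorem exists_tendsto_l2norm_sub {f : ℕ → Ω → ℝ} (hf : ∀ k, MemLp (f k) 2 ρ) {α : ℕ → ℝ}
    (hα : Tendsto α atTop (𝓝 0)) (h : ∀ k l, ∫ x, (f k x - f l x) ^ 2 ∂ρ ≤ α k + α l) :
    ∃ g : Ω → ℝ, Measurable g ∧ MemLp g 2 ρ ∧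
      Tendsto (fun k => l2norm ρ (fun x => f k x - g x)) atTop (𝓝 0) := by
  have hd : ∀ k l, ‖(hf k).toLp (f k) - (hf l).toLp (f l)‖ ^ 2 = ∫ x, (f k x - f l x) ^ 2 ∂ρ := by
    intro k l
    have h1 := l2norm_eq_norm ((hf k).sub (hf l))
    rw [(hf k).toLp_sub (hf l)] at h1
    rw [← h1, l2norm_sq]; rfl
  have hc : CauchySeq fun k => (hf k).toLp (f k) := by
    refine Metric.cauchySeq_iff.2 fun ε hε => ?_
    obtain ⟨N, hN⟩ := eventually_atTop.1
      (hα.eventually (gt_mem_nhds (by positivity : 0 < ε ^ 2 / 2)))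
    refine ⟨N, fun k hk l hl => ?_⟩
    rw [dist_eq_norm]
    refine lt_of_pow_lt_pow_left₀ 2 hε.le ?_
    rw [hd]
    linarith [h k l, hN k hk, hN l hl]
  obtain ⟨g, hg⟩ := cauchySeq_tendsto_of_complete hc
  refine ⟨g, (Lp.stronglyMeasurable g).measurable, Lp.memLp g, ?_⟩
  have h2 := tendsto_iff_norm_sub_tendsto_zero.1 hg
  refine h2.congr fun k => ?_
  have h3 := l2norm_eq_norm ((hf k).sub (Lp.memLp g))
  rw [(hf k).toLp_sub (Lp.memLp g), Lp.toLp_coeFn] at h3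
  exact h3.symm

/-- Weak compactness of bounded sequences in a Hilbert space. The limit is taken along an
ultrafilter, which needs neither separability nor the choice of a subsequence. -/
theorem exists_weak_limit {H : Type*} [NormedAddCommGroup H] [InnerProductSpace ℝ H]
    [CompleteSpace H] {v : ℕ → H} {C : ℝ} (hv : ∀ n, ‖v n‖ ≤ C) :
    ∃ w : H, ∀ u, Tendsto (fun n => ⟪v n, u⟫_ℝ) (hyperfilter ℕ) (𝓝 ⟪w, u⟫_ℝ) := by
  set L : ℕ → WeakDual ℝ H := fun n => StrongDual.toWeakDual (InnerProductSpace.toDual ℝ H (v n))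
    with hL
  obtain ⟨x, -, hx⟩ := (WeakDual.isCompact_closedBall (𝕜 := ℝ) (0 : StrongDual ℝ H)
    C).ultrafilter_le_nhds ((hyperfilter ℕ).map L) (by
      rw [Ultrafilter.coe_map, le_principal_iff, mem_map]
      refine univ_mem' fun n => ?_
      simp only [mem_preimage, mem_closedBall_zero_iff, hL]
      exact ((InnerProductSpace.toDual ℝ H).norm_map (v n)).trans_le (hv n))
  refine ⟨(InnerProductSpace.toDual ℝ H).symm (WeakDual.toStrongDual x), fun u => ?_⟩
  have h1 := ((WeakDual.eval_continuous u).tendsto x).comp hx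
  rw [InnerProductSpace.toDual_symm_apply]
  exact h1

theorem exists_weak_limit_memLp {f : ℕ → Ω → ℝ} (hf : ∀ k, MemLp (f k) 2 ρ) {C : ℝ}
    (h : ∀ k, ∫ x, f k x ^ 2 ∂ρ ≤ C) :
    ∃ g : Ω → ℝ, Measurable g ∧ MemLp g 2 ρ ∧ ∀ u : Ω → ℝ, MemLp u 2 ρ →
      Tendsto (fun k => ∫ x, f k x * u x ∂ρ) (hyperfilter ℕ) (𝓝 (∫ x, g x * u x ∂ρ)) := by
  obtain ⟨g, hg⟩ := exists_weak_limit (v := fun k => (hf k).toLp (f k)) (C := √C) fun k => by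
    rw [← l2norm_eq_norm]
    exact Real.sqrt_le_sqrt (h k)
  refine ⟨g, (Lp.stronglyMeasurable g).measurable, Lp.memLp g, fun u hu => ?_⟩
  have h1 := hg (hu.toLp u)
  simp only [inner_toLp] at h1
  have h2 := inner_toLp (Lp.memLp g) hu
  rw [Lp.toLp_coeFn] at h2
  rwa [h2] at h1

theorem tendsto_integral_mul_of_l2norm {ι : Type*} {l : Filter ι} {f : ι → Ω → ℝ} {g u : Ω → ℝ}
    (hf : ∀ k, MemLp (f k) 2 ρ) (hg : MemLp g 2 ρ) (hu : MemLp u 2 ρ)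
    (h : Tendsto (fun k => l2norm ρ (fun x => f k x - g x)) l (𝓝 0)) :
    Tendsto (fun k => ∫ x, f k x * u x ∂ρ) l (𝓝 (∫ x, g x * u x ∂ρ)) := by
  rw [tendsto_iff_norm_sub_tendsto_zero]
  refine squeeze_zero (fun _ => norm_nonneg _) (fun k => ?_)
    (by simpa using h.mul_const (l2norm ρ u))
  have h1 := abs_integral_mul_le ((hf k).sub hg) hu
  have h2 : ∫ x, (f k - g) x * u x ∂ρ = ∫ x, f k x * u x ∂ρ - ∫ x, g x * u x ∂ρ := by
    refine Eq.trans ?_ (integral_sub ((hf k).integrable_mul hu) (hg.integrable_mul hu))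
    refine integral_congr_ae (ae_of_all _ fun x => ?_)
    simp only [Pi.sub_apply]; ring
  rw [h2] at h1
  exact h1

/-- A function dominated by the members of a sequence tending to `0` in `L²` is almost everywhere
nonpositive. -/
theorem ae_nonpos_of_le_of_tendsto {f : Ω → ℝ} {n : ℕ → Ω → ℝ} (hn : ∀ k, MemLp (n k) 2 ρ)
    (h : ∀ k, ∀ᵐ x ∂ρ, f x ≤ n k x) (hlim : Tendsto (fun k => l2norm ρ (n k)) atTop (𝓝 0)) :
    ∀ᵐ x ∂ρ, f x ≤ 0 := by
  have h1 : Tendsto (fun k => eLpNorm (n k - (fun _ => (0 : ℝ))) 2 ρ) atTop (𝓝 0) := by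
    have h2 : ∀ k, eLpNorm (n k - (fun _ => (0 : ℝ))) 2 ρ = ENNReal.ofReal (l2norm ρ (n k)) := by
      intro k
      rw [← eLpNorm_eq_ofReal_l2norm (hn k)]
      congr 1; funext x; simp
    simp only [h2]
    simpa using ENNReal.tendsto_ofReal hlim
  obtain ⟨ns, -, hns⟩ := (tendstoInMeasure_of_tendsto_eLpNorm (by simp) (fun k => (hn k).1)
    aestronglyMeasurable_const h1).exists_seq_tendsto_ae
  filter_upwards [hns, ae_all_iff.2 h] with x h3 h4
  exact ge_of_tendsto' h3 fun k => h4 _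

end HilbertLimits

/-- Integration by parts in time. -/
theorem integral_timeIntegral_mul {T : ℝ} (hT : 0 ≤ T) {W u : ℝ → ℝ → ℝ}
    (hWm : Measurable fun q : ℝ × ℝ => W q.1 q.2)
    (hW : MemLp (fun q : ℝ × ℝ => W q.1 q.2) 2 (spaceTime T))
    (hum : Measurable fun q : ℝ × ℝ => u q.1 q.2)
    (hu : MemLp (fun q : ℝ × ℝ => u q.1 q.2) 2 (spaceTime T)) :
    MemLp (fun q : ℝ × ℝ => (∫ τ in (0 : ℝ)..T, u τ q.2) - ∫ τ in (0 : ℝ)..q.1, u τ q.2) 2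
      (spaceTime T) ∧
    ∫ q : ℝ × ℝ, (∫ τ in (0 : ℝ)..q.1, W τ q.2) * u q.1 q.2 ∂spaceTime T =
      ∫ q : ℝ × ℝ, W q.1 q.2 *
        ((∫ τ in (0 : ℝ)..T, u τ q.2) - ∫ τ in (0 : ℝ)..q.1, u τ q.2) ∂spaceTime T := by
  have hTm : T ∈ Icc 0 T := ⟨hT, le_rfl⟩
  have h0m : (0 : ℝ) ∈ Icc 0 T := ⟨le_rfl, hT⟩
  have hU : MemLp (fun q : ℝ × ℝ => (∫ τ in (0 : ℝ)..T, u τ q.2) - ∫ τ in (0 : ℝ)..q.1, u τ q.2) 2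
      (spaceTime T) :=
    MemLp.sub ((l2norm_timeIntegral_le hum hu hTm).1.comp_snd _) (memLp_timeIntegral hum hu)
  refine ⟨hU, ?_⟩
  have i1 := integrable_mul_of_memLp (memLp_timeIntegral hWm hW) hu
  have i2 := integrable_mul_of_memLp hW hU
  rw [integral_spaceTime_symm i1, integral_spaceTime_symm i2]
  refine integral_congr_ae ?_
  filter_upwards [memLp_slice_torus hW, memLp_slice_torus hu] with θ h1 h2
  have hv := intervalIntegrable_of_time (h1.integrable (by simp)) h0m hTm
  have hq := intervalIntegrable_of_time (h2.integrable (by simp)) h0m hTm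
  have h3 := integral_primitive_mul hv hq 0 (-∫ τ in (0 : ℝ)..T, u τ θ)
  simp only [integral_time hT]
  simp only [zero_add, neg_add_cancel, mul_zero, zero_mul,
    sub_self] at h3
  have h4 : ∫ t in (0 : ℝ)..T, W t θ * ((∫ τ in (0 : ℝ)..T, u τ θ) - ∫ τ in (0 : ℝ)..t, u τ θ) =
      -∫ t in (0 : ℝ)..T, W t θ * (-(∫ τ in (0 : ℝ)..T, u τ θ) + ∫ τ in (0 : ℝ)..t, u τ θ) := by
    rw [← intervalIntegral.integral_neg]
    refine intervalIntegral.integral_congr fun t _ => ?_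
    ring
  rw [h4]
  linarith

/-! ### Limits of approximate solutions -/

/-- The representative in `L²_0` of the functional `g ↦ ∫ G v + ∫ g f + s ∫ G f`, `G' = g`, which
vanishes exactly when the weak formulation holds. -/
def residual (s : ℝ) (v f : ℝ → ℝ) (θ : ℝ) : ℝ :=
  f θ - ∫ u, f u ∂torusMeasure - prim v θ - s * prim (fun θ => f θ - ∫ u, f u ∂torusMeasure) θ

theorem memL20_sub_mean {f : ℝ → ℝ} (hf : MemLp f 2 torusMeasure) :
    MemL20 fun θ => f θ - ∫ u, f u ∂torusMeasure :=
  ⟨hf.sub (memLp_const _), by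
    rw [integral_sub (hf.integrable (by simp)) (integrable_const _)]; simp⟩

theorem memL20_residual {s : ℝ} {v f : ℝ → ℝ} (hv : MemL20 v) (hf : MemLp f 2 torusMeasure) :
    MemL20 (residual s v f) :=
  ((memL20_sub_mean hf).sub hv.prim).sub ((memL20_sub_mean hf).prim.const_mul s)

theorem integral_mul_residual {s : ℝ} {v f g : ℝ → ℝ} (hv : MemL20 v) (hf : MemLp f 2 torusMeasure)
    (hg : MemL20 g) : ∫ θ, prim g θ * v θ ∂torusMeasure + ∫ θ, g θ * f θ ∂torusMeasure +
      s * ∫ θ, prim g θ * f θ ∂torusMeasure = ∫ θ, g θ * residual s v f θ ∂torusMeasure := by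
  set m := ∫ u, f u ∂torusMeasure with hm
  have h1 := memL20_sub_mean hf
  rw [← hm] at h1
  have hp1 := memLp_prim (h1.1.integrable (by simp))
  have hpv := memLp_prim (hv.1.integrable (by simp))
  have hpg := memLp_prim (hg.1.integrable (by simp))
  have e1 : ∀ {a : ℝ → ℝ}, MemLp a 2 torusMeasure → ∫ θ, a θ ∂torusMeasure = 0 →
      ∫ θ, a θ * f θ ∂torusMeasure = ∫ θ, a θ * (f θ - m) ∂torusMeasure := by
    intro a ha ha0
    simp only [mul_sub]
    rw [integral_sub (integrable_mul_of_memLp ha hf) ((ha.integrable (by simp)).mul_const m),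
      integral_mul_const, ha0, zero_mul, sub_zero]
  have e2 : ∫ θ, g θ * residual s v f θ ∂torusMeasure = ∫ θ, g θ * (f θ - m) ∂torusMeasure -
      ∫ θ, g θ * prim v θ ∂torusMeasure -
      s * ∫ θ, g θ * prim (fun θ => f θ - m) θ ∂torusMeasure := by
    rw [← integral_mul_sub hg.1 h1.1 hpv, ← integral_const_mul]
    simp only [mul_left_comm s]
    exact integral_mul_sub (b := fun θ => f θ - m - prim v θ) hg.1 (h1.1.sub hpv) (hp1.const_mul s)
  rw [e2, e1 hg.1 hg.2, e1 hpg (integral_prim (hg.1.integrable (by simp))), integral_prim_mul hg hv,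
    integral_prim_mul hg h1]
  ring

theorem measurable_integral_torus {f : ℝ → ℝ → ℝ} (hf : Measurable fun q : ℝ × ℝ => f q.1 q.2) :
    Measurable fun t => ∫ θ, f t θ ∂torusMeasure :=
  (hf.stronglyMeasurable.integral_prod_right' (ν := torusMeasure)).measurable

theorem memLp_integral_torus {T : ℝ} {f : ℝ → ℝ → ℝ} (hfm : Measurable fun q : ℝ × ℝ => f q.1 q.2)
    (hf : MemLp (fun q : ℝ × ℝ => f q.1 q.2) 2 (spaceTime T)) :
    MemLp (fun t => ∫ θ, f t θ ∂torusMeasure) 2 (timeMeasure T) := by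
  refine (memLp_l2norm hf).of_le (measurable_integral_torus hfm).aestronglyMeasurable ?_
  filter_upwards [memLp_slice_time hf] with t ht
  rw [Real.norm_eq_abs, Real.norm_of_nonneg l2norm_nonneg]
  exact abs_integral_le_integral_abs.trans (integral_abs_le_l2norm ht)

theorem measurable_residual {s : ℝ} {v f : ℝ → ℝ → ℝ} (hv : Measurable fun q : ℝ × ℝ => v q.1 q.2)
    (hf : Measurable fun q : ℝ × ℝ => f q.1 q.2) :
    Measurable fun q : ℝ × ℝ => residual s (v q.1) (f q.1) q.2 := by
  have h1 : Measurable fun q : ℝ × ℝ => f q.1 q.2 - ∫ u, f q.1 u ∂torusMeasure :=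
    hf.sub ((measurable_integral_torus hf).comp measurable_fst)
  exact (h1.sub (measurable_prim hv)).sub
    ((measurable_prim (ζ := fun t θ => f t θ - ∫ u, f t u ∂torusMeasure) h1).const_mul s)

theorem memLp_residual {T s : ℝ} {v f : ℝ → ℝ → ℝ} (hvm : Measurable fun q : ℝ × ℝ => v q.1 q.2)
    (hfm : Measurable fun q : ℝ × ℝ => f q.1 q.2)
    (hv : MemLp (fun q : ℝ × ℝ => v q.1 q.2) 2 (spaceTime T))
    (hf : MemLp (fun q : ℝ × ℝ => f q.1 q.2) 2 (spaceTime T)) :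
    MemLp (fun q : ℝ × ℝ => residual s (v q.1) (f q.1) q.2) 2 (spaceTime T) := by
  have h1m : Measurable fun q : ℝ × ℝ => f q.1 q.2 - ∫ u, f q.1 u ∂torusMeasure :=
    hfm.sub ((measurable_integral_torus hfm).comp measurable_fst)
  have h1 : MemLp (fun q : ℝ × ℝ => f q.1 q.2 - ∫ u, f q.1 u ∂torusMeasure) 2 (spaceTime T) :=
    hf.sub ((memLp_integral_torus hfm hf).comp_fst _)
  exact (h1.sub (memLp_prim_spaceTime hvm hv)).sub
    ((memLp_prim_spaceTime (ζ := fun t θ => f t θ - ∫ u, f t u ∂torusMeasure) h1m h1).const_mul s)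

theorem l2norm_l2norm {T : ℝ} {f : ℝ → ℝ → ℝ}
    (hf : MemLp (fun q : ℝ × ℝ => f q.1 q.2) 2 (spaceTime T)) :
    l2norm (timeMeasure T) (fun t => l2norm torusMeasure (f t)) =
      l2norm (spaceTime T) (fun q : ℝ × ℝ => f q.1 q.2) := by
  rw [l2norm, integral_l2norm_sq hf, l2norm]

section Limit
variable {Φ : ℝ → ℝ} {Λ s T : ℝ} {ζ V F : ℕ → ℝ → ℝ → ℝ} {e : ℕ → ℝ → ℝ} {R : ℕ → ℝ → ℝ}
  {R₀ : ℝ → ℝ} {ζ' V' : ℝ → ℝ → ℝ}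

/-- Convergence in space-time, as convergence in time of the `L²` distances in space. -/
theorem tendsto_l2norm_slices (hζL : ∀ k, MemLp (fun q : ℝ × ℝ => ζ k q.1 q.2) 2 (spaceTime T))
    (hζ'L : MemLp (fun q : ℝ × ℝ => ζ' q.1 q.2) 2 (spaceTime T))
    (hlim : Tendsto (fun k => l2norm (spaceTime T) fun q : ℝ × ℝ => ζ k q.1 q.2 - ζ' q.1 q.2) atTop
      (𝓝 0)) :
    (∀ k, MemLp (fun t => l2norm torusMeasure fun θ => ζ k t θ - ζ' t θ) 2 (timeMeasure T)) ∧
    Tendsto (fun k => l2norm (timeMeasure T) fun t => l2norm torusMeasure fun θ =>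
      ζ k t θ - ζ' t θ) atTop (𝓝 0) := by
  have h1 : ∀ k, MemLp (fun q : ℝ × ℝ => ζ k q.1 q.2 - ζ' q.1 q.2) 2 (spaceTime T) :=
    fun k => (hζL k).sub hζ'L
  refine ⟨fun k => memLp_l2norm (f := fun t θ => ζ k t θ - ζ' t θ) (h1 k), ?_⟩
  refine hlim.congr fun k => ?_
  exact (l2norm_l2norm (f := fun t θ => ζ k t θ - ζ' t θ) (h1 k)).symm

theorem ae_integral_eq_zero_of_limit
    (hζL : ∀ k, MemLp (fun q : ℝ × ℝ => ζ k q.1 q.2) 2 (spaceTime T))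
    (hζ'L : MemLp (fun q : ℝ × ℝ => ζ' q.1 q.2) 2 (spaceTime T))
    (hlim : Tendsto (fun k => l2norm (spaceTime T) fun q : ℝ × ℝ => ζ k q.1 q.2 - ζ' q.1 q.2) atTop
      (𝓝 0)) (h0 : ∀ k, ∀ᵐ t ∂timeMeasure T, ∫ θ, ζ k t θ ∂torusMeasure = 0) :
    ∀ᵐ t ∂timeMeasure T, ∫ θ, ζ' t θ ∂torusMeasure = 0 := by
  obtain ⟨h1, h2⟩ := tendsto_l2norm_slices hζL hζ'L hlim
  have := ae_nonpos_of_le_of_tendsto (f := fun t => |∫ θ, ζ' t θ ∂torusMeasure|) h1 (fun k => by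
    filter_upwards [h0 k, memLp_slice_time (hζL k), memLp_slice_time hζ'L] with t h3 h4 h5
    have h6 := integral_abs_le_l2norm (h4.sub h5)
    have h7 := abs_integral_le_integral_abs.trans h6
    simp only [Pi.sub_apply] at h7
    rw [integral_sub (h4.integrable (by simp)) (h5.integrable (by simp)), h3, zero_sub, abs_neg]
      at h7
    exact h7) h2
  filter_upwards [this] with t ht
  exact abs_nonpos_iff.1 ht

theorem ae_l2norm_le_of_limit
    (hζL : ∀ k, MemLp (fun q : ℝ × ℝ => ζ k q.1 q.2) 2 (spaceTime T))
    (hζ'L : MemLp (fun q : ℝ × ℝ => ζ' q.1 q.2) 2 (spaceTime T))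
    (hlim : Tendsto (fun k => l2norm (spaceTime T) fun q : ℝ × ℝ => ζ k q.1 q.2 - ζ' q.1 q.2) atTop
      (𝓝 0)) {C : ℝ} (hC : ∀ k, ∀ᵐ t ∂timeMeasure T, l2norm torusMeasure (ζ k t) ≤ C) :
    ∀ᵐ t ∂timeMeasure T, l2norm torusMeasure (ζ' t) ≤ C := by
  obtain ⟨h1, h2⟩ := tendsto_l2norm_slices hζL hζ'L hlim
  have := ae_nonpos_of_le_of_tendsto (f := fun t => l2norm torusMeasure (ζ' t) - C) h1 (fun k => by
    filter_upwards [hC k, memLp_slice_time (hζL k), memLp_slice_time hζ'L] with t h3 h4 h5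
    have h6 := l2norm_sub_le h4 (h4.sub h5)
    have h7 : (fun θ => ζ k t θ - (ζ k t - ζ' t) θ) = ζ' t := by
      funext θ; simp
    rw [h7] at h6
    change _ ≤ _ + l2norm torusMeasure (fun θ => ζ k t θ - ζ' t θ) at h6
    linarith) h2
  filter_upwards [this] with t ht
  linarith

theorem tendsto_l2norm_prim (hζm : ∀ k, Measurable fun q : ℝ × ℝ => ζ k q.1 q.2)
    (hζL : ∀ k, MemLp (fun q : ℝ × ℝ => ζ k q.1 q.2) 2 (spaceTime T))
    (hζ'm : Measurable fun q : ℝ × ℝ => ζ' q.1 q.2)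
    (hζ'L : MemLp (fun q : ℝ × ℝ => ζ' q.1 q.2) 2 (spaceTime T))
    (hlim : Tendsto (fun k => l2norm (spaceTime T) fun q : ℝ × ℝ => ζ k q.1 q.2 - ζ' q.1 q.2) atTop
      (𝓝 0)) :
    Tendsto (fun k => l2norm (spaceTime T) fun q : ℝ × ℝ => prim (ζ k q.1) q.2 - prim (ζ' q.1) q.2)
      atTop (𝓝 0) := by
  refine squeeze_zero (fun _ => l2norm_nonneg) (fun k => ?_) (by simpa using hlim.const_mul 2)
  have h1 : MemLp (fun q : ℝ × ℝ => ζ k q.1 q.2 - ζ' q.1 q.2) 2 (spaceTime T) := (hζL k).sub hζ'L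
  have h2 : MemLp (fun q : ℝ × ℝ => prim (ζ k q.1) q.2 - prim (ζ' q.1) q.2) 2 (spaceTime T) :=
    (memLp_prim_spaceTime (hζm k) (hζL k)).sub (memLp_prim_spaceTime hζ'm hζ'L)
  rw [← l2norm_l2norm (f := fun t θ => ζ k t θ - ζ' t θ) h1,
    ← l2norm_l2norm (f := fun t θ => prim (ζ k t) θ - prim (ζ' t) θ) h2]
  have h3 := l2norm_const_mul (ρ := timeMeasure T)
    (f := fun t => l2norm torusMeasure fun θ => ζ k t θ - ζ' t θ) 2
  rw [abs_of_pos two_pos] at h3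
  rw [← h3]
  refine l2norm_mono ((memLp_l2norm (f := fun t θ => ζ k t θ - ζ' t θ) h1).const_mul 2) ?_
  filter_upwards [memLp_slice_time (hζL k), memLp_slice_time hζ'L] with t h4 h5
  rw [abs_of_nonneg l2norm_nonneg, abs_of_nonneg (mul_nonneg two_pos.le l2norm_nonneg)]
  rw [← l2norm_congr (f := prim fun θ => ζ k t θ - ζ' t θ) (ae_torus_mem.mono fun θ hθ =>
    prim_sub (h4.integrable (by simp)) (h5.integrable (by simp)) (Ico_subset_Icc_self hθ))]
  exact l2norm_prim_le (h4.sub h5)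

/-- The relation between `ζ` and `V` in the definition of `ApproxSol` is stable under strong
convergence of `ζ` and weak convergence of `V`. -/
theorem prim_eq_of_limit (hT : 0 ≤ T) (hζm : ∀ k, Measurable fun q : ℝ × ℝ => ζ k q.1 q.2)
    (hζL : ∀ k, MemLp (fun q : ℝ × ℝ => ζ k q.1 q.2) 2 (spaceTime T))
    (hVm : ∀ k, Measurable fun q : ℝ × ℝ => V k q.1 q.2)
    (hVL : ∀ k, MemLp (fun q : ℝ × ℝ => V k q.1 q.2) 2 (spaceTime T))
    (hRL : ∀ k, MemLp (R k) 2 torusMeasure)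
    (heq : ∀ k, ∀ᵐ q ∂spaceTime T, prim (ζ k q.1) q.2 = R k q.2 + ∫ τ in (0 : ℝ)..q.1, V k τ q.2)
    (hζ'm : Measurable fun q : ℝ × ℝ => ζ' q.1 q.2)
    (hζ'L : MemLp (fun q : ℝ × ℝ => ζ' q.1 q.2) 2 (spaceTime T))
    (hV'm : Measurable fun q : ℝ × ℝ => V' q.1 q.2)
    (hV'L : MemLp (fun q : ℝ × ℝ => V' q.1 q.2) 2 (spaceTime T))
    (hR₀ : MemLp R₀ 2 torusMeasure)
    (hlim : Tendsto (fun k => l2norm (spaceTime T) fun q : ℝ × ℝ => ζ k q.1 q.2 - ζ' q.1 q.2) atTop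
      (𝓝 0))
    (hRlim : Tendsto (fun k => l2norm torusMeasure fun θ => R k θ - R₀ θ) atTop (𝓝 0))
    (hVlim : ∀ u : ℝ × ℝ → ℝ, MemLp u 2 (spaceTime T) →
      Tendsto (fun k => ∫ q : ℝ × ℝ, V k q.1 q.2 * u q ∂spaceTime T) (hyperfilter ℕ)
        (𝓝 (∫ q : ℝ × ℝ, V' q.1 q.2 * u q ∂spaceTime T))) :
    ∀ᵐ q ∂spaceTime T, prim (ζ' q.1) q.2 = R₀ q.2 + ∫ τ in (0 : ℝ)..q.1, V' τ q.2 := by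
  have hpL : MemLp (fun q : ℝ × ℝ => prim (ζ' q.1) q.2) 2 (spaceTime T) :=
    memLp_prim_spaceTime hζ'm hζ'L
  have hR₀L : MemLp (fun q : ℝ × ℝ => R₀ q.2) 2 (spaceTime T) := hR₀.comp_snd _
  have hRkL : ∀ k, MemLp (fun q : ℝ × ℝ => R k q.2) 2 (spaceTime T) := fun k => (hRL k).comp_snd _
  have hI := memLp_timeIntegral hV'm hV'L
  -- the relations for `ζ k` and `V k` are tested with the defect `D` of the limit, of which a Borel
  -- version `u` is taken so that the integral in time can be moved onto it
  set D : ℝ × ℝ → ℝ := fun q => prim (ζ' q.1) q.2 - R₀ q.2 - ∫ τ in (0 : ℝ)..q.1, V' τ q.2 with hD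
  have hDL : MemLp D 2 (spaceTime T) := (hpL.sub hR₀L).sub hI
  set u : ℝ → ℝ → ℝ := fun t θ => hDL.1.mk D (t, θ) with hu
  have hum : Measurable fun q : ℝ × ℝ => u q.1 q.2 := hDL.1.stronglyMeasurable_mk.measurable
  have huD : (fun q : ℝ × ℝ => u q.1 q.2) =ᵐ[spaceTime T] D := hDL.1.ae_eq_mk.symm
  have huL : MemLp (fun q : ℝ × ℝ => u q.1 q.2) 2 (spaceTime T) := hDL.ae_eq huD.symm
  have hle : ((hyperfilter ℕ : Ultrafilter ℕ) : Filter ℕ) ≤ atTop := Nat.hyperfilter_le_atTop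
  have t1 := (tendsto_integral_mul_of_l2norm
    (f := fun k (q : ℝ × ℝ) => prim (ζ k q.1) q.2) (fun k => memLp_prim_spaceTime (hζm k) (hζL k))
    hpL huL (tendsto_l2norm_prim hζm hζL hζ'm hζ'L hlim)).mono_left hle
  have hRst : ∀ k, l2norm (spaceTime T) (fun q : ℝ × ℝ => R k q.2 - R₀ q.2) =
      √T * l2norm torusMeasure fun θ => R k θ - R₀ θ := by
    intro k
    rw [← l2norm_l2norm (f := fun _ θ => R k θ - R₀ θ) (((hRL k).sub hR₀).comp_snd _)]
    simp only [l2norm, integral_const, smul_eq_mul]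
    rw [Real.sqrt_mul measureReal_nonneg, Real.sqrt_sq (Real.sqrt_nonneg _)]
    simp [hT]
  have t2 := (tendsto_integral_mul_of_l2norm (f := fun k (q : ℝ × ℝ) => R k q.2)
    hRkL hR₀L huL (by
      simp only [hRst]
      simpa using hRlim.const_mul √T)).mono_left hle
  have hU := integral_timeIntegral_mul hT hV'm hV'L hum huL
  have t3 := hVlim _ hU.1
  rw [← hU.2] at t3
  have e1 : ∀ k, ∫ q : ℝ × ℝ, prim (ζ k q.1) q.2 * u q.1 q.2 ∂spaceTime T =
      ∫ q : ℝ × ℝ, R k q.2 * u q.1 q.2 ∂spaceTime T + ∫ q : ℝ × ℝ, V k q.1 q.2 *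
        ((∫ τ in (0 : ℝ)..T, u τ q.2) - ∫ τ in (0 : ℝ)..q.1, u τ q.2) ∂spaceTime T := by
    intro k
    rw [← (integral_timeIntegral_mul hT (hVm k) (hVL k) hum huL).2,
      ← integral_add (integrable_mul_of_memLp (hRkL k) huL)
        (integrable_mul_of_memLp (memLp_timeIntegral (hVm k) (hVL k)) huL)]
    refine integral_congr_ae ((heq k).mono fun q hq => ?_)
    simp only [hq, add_mul]
  have t4 := t1.congr e1
  have e2 := tendsto_nhds_unique t4 (t2.add t3)
  have e3 : ∫ q : ℝ × ℝ, u q.1 q.2 ^ 2 ∂spaceTime T = 0 := by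
    have e4 : ∫ q : ℝ × ℝ, u q.1 q.2 ^ 2 ∂spaceTime T = ∫ q : ℝ × ℝ, u q.1 q.2 * D q ∂spaceTime T :=
      integral_congr_ae (huD.mono fun q hq => by
        have h1 : u q.1 q.2 = D q := hq
        simp only [sq, h1])
    have e6 : ∫ q : ℝ × ℝ, u q.1 q.2 * D q ∂spaceTime T = _ :=
      integral_mul_sub (b := fun q : ℝ × ℝ => prim (ζ' q.1) q.2 - R₀ q.2) huL (hpL.sub hR₀L) hI
    rw [e4, e6, integral_mul_sub huL hpL hR₀L]
    simp only [mul_comm (u _ _)]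
    linarith
  have e5 := (l2norm_eq_zero_iff huL).1 e3
  filter_upwards [e5, huD] with q h1 h2
  have h3 : D q = 0 := by rw [← h2, h1]; rfl
  simp only [hD] at h3
  linarith

/-- Weak limits of functions with average `0` at almost every time have the same property: test
with the average of the limit. -/
theorem ae_integral_eq_zero_of_weak_limit
    (hVL : ∀ k, MemLp (fun q : ℝ × ℝ => V k q.1 q.2) 2 (spaceTime T))
    (h0 : ∀ k, ∀ᵐ t ∂timeMeasure T, ∫ θ, V k t θ ∂torusMeasure = 0)
    (hV'm : Measurable fun q : ℝ × ℝ => V' q.1 q.2)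
    (hV'L : MemLp (fun q : ℝ × ℝ => V' q.1 q.2) 2 (spaceTime T))
    (hVlim : ∀ u : ℝ × ℝ → ℝ, MemLp u 2 (spaceTime T) →
      Tendsto (fun k => ∫ q : ℝ × ℝ, V k q.1 q.2 * u q ∂spaceTime T) (hyperfilter ℕ)
        (𝓝 (∫ q : ℝ × ℝ, V' q.1 q.2 * u q ∂spaceTime T))) :
    ∀ᵐ t ∂timeMeasure T, ∫ θ, V' t θ ∂torusMeasure = 0 := by
  set m : ℝ → ℝ := fun t => ∫ θ, V' t θ ∂torusMeasure with hm
  have hmL : MemLp m 2 (timeMeasure T) := memLp_integral_torus hV'm hV'L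
  have hmL' : MemLp (fun q : ℝ × ℝ => m q.1) 2 (spaceTime T) := hmL.comp_fst _
  have e1 : ∀ {W : ℝ → ℝ → ℝ}, MemLp (fun q : ℝ × ℝ => W q.1 q.2) 2 (spaceTime T) →
      ∫ q : ℝ × ℝ, W q.1 q.2 * m q.1 ∂spaceTime T =
        ∫ t, (∫ θ, W t θ ∂torusMeasure) * m t ∂timeMeasure T := by
    intro W hW
    rw [integral_spaceTime (integrable_mul_of_memLp hW hmL')]
    simp only [integral_mul_const]
  have t1 := hVlim _ hmL'
  have e2 : ∀ k, ∫ q : ℝ × ℝ, V k q.1 q.2 * m q.1 ∂spaceTime T = 0 := fun k => by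
    rw [e1 (hVL k)]
    exact integral_eq_zero_of_ae ((h0 k).mono fun t ht => by simp [ht])
  simp only [e2] at t1
  have e3 := tendsto_nhds_unique tendsto_const_nhds t1
  rw [e1 hV'L] at e3
  refine (l2norm_eq_zero_iff hmL).1 ?_
  rw [e3]
  refine integral_congr_ae (ae_of_all _ fun t => ?_)
  simp only [hm, sq]

/-- The fluxes of approximate solutions converge strongly, as `Φ` is Lipschitz. -/
theorem tendsto_l2norm_flux (hΛ : 0 < Λ) (hLip : ∀ x y, |Φ x - Φ y| ≤ Λ * |x - y|)
    (hζL : ∀ k, MemLp (fun q : ℝ × ℝ => ζ k q.1 q.2) 2 (spaceTime T))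
    (hFL : ∀ k, MemLp (fun q : ℝ × ℝ => F k q.1 q.2) 2 (spaceTime T))
    (heL : ∀ k, MemLp (e k) 2 (timeMeasure T))
    (hflux : ∀ k, ∀ᵐ t ∂timeMeasure T,
      l2norm torusMeasure (fun θ => F k t θ - Φ (ζ k t θ)) ≤ e k t)
    (hζ'L : MemLp (fun q : ℝ × ℝ => ζ' q.1 q.2) 2 (spaceTime T))
    (hlim : Tendsto (fun k => l2norm (spaceTime T) fun q : ℝ × ℝ => ζ k q.1 q.2 - ζ' q.1 q.2) atTop
      (𝓝 0)) (he : Tendsto (fun k => l2norm (timeMeasure T) (e k)) atTop (𝓝 0)) :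
    Tendsto (fun k => l2norm (spaceTime T) fun q : ℝ × ℝ => F k q.1 q.2 - Φ (ζ' q.1 q.2)) atTop
      (𝓝 0) := by
  obtain ⟨h1, h2⟩ := tendsto_l2norm_slices hζL hζ'L hlim
  refine squeeze_zero (fun _ => l2norm_nonneg) (fun k => ?_)
    (by simpa using he.add (h2.const_mul Λ))
  have hΦ' : MemLp (fun q : ℝ × ℝ => Φ (ζ' q.1 q.2)) 2 (spaceTime T) :=
    memLp_comp_lipschitz hΛ hLip hζ'L
  have hd : MemLp (fun q : ℝ × ℝ => F k q.1 q.2 - Φ (ζ' q.1 q.2)) 2 (spaceTime T) :=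
    (hFL k).sub hΦ'
  rw [← l2norm_l2norm (f := fun t θ => F k t θ - Φ (ζ' t θ)) hd]
  have h3 := l2norm_const_mul (ρ := timeMeasure T)
    (f := fun t => l2norm torusMeasure fun θ => ζ k t θ - ζ' t θ) Λ
  rw [abs_of_pos hΛ] at h3
  rw [← h3]
  refine le_trans ?_ (l2norm_add_le (heL k) ((h1 k).const_mul Λ))
  refine l2norm_mono ((heL k).add ((h1 k).const_mul Λ)) ?_
  filter_upwards [hflux k, memLp_slice_time (hζL k), memLp_slice_time hζ'L,
    memLp_slice_time (hFL k)] with t h4 h5 h6 h7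
  rw [abs_of_nonneg l2norm_nonneg]
  refine le_trans ?_ (le_abs_self _)
  have h8 : MemLp (fun θ => Φ (ζ k t θ)) 2 torusMeasure := memLp_comp_lipschitz hΛ hLip h5
  have h9 : MemLp (fun θ => Φ (ζ' t θ)) 2 torusMeasure := memLp_comp_lipschitz hΛ hLip h6
  have h10 := l2norm_add_le (h7.sub h8) (h8.sub h9)
  have h11 : (fun θ => (F k t - fun θ => Φ (ζ k t θ)) θ +
      ((fun θ => Φ (ζ k t θ)) - fun θ => Φ (ζ' t θ)) θ) = fun θ => F k t θ - Φ (ζ' t θ) := by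
    funext θ; simp
  rw [h11] at h10
  have h12 : l2norm torusMeasure ((fun θ => Φ (ζ k t θ)) - fun θ => Φ (ζ' t θ)) ≤
      Λ * l2norm torusMeasure fun θ => ζ k t θ - ζ' t θ := by
    have h13 := l2norm_const_mul (ρ := torusMeasure) (f := fun θ => ζ k t θ - ζ' t θ) Λ
    rw [abs_of_pos hΛ] at h13
    rw [← h13]
    refine l2norm_mono ((h5.sub h6).const_mul Λ) (ae_of_all _ fun θ => ?_)
    rw [abs_mul, abs_of_pos hΛ]; exact hLip _ _
  exact h10.trans (add_le_add h4 h12)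

/-- The weak formulation is stable under strong convergence of the fluxes and weak convergence
of `V`: it is tested with the residual of the limit. -/
theorem weak_of_limit (hVL : ∀ k, MemLp (fun q : ℝ × ℝ => V k q.1 q.2) 2 (spaceTime T))
    (hFL : ∀ k, MemLp (fun q : ℝ × ℝ => F k q.1 q.2) 2 (spaceTime T))
    (heL : ∀ k, MemLp (e k) 2 (timeMeasure T))
    (hweak : ∀ k, ∀ᵐ t ∂timeMeasure T, ∀ g, MemL20 g →
      |∫ θ, prim g θ * V k t θ ∂torusMeasure + ∫ θ, g θ * F k t θ ∂torusMeasure +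
        s * ∫ θ, prim g θ * F k t θ ∂torusMeasure| ≤ e k t * l2norm torusMeasure g)
    (hV'm : Measurable fun q : ℝ × ℝ => V' q.1 q.2)
    (hV'L : MemLp (fun q : ℝ × ℝ => V' q.1 q.2) 2 (spaceTime T))
    (hV'0 : ∀ᵐ t ∂timeMeasure T, ∫ θ, V' t θ ∂torusMeasure = 0) {F' : ℝ → ℝ → ℝ}
    (hF'm : Measurable fun q : ℝ × ℝ => F' q.1 q.2)
    (hF'L : MemLp (fun q : ℝ × ℝ => F' q.1 q.2) 2 (spaceTime T))
    (hVlim : ∀ u : ℝ × ℝ → ℝ, MemLp u 2 (spaceTime T) →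
      Tendsto (fun k => ∫ q : ℝ × ℝ, V k q.1 q.2 * u q ∂spaceTime T) (hyperfilter ℕ)
        (𝓝 (∫ q : ℝ × ℝ, V' q.1 q.2 * u q ∂spaceTime T)))
    (hFlim : Tendsto (fun k => l2norm (spaceTime T) fun q : ℝ × ℝ => F k q.1 q.2 - F' q.1 q.2) atTop
      (𝓝 0)) (he : Tendsto (fun k => l2norm (timeMeasure T) (e k)) atTop (𝓝 0)) :
    ∀ᵐ t ∂timeMeasure T, ∀ g, MemL20 g →
      ∫ θ, prim g θ * V' t θ ∂torusMeasure + ∫ θ, g θ * F' t θ ∂torusMeasure +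
        s * ∫ θ, prim g θ * F' t θ ∂torusMeasure = 0 := by
  have hle : ((hyperfilter ℕ : Ultrafilter ℕ) : Filter ℕ) ≤ atTop := Nat.hyperfilter_le_atTop
  set G : ℝ → ℝ → ℝ := fun t => residual s (V' t) (F' t) with hG
  have hGm : Measurable fun q : ℝ × ℝ => G q.1 q.2 := measurable_residual hV'm hF'm
  have hGL : MemLp (fun q : ℝ × ℝ => G q.1 q.2) 2 (spaceTime T) :=
    memLp_residual hV'm hF'm hV'L hF'L
  have hPL : MemLp (fun q : ℝ × ℝ => prim (G q.1) q.2) 2 (spaceTime T) :=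
    memLp_prim_spaceTime hGm hGL
  have hsl : ∀ᵐ t ∂timeMeasure T, MemL20 (V' t) ∧ MemLp (F' t) 2 torusMeasure := by
    filter_upwards [memLp_slice_time hV'L, memLp_slice_time hF'L, hV'0] with t h1 h2 h3
    exact ⟨⟨h1, h3⟩, h2⟩
  -- the functional of the weak formulation, integrated in time
  have e1 : ∀ {W f : ℝ → ℝ → ℝ}, MemLp (fun q : ℝ × ℝ => W q.1 q.2) 2 (spaceTime T) →
      MemLp (fun q : ℝ × ℝ => f q.1 q.2) 2 (spaceTime T) →
      Integrable (fun t => ∫ θ, prim (G t) θ * W t θ ∂torusMeasure +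
        ∫ θ, G t θ * f t θ ∂torusMeasure + s * ∫ θ, prim (G t) θ * f t θ ∂torusMeasure)
        (timeMeasure T) ∧
      ∫ q : ℝ × ℝ, W q.1 q.2 * prim (G q.1) q.2 ∂spaceTime T +
        ∫ q : ℝ × ℝ, f q.1 q.2 * G q.1 q.2 ∂spaceTime T +
        s * ∫ q : ℝ × ℝ, f q.1 q.2 * prim (G q.1) q.2 ∂spaceTime T =
      ∫ t, (∫ θ, prim (G t) θ * W t θ ∂torusMeasure + ∫ θ, G t θ * f t θ ∂torusMeasure +
        s * ∫ θ, prim (G t) θ * f t θ ∂torusMeasure) ∂timeMeasure T := by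
    intro W f hW hf
    have i1 := integrable_mul_of_memLp hPL hW
    have i2 := integrable_mul_of_memLp hGL hf
    have i3 := integrable_mul_of_memLp hPL hf
    have j1 : Integrable (fun t => ∫ θ, prim (G t) θ * W t θ ∂torusMeasure) (timeMeasure T) :=
      i1.integral_prod_left
    have j2 : Integrable (fun t => ∫ θ, G t θ * f t θ ∂torusMeasure) (timeMeasure T) :=
      i2.integral_prod_left
    have j3 : Integrable (fun t => ∫ θ, prim (G t) θ * f t θ ∂torusMeasure) (timeMeasure T) :=
      i3.integral_prod_left
    have j4 : Integrable (fun t => ∫ θ, prim (G t) θ * W t θ ∂torusMeasure +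
        ∫ θ, G t θ * f t θ ∂torusMeasure) (timeMeasure T) := j1.add j2
    refine ⟨j4.add (j3.const_mul s), ?_⟩
    rw [integral_add j4 (j3.const_mul s), integral_add j1 j2, integral_const_mul]
    simp only [mul_comm (W _ _), mul_comm (f _ _)]
    rw [integral_spaceTime i1, integral_spaceTime i2, integral_spaceTime i3]
  have t1 := hVlim _ hPL
  have t2 := (tendsto_integral_mul_of_l2norm (f := fun k (q : ℝ × ℝ) => F k q.1 q.2) hFL hF'L hGL
    hFlim).mono_left hle
  have t3 := (tendsto_integral_mul_of_l2norm (f := fun k (q : ℝ × ℝ) => F k q.1 q.2) hFL hF'L hPL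
    hFlim).mono_left hle
  have t4 := (t1.add t2).add (t3.const_mul s)
  have hGt : MemLp (fun t => l2norm torusMeasure (G t)) 2 (timeMeasure T) := memLp_l2norm hGL
  have t5 : Tendsto (fun k => ∫ q : ℝ × ℝ, V k q.1 q.2 * prim (G q.1) q.2 ∂spaceTime T +
        ∫ q : ℝ × ℝ, F k q.1 q.2 * G q.1 q.2 ∂spaceTime T +
        s * ∫ q : ℝ × ℝ, F k q.1 q.2 * prim (G q.1) q.2 ∂spaceTime T) atTop (𝓝 0) := by
    refine squeeze_zero_norm (a := fun k => l2norm (timeMeasure T) (e k) *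
      l2norm (timeMeasure T) fun t => l2norm torusMeasure (G t)) (fun k => ?_)
      (by simpa using he.mul_const _)
    rw [(e1 (hVL k) (hFL k)).2]
    refine (norm_integral_le_integral_norm _).trans ?_
    refine le_trans ?_ (le_of_abs_le (abs_integral_mul_le (heL k) hGt))
    refine integral_mono_ae (e1 (hVL k) (hFL k)).1.norm (integrable_mul_of_memLp (heL k) hGt) ?_
    filter_upwards [hweak k, hsl] with t h1 h2
    exact h1 (G t) (memL20_residual h2.1 h2.2)
  have e2 := tendsto_nhds_unique t4 (t5.mono_left hle)
  rw [(e1 hV'L hF'L).2] at e2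
  have e3 : ∫ q : ℝ × ℝ, G q.1 q.2 ^ 2 ∂spaceTime T = 0 := by
    rw [integral_spaceTime hGL.integrable_sq, ← e2]
    refine integral_congr_ae (hsl.mono fun t ht => ?_)
    simp only
    rw [integral_mul_residual ht.1 ht.2 (memL20_residual ht.1 ht.2)]
    simp only [sq, hG]
  have e4 := (l2norm_eq_zero_iff hGL).1 e3
  filter_upwards [hsl, ae_ae_of_ae_spaceTime e4] with t h1 h2 g hg
  rw [integral_mul_residual h1.1 h1.2 hg]
  refine integral_eq_zero_of_ae (h2.mono fun θ hθ => ?_)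
  have : residual s (V' t) (F' t) θ = 0 := hθ
  simp [this]

end Limit

/-- Approximate solutions whose errors tend to `0` and whose initial data converge, converge to an
exact solution: strongly in `L²` by stability, and then uniformly in time with values in `H⁻¹`. -/
theorem exists_limit_approxSol {Φ : ℝ → ℝ} {lam Λ s T : ℝ} (hT : 0 < T) (hlam : 0 < lam)
    (hΛ : 0 < Λ) (hs : |s| = 1) (hmono : ∀ x y, lam * (x - y) ^ 2 ≤ (Φ x - Φ y) * (x - y))
    (hLip : ∀ x y, |Φ x - Φ y| ≤ Λ * |x - y|) {R : ℕ → ℝ → ℝ} {ζ V F : ℕ → ℝ → ℝ → ℝ}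
    {e : ℕ → ℝ → ℝ} (h : ∀ k, ApproxSol Φ s T (R k) (ζ k) (V k) (F k) (e k)) {R₀ : ℝ → ℝ}
    (hR₀ : MemLp R₀ 2 torusMeasure)
    (hR : Tendsto (fun k => l2norm torusMeasure fun θ => R k θ - R₀ θ) atTop (𝓝 0))
    (he : Tendsto (fun k => ∫ t, e k t ^ 2 ∂timeMeasure T) atTop (𝓝 0)) {C : ℝ}
    (hζC : ∀ k, ∀ᵐ t ∂timeMeasure T, l2norm torusMeasure (ζ k t) ≤ C)
    (hVC : ∀ k, ∫ q : ℝ × ℝ, V k q.1 q.2 ^ 2 ∂spaceTime T ≤ C) :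
    ∃ ζ' V' : ℝ → ℝ → ℝ, ApproxSol Φ s T R₀ ζ' V' (fun t θ => Φ (ζ' t θ)) (fun _ => 0) ∧
      (∀ᵐ t ∂timeMeasure T, l2norm torusMeasure (ζ' t) ≤ C) ∧
      ∃ a : ℕ → ℝ, Tendsto a atTop (𝓝 0) ∧ ∀ k, ∀ᵐ t ∂timeMeasure T,
        l2norm torusMeasure (prim fun θ => ζ k t θ - ζ' t θ) ≤ a k := by
  set c := 2 * (4 / lam + 1 / 2) with hc
  have hc0 : 0 ≤ c := by positivity
  set γ := 2 * (Λ ^ 2 / lam + 1 / 2) with hγ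
  have hγ0 : 0 ≤ γ := by positivity
  set κ := lam⁻¹ * (1 + γ * (T * Real.exp (γ * T))) with hκ
  have hκ0 : 0 ≤ κ := by positivity
  set r : ℕ → ℝ := fun k => l2norm torusMeasure fun θ => R k θ - R₀ θ with hr
  set ε : ℕ → ℝ := fun k => ∫ t, e k t ^ 2 ∂timeMeasure T with hε
  have hsq : ∀ k l, ∫ q : ℝ × ℝ, (ζ k q.1 q.2 - ζ l q.1 q.2) ^ 2 ∂spaceTime T ≤
      κ * (2 * r k ^ 2 + c * (2 * ε k)) + κ * (2 * r l ^ 2 + c * (2 * ε l)) := by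
    intro k l
    have h1 := ((h k).stability hT hlam hΛ hs hmono hLip (h l) (C := γ) rfl rfl).2
    have h2 := l2norm_sub_sq_le (h k).memLp_R₀ (h l).memLp_R₀ hR₀
    have h3 := integral_add_sq_le (h k).memLp_e (h l).memLp_e
    set A := l2norm torusMeasure (fun θ => R k θ - R l θ) ^ 2 +
      2 * (4 / lam + 1 / 2) * ∫ t, (e k t + e l t) ^ 2 ∂timeMeasure T with hA
    have h4 : A ≤ 2 * r k ^ 2 + 2 * r l ^ 2 + c * (2 * ε k + 2 * ε l) := by
      rw [hA, ← hc]
      exact add_le_add h2 (mul_le_mul_of_nonneg_left h3 hc0)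
    have h5 : ∫ q : ℝ × ℝ, (ζ k q.1 q.2 - ζ l q.1 q.2) ^ 2 ∂spaceTime T ≤ κ * A := by
      have h6 : κ * A = lam⁻¹ * (A + γ * (T * (A * Real.exp (γ * T)))) := by rw [hκ]; ring
      rw [h6, inv_mul_eq_div, le_div_iff₀ hlam]
      linarith
    have h7 := mul_le_mul_of_nonneg_left h4 hκ0
    linarith
  have hα : Tendsto (fun k => κ * (2 * r k ^ 2 + c * (2 * ε k))) atTop (𝓝 0) := by
    have := (((hR.pow 2).const_mul 2).add ((he.const_mul 2).const_mul c)).const_mul κ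
    simpa using this
  obtain ⟨z, hzm, hzL, hzlim⟩ := exists_tendsto_l2norm_sub
    (f := fun k (q : ℝ × ℝ) => ζ k q.1 q.2) (fun k => (h k).memLp_ζ) hα hsq
  obtain ⟨v, hvm, hvL, hvlim⟩ := exists_weak_limit_memLp
    (f := fun k (q : ℝ × ℝ) => V k q.1 q.2) (fun k => (h k).memLp_V) hVC
  set ζ' : ℝ → ℝ → ℝ := fun t θ => z (t, θ) with hζ'
  set V' : ℝ → ℝ → ℝ := fun t θ => v (t, θ) with hV'
  have hel : Tendsto (fun k => l2norm (timeMeasure T) (e k)) atTop (𝓝 0) := by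
    have := (Real.continuous_sqrt.tendsto 0).comp he
    rw [Real.sqrt_zero] at this
    exact this
  have hm0 := ae_integral_eq_zero_of_limit (ζ' := ζ') (fun k => (h k).memLp_ζ) hzL hzlim
    fun k => (h k).mean_ζ
  have hV0 := ae_integral_eq_zero_of_weak_limit (V' := V') (fun k => (h k).memLp_V)
    (fun k => (h k).mean_V) hvm hvL hvlim
  have hp := prim_eq_of_limit (ζ' := ζ') (V' := V') hT.le (fun k => (h k).measurable_ζ)
    (fun k => (h k).memLp_ζ) (fun k => (h k).measurable_V) (fun k => (h k).memLp_V)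
    (fun k => (h k).memLp_R₀) (fun k => (h k).prim_eq) hzm hzL hvm hvL hR₀ hzlim hR hvlim
  have hFm : Measurable fun q : ℝ × ℝ => Φ (ζ' q.1 q.2) :=
    (continuous_of_lipschitz_bound hΛ hLip).measurable.comp hzm
  have hFL : MemLp (fun q : ℝ × ℝ => Φ (ζ' q.1 q.2)) 2 (spaceTime T) :=
    memLp_comp_lipschitz hΛ hLip hzL
  have hFlim := tendsto_l2norm_flux (ζ' := ζ') hΛ hLip (fun k => (h k).memLp_ζ)
    (fun k => (h k).memLp_F) (fun k => (h k).memLp_e) (fun k => (h k).flux) hzL hzlim hel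
  have hw := weak_of_limit (s := s) (V' := V') (F' := fun t θ => Φ (ζ' t θ))
    (fun k => (h k).memLp_V) (fun k => (h k).memLp_F) (fun k => (h k).memLp_e)
    (fun k => (h k).weak) hvm hvL hV0 hFm hFL hvlim hFlim hel
  have hsol : ApproxSol Φ s T R₀ ζ' V' (fun t θ => Φ (ζ' t θ)) (fun _ => 0) :=
    { measurable_ζ := hzm
      measurable_V := hvm
      memLp_ζ := hzL
      memLp_V := hvL
      memLp_F := hFL
      memLp_e := memLp_const 0
      memLp_R₀ := hR₀
      mean_ζ := hm0
      mean_V := hV0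
      prim_eq := hp
      weak := hw.mono fun t ht g hg => by rw [ht g hg, abs_zero, zero_mul]
      flux := ae_of_all _ fun t => by simp [l2norm] }
  refine ⟨ζ', V', hsol, ae_l2norm_le_of_limit (ζ' := ζ') (fun k => (h k).memLp_ζ) hzL hzlim hζC,
    fun k => √((r k ^ 2 + c * ε k) * Real.exp (γ * T)), ?_, fun k => ?_⟩
  · have := (Real.continuous_sqrt.tendsto _).comp
      (((hR.pow 2).add (he.const_mul c)).mul_const (Real.exp (γ * T)))
    simpa [Function.comp_def] using this
  · have h1 := ((h k).stability hT hlam hΛ hs hmono hLip hsol (C := γ) rfl rfl).1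
    filter_upwards [h1] with t ht
    refine Real.le_sqrt_of_sq_le (ht.trans (le_of_eq ?_))
    simp only [add_zero]
    rfl

/-! ### Exact solutions are weak solutions -/

theorem integral_primitive_mul_deriv {v f f' : ℝ → ℝ} {a b : ℝ}
    (hv : IntervalIntegrable v volume a b) (hf : ∀ x, HasDerivAt f (f' x) x)
    (hf' : Continuous f') (c : ℝ) :
    ∫ x in a..b, (c + ∫ s in a..x, v s) * f' x =
      (c + ∫ s in a..b, v s) * f b - c * f a - ∫ x in a..b, v x * f x := by
  have h1 : ∀ x, f a + ∫ s in a..x, f' s = f x := fun x => by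
    rw [intervalIntegral.integral_eq_sub_of_hasDerivAt (fun y _ => hf y)
      (hf'.intervalIntegrable a x)]
    ring
  have h := integral_primitive_mul hv (hf'.intervalIntegrable a b) c (f a)
  simpa only [h1] using h

theorem integral_mul_eq_neg_prim_mul_deriv {w f f' : ℝ → ℝ} (hw : MemL20 w)
    (hf : ∀ x, HasDerivAt f (f' x) x) (hf' : Continuous f') (h01 : f 1 = f 0) :
    ∫ θ, w θ * f θ ∂torusMeasure = -∫ θ, prim w θ * f' θ ∂torusMeasure := by
  have h := integral_primitive_mul_deriv (intervalIntegrable_of_torus hw.integrable) hf hf'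
    (-∫ u in (0 : ℝ)..1, ∫ s in (0 : ℝ)..u, w s)
  have h1 := hw.2
  rw [integral_torus] at h1
  rw [h1, h01] at h
  simp only [neg_add_eq_sub] at h
  rw [integral_torus, integral_torus]
  simp only [prim]
  rw [h]; ring

theorem memLp_spaceTime_of_continuous {T : ℝ} {f : ℝ × ℝ → ℝ} (hf : Continuous f) :
    MemLp f 2 (spaceTime T) := by
  obtain ⟨C, hC⟩ := (isCompact_Icc.prod isCompact_Icc).exists_bound_of_continuousOn
    (s := Icc 0 T ×ˢ Icc (0 : ℝ) 1) hf.continuousOn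
  exact MemLp.of_bound hf.aestronglyMeasurable C
    (ae_spaceTime_mem.mono fun q hq => hC q ⟨hq.1, Ico_subset_Icc_self hq.2⟩)

/-- The partial derivatives of a test function `p`, with `q = ∂²p/∂t∂θ`. -/
theorem IsTestFun.exists_derivs {T : ℝ} {p : ℝ → ℝ → ℝ} (hp : IsTestFun T p) :
    ∃ q : ℝ → ℝ → ℝ, (Continuous fun x : ℝ × ℝ => q x.1 x.2) ∧
      (Continuous fun x : ℝ × ℝ => deriv (fun t => p t x.2) x.1) ∧
      (Continuous fun x : ℝ × ℝ => deriv (fun θ => p x.1 θ) x.2) ∧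
      (∀ t θ, HasDerivAt (fun θ => deriv (fun t => p t θ) t) (q t θ) θ) ∧
      (∀ t θ, HasDerivAt (fun t => deriv (fun θ => p t θ) θ) (q t θ) t) ∧
      (∀ t, deriv (fun t => p t 1) t = deriv (fun t => p t 0) t) ∧
      ∀ t, t ≤ 0 ∨ T ≤ t → ∀ θ, deriv (fun θ => p t θ) θ = 0 := by
  obtain ⟨hs, hper, a, b, ha, hb, hz⟩ := hp
  set P : ℝ × ℝ → ℝ := fun q => p q.1 q.2 with hP
  have hd : Differentiable ℝ P := hs.differentiable (by simp)
  have hs1 : ContDiff ℝ ∞ (fderiv ℝ P) := hs.fderiv_right (by simp)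
  have hd1 : Differentiable ℝ (fderiv ℝ P) := hs1.differentiable (by simp)
  have hs2 : ContDiff ℝ ∞ (fderiv ℝ (fderiv ℝ P)) := hs1.fderiv_right (by simp)
  have ht : ∀ t θ : ℝ, HasDerivAt (fun t => ((t, θ) : ℝ × ℝ)) (1, 0) t := fun t θ =>
    (hasDerivAt_id t).prodMk (hasDerivAt_const t θ)
  have hθ : ∀ t θ : ℝ, HasDerivAt (fun θ => ((t, θ) : ℝ × ℝ)) (0, 1) θ := fun t θ =>
    (hasDerivAt_const θ t).prodMk (hasDerivAt_id θ)
  have e1 : ∀ t θ, deriv (fun t => p t θ) t = fderiv ℝ P (t, θ) (1, 0) := fun t θ =>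
    (HasFDerivAt.comp_hasDerivAt (l := P) t (hd (t, θ)).hasFDerivAt (ht t θ)).deriv
  have e2 : ∀ t θ, deriv (fun θ => p t θ) θ = fderiv ℝ P (t, θ) (0, 1) := fun t θ =>
    (HasFDerivAt.comp_hasDerivAt (l := P) θ (hd (t, θ)).hasFDerivAt (hθ t θ)).deriv
  have hsymm : ∀ x, fderiv ℝ (fderiv ℝ P) x (0, 1) (1, 0) = fderiv ℝ (fderiv ℝ P) x (1, 0) (0, 1) :=
    fun x => (hs.contDiffAt.isSymmSndFDerivAt (by simpa using ENat.LEInfty.out)) (0, 1) (1, 0)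
  refine ⟨fun t θ => fderiv ℝ (fderiv ℝ P) (t, θ) (0, 1) (1, 0), ?_, ?_, ?_, ?_, ?_, ?_, ?_⟩
  · exact (hs2.continuous.clm_apply continuous_const).clm_apply continuous_const
  · simp only [e1]; exact hs1.continuous.clm_apply continuous_const
  · simp only [e2]; exact hs1.continuous.clm_apply continuous_const
  · intro t θ
    simp only [e1]
    have := (HasFDerivAt.comp_hasDerivAt (l := fderiv ℝ P) θ (hd1 (t, θ)).hasFDerivAt
      (hθ t θ)).clm_apply (hasDerivAt_const θ ((1, 0) : ℝ × ℝ))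
    simpa using this
  · intro t θ
    simp only [e2, hsymm]
    have := (HasFDerivAt.comp_hasDerivAt (l := fderiv ℝ P) t (hd1 (t, θ)).hasFDerivAt
      (ht t θ)).clm_apply (hasDerivAt_const t ((0, 1) : ℝ × ℝ))
    simpa using this
  · intro t
    have : (fun t => p t 1) = fun t => p t 0 := by
      funext t; simpa using hper t 0
    rw [this]
  · intro t htT θ
    have : (fun θ => p t θ) = fun _ => 0 := by
      funext θ
      refine hz t (fun h => ?_) θ
      rcases htT with h1 | h1
      · linarith [h.1]
      · linarith [h.2]
    rw [this, deriv_const]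

section ByParts
variable {T : ℝ} {ζ V : ℝ → ℝ → ℝ} {p q : ℝ → ℝ → ℝ}

/-- Integration by parts in space of `∫∫ ζ ∂p/∂t`, where `q = ∂²p/∂t∂θ`. -/
theorem integral_mul_deriv_time (hζm : Measurable fun q : ℝ × ℝ => ζ q.1 q.2)
    (hζL : MemLp (fun q : ℝ × ℝ => ζ q.1 q.2) 2 (spaceTime T))
    (hζ0 : ∀ᵐ t ∂timeMeasure T, ∫ θ, ζ t θ ∂torusMeasure = 0)
    (hqc : Continuous fun x : ℝ × ℝ => q x.1 x.2)
    (hpc : Continuous fun x : ℝ × ℝ => deriv (fun t => p t x.2) x.1)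
    (hpq : ∀ t θ, HasDerivAt (fun θ => deriv (fun t => p t θ) t) (q t θ) θ)
    (hper : ∀ t, deriv (fun t => p t 1) t = deriv (fun t => p t 0) t) :
    ∫ x, ζ x.1 x.2 * deriv (fun t => p t x.2) x.1 ∂spaceTime T =
      -∫ x : ℝ × ℝ, prim (ζ x.1) x.2 * q x.1 x.2 ∂spaceTime T := by
  have i1 := integrable_mul_of_memLp hζL (memLp_spaceTime_of_continuous (T := T) hpc)
  have i2 := integrable_mul_of_memLp (memLp_prim_spaceTime hζm hζL)
    (memLp_spaceTime_of_continuous (T := T) hqc)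
  rw [integral_spaceTime i1, integral_spaceTime i2, ← integral_neg]
  refine integral_congr_ae ?_
  filter_upwards [memLp_slice_time hζL, hζ0] with t h1 h2
  exact integral_mul_eq_neg_prim_mul_deriv ⟨h1, h2⟩ (hpq t)
    (hqc.comp (by fun_prop : Continuous fun θ : ℝ => (t, θ))) (hper t)

/-- Integration by parts in time of `∫∫ V ∂p/∂θ`, where `q = ∂²p/∂t∂θ` and `R₀` is arbitrary. -/
theorem integral_mul_deriv_space (hT : 0 < T) (hVm : Measurable fun q : ℝ × ℝ => V q.1 q.2)
    (hVL : MemLp (fun q : ℝ × ℝ => V q.1 q.2) 2 (spaceTime T)) {R₀ : ℝ → ℝ}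
    (hR₀ : MemLp R₀ 2 torusMeasure) (hqc : Continuous fun x : ℝ × ℝ => q x.1 x.2)
    (hpc : Continuous fun x : ℝ × ℝ => deriv (fun θ => p x.1 θ) x.2)
    (hpq : ∀ t θ, HasDerivAt (fun t => deriv (fun θ => p t θ) θ) (q t θ) t)
    (hz : ∀ t, t ≤ 0 ∨ T ≤ t → ∀ θ, deriv (fun θ => p t θ) θ = 0) :
    ∫ x, V x.1 x.2 * deriv (fun θ => p x.1 θ) x.2 ∂spaceTime T =
      -∫ x : ℝ × ℝ, (R₀ x.2 + ∫ τ in (0 : ℝ)..x.1, V τ x.2) * q x.1 x.2 ∂spaceTime T := by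
  have hRL : MemLp (fun x : ℝ × ℝ => R₀ x.2) 2 (spaceTime T) := hR₀.comp_snd _
  have i1 := integrable_mul_of_memLp hVL (memLp_spaceTime_of_continuous (T := T) hpc)
  have i2 : Integrable (fun x : ℝ × ℝ => (R₀ x.2 + ∫ τ in (0 : ℝ)..x.1, V τ x.2) * q x.1 x.2)
      (spaceTime T) := integrable_mul_of_memLp (hRL.add (memLp_timeIntegral hVm hVL))
    (memLp_spaceTime_of_continuous (T := T) hqc)
  rw [integral_spaceTime_symm i1, integral_spaceTime_symm i2, ← integral_neg]
  refine integral_congr_ae ?_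
  filter_upwards [memLp_slice_torus hVL] with θ h1
  have h0T : (0 : ℝ) ∈ Icc 0 T := ⟨le_rfl, hT.le⟩
  have h := integral_primitive_mul_deriv
    (intervalIntegrable_of_time (h1.integrable (by simp)) h0T ⟨hT.le, le_rfl⟩)
    (fun t => hpq t θ) (hqc.comp (by fun_prop : Continuous fun t : ℝ => (t, θ))) (R₀ θ)
  rw [hz 0 (Or.inl le_rfl), hz T (Or.inr le_rfl)] at h
  simp only [integral_time hT.le]
  simp only [mul_zero, sub_zero, zero_sub] at h
  rw [h, neg_neg]

end ByParts

/-- An exact solution in the integrated form of `ApproxSol` is a weak solution. -/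
theorem ApproxSol.isWeakSolution {φ : ℝ → ℝ} {s T : ℝ} (hT : 0 < T) {ζ₀ : ℝ → ℝ}
    (hζ₀ : MemLp ζ₀ 2 torusMeasure) {ζ V : ℝ → ℝ → ℝ}
    (h : ApproxSol (deriv φ) s T (prim ζ₀) ζ V (fun t θ => deriv φ (ζ t θ)) fun _ => 0) {C : ℝ}
    (hC : ∀ᵐ t ∂timeMeasure T, l2norm torusMeasure (ζ t) ≤ C) : IsWeakSolution φ s T ζ₀ ζ where
  measurable := h.measurable_ζ.aestronglyMeasurable
  mean_zero := by
    filter_upwards [memLp_slice_time h.memLp_ζ, h.mean_ζ] with t h1 h2 using ⟨h1, h2⟩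
  bounded := ⟨C ^ 2, hC.mono fun t ht => by
    rw [← l2norm_sq]; exact pow_le_pow_left₀ l2norm_nonneg ht 2⟩
  memLp_flux := h.memLp_F
  weak_form := by
    refine ⟨V, ⟨h.memLp_V, ?_, fun p hp => ?_⟩, ?_⟩
    · filter_upwards [memLp_slice_time h.memLp_V, h.mean_V] with t h1 h2 using ⟨h1, h2⟩
    · obtain ⟨q, hqc, hptc, hpθc, hq1, hq2, hper, hz⟩ := hp.exists_derivs
      rw [integral_mul_deriv_time h.measurable_ζ h.memLp_ζ h.mean_ζ hqc hptc hq1 hper,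
        integral_mul_deriv_space hT h.measurable_V h.memLp_V h.memLp_R₀ hqc hpθc hq2 hz]
      congr 1
      exact integral_congr_ae (h.prim_eq.mono fun x hx => by simp only [hx])
    · filter_upwards [h.weak] with t ht g hg
      have := ht g hg
      rw [zero_mul, abs_nonpos_iff] at this
      linarith
  initial := by
    intro ε hε
    set I := ∫ q : ℝ × ℝ, V q.1 q.2 ^ 2 ∂spaceTime T with hI
    have hI0 : 0 ≤ I := integral_nonneg fun _ => sq_nonneg _
    refine ⟨ε ^ 2 / (I + 1), by positivity, ?_⟩
    filter_upwards [memLp_slice_time h.memLp_ζ, ae_ae_of_ae_spaceTime h.prim_eq,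
      ae_restrict_mem measurableSet_Icc] with t h1 h2 ht htδ
    rw [hMinusNorm_eq, l2norm_congr (g := fun θ => ∫ τ in (0 : ℝ)..t, V τ θ)]
    · refine le_of_sq_le_sq ?_ hε.le
      refine (l2norm_timeIntegral_le h.measurable_V h.memLp_V ht).2.trans ?_
      rw [lt_div_iff₀ (by positivity)] at htδ
      nlinarith [ht.1]
    · filter_upwards [h2, ae_torus_mem] with θ h3 hθ
      rw [prim_sub (h1.integrable (by simp)) (hζ₀.integrable (by simp)) (Ico_subset_Icc_self hθ),
        h3]
      ring

/-! ### Weak solutions are exact solutions -/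

theorem exists_Icc_of_isCompact_subset_Ioo {K : Set ℝ} (hK : IsCompact K) {u v : ℝ} (huv : u < v)
    (hs : K ⊆ Ioo u v) : ∃ a b, u < a ∧ b < v ∧ K ⊆ Icc a b := by
  rcases K.eq_empty_or_nonempty with rfl | hne
  · exact ⟨v, u, huv, huv, empty_subset _⟩
  · obtain ⟨a, ha⟩ := hK.exists_isLeast hne
    obtain ⟨b, hb⟩ := hK.exists_isGreatest hne
    exact ⟨a, b, (hs ha.1).1, (hs hb.1).2, fun x hx => ⟨ha.2 hx, hb.2 hx⟩⟩

/-- A smooth function with integral `0`, supported in `(0,T)`, is the derivative of a smooth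
function supported in `(0,T)`. -/
theorem exists_primitive_of_integral_eq_zero {T : ℝ} (hT : 0 < T) {h : ℝ → ℝ}
    (hs : ContDiff ℝ ∞ h) {a b : ℝ} (ha : 0 < a) (hb : b < T) (hz : ∀ t, t ∉ Icc a b → h t = 0)
    (hi : ∫ t, h t = 0) :
    ∃ χ : ℝ → ℝ, ContDiff ℝ ∞ χ ∧ (∃ a b, 0 < a ∧ b < T ∧ ∀ t, t ∉ Icc a b → χ t = 0) ∧
      deriv χ = h := by
  have hd : ∀ t, HasDerivAt (fun t => ∫ τ in (0 : ℝ)..t, h τ) (h t) t := fun t =>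
    (hs.continuous.integral_hasStrictDerivAt 0 t).hasDerivAt
  have hd' : deriv (fun t => ∫ τ in (0 : ℝ)..t, h τ) = h := funext fun t => (hd t).deriv
  refine ⟨fun t => ∫ τ in (0 : ℝ)..t, h τ, ?_, ⟨min a (T / 2), max b (T / 2), ?_, ?_, ?_⟩, hd'⟩
  · rw [contDiff_infty_iff_deriv, hd']
    exact ⟨fun t => (hd t).differentiableAt, hs⟩
  · exact lt_min ha (by linarith)
  · exact max_lt hb (by linarith)
  · intro t ht
    rw [mem_Icc, not_and_or, not_le, not_le] at ht
    rcases ht with ht | ht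
    · have hta := (lt_min_iff.1 ht).1
      refine (intervalIntegral.integral_congr (g := fun _ => 0)
        fun x hx => hz x fun hx' => ?_).trans (by simp)
      have : x ≤ max 0 t := hx.2
      have := max_lt ha hta
      linarith [hx'.1]
    · have htb := (max_lt_iff.1 ht).1
      have ht0 : 0 < t := by linarith [(max_lt_iff.1 ht).2]
      have hsupp : Function.support h ⊆ Ioc 0 t := fun x hx => by
        by_contra hx'
        refine hx (hz x fun hx2 => hx' ⟨ha.trans_le hx2.1, hx2.2.trans htb.le⟩)
      show ∫ τ in (0 : ℝ)..t, h τ = 0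
      rw [intervalIntegral.integral_eq_integral_of_support_subset hsupp, hi]

/-- The lemma of du Bois-Reymond: a function whose distributional derivative vanishes is
constant. -/
theorem ae_eq_const_of_integral_mul_deriv_eq_zero {T : ℝ} (hT : 0 < T) {d : ℝ → ℝ}
    (hd : Integrable d (timeMeasure T))
    (h : ∀ χ : ℝ → ℝ, ContDiff ℝ ∞ χ → (∃ a b, 0 < a ∧ b < T ∧ ∀ t, t ∉ Icc a b → χ t = 0) →
      ∫ t, d t * deriv χ t ∂timeMeasure T = 0) :
    ∃ c, ∀ᵐ t ∂timeMeasure T, d t = c := by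
  let bump : ContDiffBump (T / 2) := ⟨T / 8, T / 4, by positivity, by linarith⟩
  set χ₀ : ℝ → ℝ := bump.normed volume with hχ₀
  have hχs : ContDiff ℝ ∞ χ₀ := bump.contDiff_normed
  have hχc : HasCompactSupport χ₀ := bump.hasCompactSupport_normed
  have hχi : ∫ t, χ₀ t = 1 := bump.integral_normed
  have hχsub : tsupport χ₀ ⊆ Ioo 0 T := by
    rw [hχ₀, bump.tsupport_normed_eq]
    intro x hx
    rw [mem_closedBall_iff_norm, Real.norm_eq_abs, abs_le] at hx
    have hr : bump.rOut = T / 4 := rfl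
    rw [hr] at hx
    constructor <;> linarith [hx.1, hx.2]
  set c := ∫ t, d t * χ₀ t ∂timeMeasure T with hc
  refine ⟨c, ?_⟩
  have hbdd : ∀ {g : ℝ → ℝ}, Continuous g → Integrable (fun t => d t * g t) (timeMeasure T) := by
    intro g hg
    obtain ⟨C, hC⟩ := isCompact_Icc.exists_bound_of_continuousOn (s := Icc 0 T) hg.continuousOn
    exact hd.mul_bdd hg.aestronglyMeasurable ((ae_restrict_mem measurableSet_Icc).mono hC)
  have hfund : ∀ᵐ t ∂(volume : Measure ℝ), t ∈ Ioo 0 T → d t - c = 0 := by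
    refine isOpen_Ioo.ae_eq_zero_of_integral_contDiff_smul_eq_zero ?_ fun g hgs hgc hgsub => ?_
    · have h1 : IntegrableOn (fun t => d t - c) (Icc 0 T) := hd.sub (integrable_const c)
      exact (h1.mono_set Ioo_subset_Icc_self).locallyIntegrableOn
    -- subtracting a multiple of the bump function makes the integral of a test function `g` vanish
    · set k := ∫ t, g t with hk
      obtain ⟨a, b, ha, hb, hab⟩ := exists_Icc_of_isCompact_subset_Ioo
        (hgc.isCompact.union hχc.isCompact) hT (union_subset hgsub hχsub)
      have hgz : ∀ t, t ∉ Icc a b → g t = 0 := fun t ht =>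
        image_eq_zero_of_notMem_tsupport fun h' => ht (hab (Or.inl h'))
      have hχz : ∀ t, t ∉ Icc a b → χ₀ t = 0 := fun t ht =>
        image_eq_zero_of_notMem_tsupport fun h' => ht (hab (Or.inr h'))
      have hgi : Integrable g := hgs.continuous.integrable_of_hasCompactSupport hgc
      have hχint : Integrable χ₀ := hχs.continuous.integrable_of_hasCompactSupport hχc
      obtain ⟨χ, hχ1, hχ2, hχ3⟩ := exists_primitive_of_integral_eq_zero hT
        (h := fun t => g t - k * χ₀ t) (hgs.sub (contDiff_const.mul hχs)) ha hb
        (fun t ht => by rw [hgz t ht, hχz t ht]; simp)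
        (by rw [integral_sub hgi (hχint.const_mul k), integral_const_mul, hχi]; simp [hk])
      have h1 := h χ hχ1 hχ2
      rw [hχ3] at h1
      have h2 : ∫ t, d t * (g t - k * χ₀ t) ∂timeMeasure T =
          ∫ t, d t * g t ∂timeMeasure T - k * c := by
        have h3 : ∀ t, d t * (g t - k * χ₀ t) = d t * g t - k * (d t * χ₀ t) := fun t => by ring
        simp only [h3]
        rw [integral_sub (hbdd hgs.continuous) ((hbdd hχs.continuous).const_mul k),
          integral_const_mul]
      have hgT : ∀ t, t ∉ Icc 0 T → g t = 0 := fun t ht =>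
        hgz t fun h' => ht ⟨ha.le.trans h'.1, h'.2.trans hb.le⟩
      have h4 : ∫ t, g t ∂timeMeasure T = k :=
        setIntegral_eq_integral_of_forall_compl_eq_zero hgT
      have h5 : ∫ t, g t • (d t - c) = ∫ t, (d t * g t - c * g t) ∂timeMeasure T := by
        rw [← setIntegral_eq_integral_of_forall_compl_eq_zero (s := Icc 0 T)
          fun t ht => by rw [hgT t ht, zero_smul]]
        refine integral_congr_ae (ae_of_all _ fun t => ?_)
        simp only [smul_eq_mul]; ring
      rw [h5, integral_sub (hbdd hgs.continuous) (hgi.restrict.const_mul c), integral_const_mul, h4]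
      linarith
  rw [timeMeasure, ← Measure.restrict_congr_set Ioo_ae_eq_Icc, ae_restrict_iff' measurableSet_Ioo]
  exact hfund.mono fun t h1 h2 => sub_eq_zero.1 (h1 h2)

/-- Completeness of the trigonometric system. -/
theorem ae_eq_zero_of_integral_mul_cos_sin {f : ℝ → ℝ} (hf : MemLp f 2 torusMeasure)
    (hc : ∀ n : ℤ, ∫ θ, f θ * Real.cos (2 * Real.pi * n * θ) ∂torusMeasure = 0)
    (hs : ∀ n : ℤ, ∫ θ, f θ * Real.sin (2 * Real.pi * n * θ) ∂torusMeasure = 0) :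
    f =ᵐ[torusMeasure] 0 := by
  have hi : Integrable f torusMeasure := hf.integrable (by simp)
  have hfc : MemLp (fun x => (f x : ℂ)) 2 (volume.restrict (Ioc (0 : ℝ) 1)) := by
    rw [← torusMeasure_eq_Ioc]; exact hf.ofReal
  have hsum := hasSum_sq_fourierCoeffOn zero_lt_one hfc
  have hcoef : ∀ n, fourierCoeffOn zero_lt_one (fun x => (f x : ℂ)) n = 0 := by
    intro n
    rw [fourierCoeffOn_eq_integral, intervalIntegral.integral_of_le zero_le_one,
      ← torusMeasure_eq_Ioc]
    have e1 : ∀ x : ℝ, fourier (-n) (x : AddCircle ((1 : ℝ) - 0)) • (f x : ℂ) =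
        ((f x * Real.cos (2 * Real.pi * n * x) : ℝ) : ℂ) -
          Complex.I * ((f x * Real.sin (2 * Real.pi * n * x) : ℝ) : ℂ) := by
      intro x
      rw [fourier_coe_apply]
      have e2 : 2 * Real.pi * Complex.I * ((-n : ℤ) : ℂ) * x / ((1 - 0 : ℝ) : ℂ) =
          ((-(2 * Real.pi * n * x) : ℝ) : ℂ) * Complex.I := by
        push_cast; ring
      rw [e2, Complex.exp_mul_I, ← Complex.ofReal_cos, ← Complex.ofReal_sin, Real.cos_neg,
        Real.sin_neg, smul_eq_mul]
      push_cast; ring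
    simp only [e1]
    have i1 : Integrable (fun θ => f θ * Real.cos (2 * Real.pi * n * θ)) torusMeasure :=
      hi.mul_bdd (c := 1) (by fun_prop) (ae_of_all _ fun x => Real.abs_cos_le_one _)
    have i2 : Integrable (fun θ => f θ * Real.sin (2 * Real.pi * n * θ)) torusMeasure :=
      hi.mul_bdd (c := 1) (by fun_prop) (ae_of_all _ fun x => Real.abs_sin_le_one _)
    rw [integral_sub i1.ofReal (i2.ofReal.const_mul _), integral_const_mul,
      integral_complex_ofReal, integral_complex_ofReal, hc, hs]
    simp
  simp only [hcoef, norm_zero, ne_eq, OfNat.ofNat_ne_zero, not_false_eq_true, zero_pow] at hsum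
  have h0 := hsum.unique hasSum_zero
  refine (l2norm_eq_zero_iff hf).1 ?_
  rw [integral_torus]
  simpa using h0

theorem integral_timeIntegral {T t : ℝ} (ht : t ∈ Icc 0 T) {V : ℝ → ℝ → ℝ}
    (hVL : MemLp (fun q : ℝ × ℝ => V q.1 q.2) 2 (spaceTime T)) :
    ∫ θ, (∫ τ in (0 : ℝ)..t, V τ θ) ∂torusMeasure =
      ∫ τ in (0 : ℝ)..t, ∫ θ, V τ θ ∂torusMeasure := by
  have hle : spaceTime t ≤ spaceTime T := by
    rw [spaceTime, spaceTime, torusMeasure, Measure.prod_restrict, Measure.prod_restrict]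
    exact Measure.restrict_mono (prod_mono (Icc_subset_Icc_right ht.2) le_rfl) le_rfl
  have hi : Integrable (fun q : ℝ × ℝ => V q.1 q.2) (spaceTime t) :=
    (hVL.integrable (by simp)).mono_measure hle
  simp only [← integral_time ht.1]
  exact (integral_spaceTime_symm hi).symm.trans (integral_spaceTime hi)

/-- A property which holds at almost every time holds at arbitrarily small times. -/
theorem exists_lt_of_ae_time {T δ : ℝ} (hT : 0 < T) (hδ : 0 < δ) {p : ℝ → Prop}
    (h : ∀ᵐ t ∂timeMeasure T, p t) : ∃ t ∈ Icc 0 T, t < δ ∧ p t := by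
  have hsub : Ioo 0 (min δ T) ⊆ Icc 0 T := fun t ht => ⟨ht.1.le, (lt_min_iff.1 ht.2).2.le⟩
  have h1 := ae_restrict_of_ae_restrict_of_subset hsub h
  have hne : NeBot (ae (volume.restrict (Ioo 0 (min δ T)))) := by
    rw [ae_neBot, Ne, Measure.restrict_eq_zero, Real.volume_Ioo, ENNReal.ofReal_eq_zero, not_le]
    simpa using lt_min hδ hT
  obtain ⟨t, h2, h3⟩ := (h1.and (ae_restrict_mem measurableSet_Ioo)).exists
  exact ⟨t, hsub h3, (lt_min_iff.1 h3.2).1, h2⟩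

section DistributionalDerivative
variable {T : ℝ} {ζ V : ℝ → ℝ → ℝ} {ζ₀ : ℝ → ℝ}

/-- The defect in the identity `prim ζ(t) = prim ζ₀ + ∫₀ᵗ V`. -/
def timeDefect (ζ₀ : ℝ → ℝ) (ζ V : ℝ → ℝ → ℝ) (t θ : ℝ) : ℝ :=
  prim (ζ t) θ - (prim ζ₀ θ + ∫ τ in (0 : ℝ)..t, V τ θ)

theorem memLp_timeDefect (hζm : Measurable fun q : ℝ × ℝ => ζ q.1 q.2)
    (hζL : MemLp (fun q : ℝ × ℝ => ζ q.1 q.2) 2 (spaceTime T))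
    (hVm : Measurable fun q : ℝ × ℝ => V q.1 q.2)
    (hVL : MemLp (fun q : ℝ × ℝ => V q.1 q.2) 2 (spaceTime T)) (hζ₀ : MemLp ζ₀ 2 torusMeasure) :
    MemLp (fun q : ℝ × ℝ => timeDefect ζ₀ ζ V q.1 q.2) 2 (spaceTime T) := by
  have hRL : MemLp (fun x : ℝ × ℝ => prim ζ₀ x.2) 2 (spaceTime T) :=
    (memLp_prim (hζ₀.integrable (by simp))).comp_snd _
  exact (memLp_prim_spaceTime hζm hζL).sub (hRL.add (memLp_timeIntegral hVm hVL))

/-- Testing the equation `∂ζ/∂t = ∂V/∂θ` with `χ(t) e(θ)`: the defect is orthogonal to `χ' ⊗ e'`. -/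
theorem integral_timeDefect_mul (hT : 0 < T) (hζm : Measurable fun q : ℝ × ℝ => ζ q.1 q.2)
    (hζL : MemLp (fun q : ℝ × ℝ => ζ q.1 q.2) 2 (spaceTime T))
    (hζ0 : ∀ᵐ t ∂timeMeasure T, ∫ θ, ζ t θ ∂torusMeasure = 0)
    (hVm : Measurable fun q : ℝ × ℝ => V q.1 q.2)
    (hVL : MemLp (fun q : ℝ × ℝ => V q.1 q.2) 2 (spaceTime T)) (hζ₀ : MemLp ζ₀ 2 torusMeasure)
    (hdist : ∀ p : ℝ → ℝ → ℝ, IsTestFun T p →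
      ∫ q, ζ q.1 q.2 * deriv (fun t => p t q.2) q.1 ∂spaceTime T =
        ∫ q, V q.1 q.2 * deriv (fun θ => p q.1 θ) q.2 ∂spaceTime T)
    {χ e : ℝ → ℝ} (hχ : ContDiff ℝ ∞ χ)
    (hχz : ∃ a b, 0 < a ∧ b < T ∧ ∀ t, t ∉ Icc a b → χ t = 0)
    (he : ContDiff ℝ ∞ e) (hper : ∀ θ, e (θ + 1) = e θ) :
    ∫ t, (∫ θ, timeDefect ζ₀ ζ V t θ * deriv e θ ∂torusMeasure) * deriv χ t ∂timeMeasure T = 0 := by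
  have hχd : ∀ t, HasDerivAt χ (deriv χ t) t := fun t =>
    ((hχ.differentiable (by simp)) t).hasDerivAt
  have hed : ∀ t, HasDerivAt e (deriv e t) t := fun t =>
    ((he.differentiable (by simp)) t).hasDerivAt
  have hχc : Continuous (deriv χ) := hχ.continuous_deriv (by simp)
  have hec : Continuous (deriv e) := he.continuous_deriv (by simp)
  have hp : IsTestFun T fun t θ => χ t * e θ := by
    refine ⟨(hχ.comp contDiff_fst).mul (he.comp contDiff_snd), fun t θ => by simp only [hper], ?_⟩
    obtain ⟨a, b, ha, hb, hz⟩ := hχz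
    exact ⟨a, b, ha, hb, fun t ht θ => by simp only [hz t ht, zero_mul]⟩
  have hpt : ∀ t θ, deriv (fun t => χ t * e θ) t = deriv χ t * e θ := fun t θ =>
    ((hχd t).mul_const (e θ)).deriv
  have hpθ : ∀ t θ, deriv (fun θ => χ t * e θ) θ = χ t * deriv e θ := fun t θ =>
    ((hed θ).const_mul (χ t)).deriv
  have hR₀ : MemLp (prim ζ₀) 2 torusMeasure := memLp_prim (hζ₀.integrable (by simp))
  have hqc : Continuous fun x : ℝ × ℝ => deriv χ x.1 * deriv e x.2 := by fun_prop
  have hec' : Continuous e := he.continuous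
  have hχc' : Continuous χ := hχ.continuous
  have e1 := integral_mul_deriv_time (p := fun t θ => χ t * e θ)
    (q := fun t θ => deriv χ t * deriv e θ) hζm hζL hζ0 hqc (by simp only [hpt]; fun_prop)
    (fun t θ => by simp only [hpt]; exact (hed θ).const_mul _)
    (fun t => by simp only [hpt]; rw [← zero_add (1 : ℝ), hper])
  have e2 := integral_mul_deriv_space (p := fun t θ => χ t * e θ)
    (q := fun t θ => deriv χ t * deriv e θ) hT hVm hVL hR₀ hqc (by simp only [hpθ]; fun_prop)
    (fun t θ => by simp only [hpθ]; exact (hχd t).mul_const _) (by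
      obtain ⟨a, b, ha, hb, hz⟩ := hχz
      intro t ht θ
      rw [hpθ, hz t (fun h => by rcases ht with h' | h' <;> linarith [h.1, h.2]), zero_mul])
  have hqL := memLp_spaceTime_of_continuous (T := T) hqc
  have i0 : Integrable (fun x : ℝ × ℝ => timeDefect ζ₀ ζ V x.1 x.2 *
      (deriv χ x.1 * deriv e x.2)) (spaceTime T) :=
    integrable_mul_of_memLp (memLp_timeDefect hζm hζL hVm hVL hζ₀) hqL
  have hRL : MemLp (fun x : ℝ × ℝ => prim ζ₀ x.2) 2 (spaceTime T) := hR₀.comp_snd _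
  have i1 : Integrable (fun x : ℝ × ℝ => prim (ζ x.1) x.2 * (deriv χ x.1 * deriv e x.2))
    (spaceTime T) := integrable_mul_of_memLp (memLp_prim_spaceTime hζm hζL) hqL
  have i2 : Integrable (fun x : ℝ × ℝ => (prim ζ₀ x.2 + ∫ τ in (0 : ℝ)..x.1, V τ x.2) *
    (deriv χ x.1 * deriv e x.2)) (spaceTime T) :=
    integrable_mul_of_memLp (hRL.add (memLp_timeIntegral hVm hVL)) hqL
  have e3 : ∫ x : ℝ × ℝ, timeDefect ζ₀ ζ V x.1 x.2 * (deriv χ x.1 * deriv e x.2)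
      ∂spaceTime T = 0 := by
    simp only [timeDefect, sub_mul]
    rw [integral_sub i1 i2]
    have := hdist _ hp
    linarith
  rw [integral_spaceTime i0] at e3
  rw [← e3]
  refine integral_congr_ae (ae_of_all _ fun t => ?_)
  simp only []
  rw [← integral_mul_const]
  refine integral_congr_ae (ae_of_all _ fun θ => ?_)
  simp only []
  ring

/-- The pairing of the defect with `e'` is constant in time by the lemma of du Bois-Reymond, and
vanishes at time `0` by the initial condition. -/
theorem integral_timeDefect_mul_deriv_eq_zero (hT : 0 < T)
    (hζm : Measurable fun q : ℝ × ℝ => ζ q.1 q.2)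
    (hζL : MemLp (fun q : ℝ × ℝ => ζ q.1 q.2) 2 (spaceTime T))
    (hζ0 : ∀ᵐ t ∂timeMeasure T, ∫ θ, ζ t θ ∂torusMeasure = 0)
    (hVm : Measurable fun q : ℝ × ℝ => V q.1 q.2)
    (hVL : MemLp (fun q : ℝ × ℝ => V q.1 q.2) 2 (spaceTime T)) (hζ₀ : MemLp ζ₀ 2 torusMeasure)
    (hdist : ∀ p : ℝ → ℝ → ℝ, IsTestFun T p →
      ∫ q, ζ q.1 q.2 * deriv (fun t => p t q.2) q.1 ∂spaceTime T =
        ∫ q, V q.1 q.2 * deriv (fun θ => p q.1 θ) q.2 ∂spaceTime T)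
    (hinit : ∀ ε > 0, ∃ δ > 0, ∀ᵐ t ∂timeMeasure T, t < δ →
      l2norm torusMeasure (prim fun θ => ζ t θ - ζ₀ θ) ≤ ε)
    {e : ℝ → ℝ} (he : ContDiff ℝ ∞ e) (hper : ∀ θ, e (θ + 1) = e θ) :
    ∀ᵐ t ∂timeMeasure T, ∫ θ, timeDefect ζ₀ ζ V t θ * deriv e θ ∂torusMeasure = 0 := by
  have hec : Continuous (deriv e) := he.continuous_deriv (by simp)
  have heL : MemLp (deriv e) 2 torusMeasure := memLp_of_continuousOn hec.continuousOn
  have hdi : Integrable (fun t => ∫ θ, timeDefect ζ₀ ζ V t θ * deriv e θ ∂torusMeasure)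
      (timeMeasure T) :=
    (integrable_mul_of_memLp (memLp_timeDefect hζm hζL hVm hVL hζ₀)
      (memLp_spaceTime_of_continuous (T := T) (f := fun x => deriv e x.2)
        (by fun_prop))).integral_prod_left
  obtain ⟨c, hc⟩ := ae_eq_const_of_integral_mul_deriv_eq_zero hT hdi fun χ hχ hχz =>
    integral_timeDefect_mul hT hζm hζL hζ0 hVm hVL hζ₀ hdist hχ hχz he hper
  suffices hc0 : c = 0 by rwa [hc0] at hc
  -- at small times both the distance of `ζ t` to `ζ₀` in `H⁻¹` and the integral of `V` are small
  set L := l2norm torusMeasure (deriv e) with hL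
  have hL0 : 0 ≤ L := l2norm_nonneg
  set I := ∫ q : ℝ × ℝ, V q.1 q.2 ^ 2 ∂spaceTime T with hI
  have hI0 : 0 ≤ I := integral_nonneg fun _ => sq_nonneg _
  have hcε : ∀ ε > 0, |c| ≤ ε * (2 * L) := by
    intro ε hε
    obtain ⟨δ, hδ, hδ'⟩ := hinit ε hε
    obtain ⟨t, ht, htδ, h1, h2, h3⟩ := exists_lt_of_ae_time hT
      (lt_min hδ (show 0 < ε ^ 2 / (I + 1) by positivity))
      (hδ'.and (hc.and (memLp_slice_time hζL)))
    have hV := l2norm_timeIntegral_le hVm hVL ht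
    have hVε : l2norm torusMeasure (fun θ => ∫ τ in (0 : ℝ)..t, V τ θ) ≤ ε := by
      refine le_of_sq_le_sq (hV.2.trans ?_) hε.le
      have := (lt_min_iff.1 htδ).2
      rw [lt_div_iff₀ (by positivity)] at this
      nlinarith [ht.1]
    have hwL : MemLp (prim fun θ => ζ t θ - ζ₀ θ) 2 torusMeasure :=
      memLp_prim ((h3.sub hζ₀).integrable (by simp))
    have hDe : (fun θ => timeDefect ζ₀ ζ V t θ) =ᵐ[torusMeasure]
        fun θ => prim (fun θ => ζ t θ - ζ₀ θ) θ - ∫ τ in (0 : ℝ)..t, V τ θ := by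
      filter_upwards [ae_torus_mem] with θ hθ
      rw [prim_sub (h3.integrable (by simp)) (hζ₀.integrable (by simp)) (Ico_subset_Icc_self hθ),
        timeDefect]
      ring
    have hDL : MemLp (timeDefect ζ₀ ζ V t) 2 torusMeasure := (hwL.sub hV.1).ae_eq hDe.symm
    have hDn : l2norm torusMeasure (timeDefect ζ₀ ζ V t) ≤ 2 * ε := by
      refine (l2norm_congr hDe).le.trans ((l2norm_sub_le hwL hV.1).trans ?_)
      linarith [h1 (lt_min_iff.1 htδ).1]
    rw [← h2]
    refine (abs_integral_mul_le hDL heL).trans ?_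
    nlinarith
  by_contra hne
  have hpos := abs_pos.2 hne
  have := hcε (|c| / (2 * (2 * L + 1))) (by positivity)
  rw [div_mul_eq_mul_div, le_div_iff₀ (by positivity)] at this
  nlinarith

/-- A distributional solution of `∂ζ/∂t = ∂V/∂θ` with initial value `ζ₀` satisfies
`prim ζ(t) = prim ζ₀ + ∫₀ᵗ V`. -/
theorem prim_eq_of_distributional (hT : 0 < T)
    (hζm : Measurable fun q : ℝ × ℝ => ζ q.1 q.2)
    (hζL : MemLp (fun q : ℝ × ℝ => ζ q.1 q.2) 2 (spaceTime T))
    (hζ0 : ∀ᵐ t ∂timeMeasure T, ∫ θ, ζ t θ ∂torusMeasure = 0)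
    (hVm : Measurable fun q : ℝ × ℝ => V q.1 q.2)
    (hVL : MemLp (fun q : ℝ × ℝ => V q.1 q.2) 2 (spaceTime T))
    (hV0 : ∀ᵐ t ∂timeMeasure T, ∫ θ, V t θ ∂torusMeasure = 0) (hζ₀ : MemLp ζ₀ 2 torusMeasure)
    (hdist : ∀ p : ℝ → ℝ → ℝ, IsTestFun T p →
      ∫ q, ζ q.1 q.2 * deriv (fun t => p t q.2) q.1 ∂spaceTime T =
        ∫ q, V q.1 q.2 * deriv (fun θ => p q.1 θ) q.2 ∂spaceTime T)
    (hinit : ∀ ε > 0, ∃ δ > 0, ∀ᵐ t ∂timeMeasure T, t < δ →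
      l2norm torusMeasure (prim fun θ => ζ t θ - ζ₀ θ) ≤ ε) :
    ∀ᵐ q ∂spaceTime T, prim (ζ q.1) q.2 = prim ζ₀ q.2 + ∫ τ in (0 : ℝ)..q.1, V τ q.2 := by
  have hDL := memLp_timeDefect hζm hζL hVm hVL hζ₀
  have hzero := fun {e : ℝ → ℝ} (he : ContDiff ℝ ∞ e) (hper : ∀ θ, e (θ + 1) = e θ) =>
    integral_timeDefect_mul_deriv_eq_zero hT hζm hζL hζ0 hVm hVL hζ₀ hdist hinit he hper
  have hlin : ∀ (n : ℤ) (θ : ℝ), HasDerivAt (fun θ => 2 * Real.pi * n * θ) (2 * Real.pi * n) θ :=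
    fun n θ => by simpa using (hasDerivAt_id θ).const_mul (2 * Real.pi * n)
  have hn2 : ∀ n : ℤ, n ≠ 0 → 2 * Real.pi * n ≠ 0 := fun n hn =>
    mul_ne_zero (by positivity) (Int.cast_ne_zero.2 hn)
  -- the constants are not derivatives of periodic functions: the average is treated separately
  have hmean : ∀ᵐ t ∂timeMeasure T, ∫ θ, timeDefect ζ₀ ζ V t θ ∂torusMeasure = 0 := by
    filter_upwards [memLp_slice_time hζL, ae_restrict_mem measurableSet_Icc] with t h1 ht
    have hR₀ := memLp_prim (hζ₀.integrable (by simp))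
    have hV := (l2norm_timeIntegral_le hVm hVL ht).1
    have i1 : Integrable (fun θ => prim ζ₀ θ + ∫ τ in (0 : ℝ)..t, V τ θ) torusMeasure :=
      (hR₀.add hV).integrable (by simp)
    simp only [timeDefect]
    rw [integral_sub ((memLp_prim (h1.integrable (by simp))).integrable (by simp)) i1,
      integral_add (hR₀.integrable (by simp)) (hV.integrable (by simp)),
      integral_prim (h1.integrable (by simp)), integral_prim (hζ₀.integrable (by simp)),
      integral_timeIntegral ht hVL, ← integral_time ht.1,
      integral_congr_ae (g := fun _ => 0)
        (ae_restrict_of_ae_restrict_of_subset (Icc_subset_Icc_right ht.2) hV0)]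
    simp
  have hdiv : ∀ {f g : ℝ → ℝ} {c : ℝ}, c ≠ 0 → ∫ θ, f θ * (g θ * c) ∂torusMeasure = 0 →
      ∫ θ, f θ * g θ ∂torusMeasure = 0 := by
    intro f g c hc h
    simp only [← mul_assoc] at h
    rw [integral_mul_const] at h
    exact (mul_eq_zero.1 h).resolve_right hc
  have hcos : ∀ᵐ t ∂timeMeasure T, ∀ n : ℤ,
      ∫ θ, timeDefect ζ₀ ζ V t θ * Real.cos (2 * Real.pi * n * θ) ∂torusMeasure = 0 := by
    rw [ae_all_iff]
    intro n
    rcases eq_or_ne n 0 with rfl | hn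
    · simpa using hmean
    have hd : deriv (fun θ => Real.sin (2 * Real.pi * n * θ)) =
        fun θ => Real.cos (2 * Real.pi * n * θ) * (2 * Real.pi * n) :=
      funext fun θ => (hlin n θ).sin.deriv
    have h := hzero (e := fun θ => Real.sin (2 * Real.pi * n * θ))
      (Real.contDiff_sin.comp (contDiff_const.mul contDiff_id)) (fun θ => by
        rw [show 2 * Real.pi * n * (θ + 1) = 2 * Real.pi * n * θ + n * (2 * Real.pi) by ring,
          Real.sin_add_int_mul_two_pi])
    rw [hd] at h
    filter_upwards [h] with t ht
    exact hdiv (hn2 n hn) ht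
  have hsin : ∀ᵐ t ∂timeMeasure T, ∀ n : ℤ,
      ∫ θ, timeDefect ζ₀ ζ V t θ * Real.sin (2 * Real.pi * n * θ) ∂torusMeasure = 0 := by
    rw [ae_all_iff]
    intro n
    rcases eq_or_ne n 0 with rfl | hn
    · simp
    have hd : deriv (fun θ => Real.cos (2 * Real.pi * n * θ)) =
        fun θ => Real.sin (2 * Real.pi * n * θ) * -(2 * Real.pi * n) :=
      funext fun θ => (hlin n θ).cos.deriv.trans (by ring)
    have h := hzero (e := fun θ => Real.cos (2 * Real.pi * n * θ))
      (Real.contDiff_cos.comp (contDiff_const.mul contDiff_id)) (fun θ => by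
        rw [show 2 * Real.pi * n * (θ + 1) = 2 * Real.pi * n * θ + n * (2 * Real.pi) by ring,
          Real.cos_add_int_mul_two_pi])
    rw [hd] at h
    filter_upwards [h] with t ht
    exact hdiv (neg_ne_zero.2 (hn2 n hn)) ht
  have hsq : ∫ q : ℝ × ℝ, timeDefect ζ₀ ζ V q.1 q.2 ^ 2 ∂spaceTime T = 0 := by
    rw [integral_spaceTime hDL.integrable_sq]
    refine integral_eq_zero_of_ae ?_
    filter_upwards [hcos, hsin, memLp_slice_time hDL] with t h1 h2 h3
    exact (l2norm_eq_zero_iff h3).2 (ae_eq_zero_of_integral_mul_cos_sin h3 h1 h2)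
  filter_upwards [(l2norm_eq_zero_iff hDL).1 hsq] with q hq
  exact sub_eq_zero.1 hq

end DistributionalDerivative

/-- A weak solution has a Borel version which is an exact solution in the integrated form of
`ApproxSol`. -/
theorem IsWeakSolution.exists_approxSol {φ : ℝ → ℝ} {s T : ℝ} (hT : 0 < T) {ζ₀ : ℝ → ℝ}
    (hζ₀ : MemLp ζ₀ 2 torusMeasure) {ζ : ℝ → ℝ → ℝ} (h : IsWeakSolution φ s T ζ₀ ζ) :
    ∃ z v : ℝ → ℝ → ℝ,
      ApproxSol (deriv φ) s T (prim ζ₀) z v (fun t θ => deriv φ (z t θ)) (fun _ => 0) ∧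
      ∀ᵐ t ∂timeMeasure T, ζ t =ᵐ[torusMeasure] z t := by
  obtain ⟨V, ⟨hVL, hV0, hdist⟩, hweak⟩ := h.weak_form
  set z : ℝ → ℝ → ℝ := fun t θ => h.measurable.mk _ (t, θ) with hz
  set v : ℝ → ℝ → ℝ := fun t θ => hVL.1.mk _ (t, θ) with hv
  have hzm : Measurable fun q : ℝ × ℝ => z q.1 q.2 := h.measurable.stronglyMeasurable_mk.measurable
  have hvm : Measurable fun q : ℝ × ℝ => v q.1 q.2 := hVL.1.stronglyMeasurable_mk.measurable
  have hzζ : ∀ᵐ q ∂spaceTime T, ζ q.1 q.2 = z q.1 q.2 := h.measurable.ae_eq_mk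
  have hvV : ∀ᵐ q ∂spaceTime T, V q.1 q.2 = v q.1 q.2 := hVL.1.ae_eq_mk
  have hzs : ∀ᵐ t ∂timeMeasure T, ζ t =ᵐ[torusMeasure] z t := ae_ae_of_ae_spaceTime hzζ
  have hvs : ∀ᵐ t ∂timeMeasure T, V t =ᵐ[torusMeasure] v t := ae_ae_of_ae_spaceTime hvV
  have hvL : MemLp (fun q : ℝ × ℝ => v q.1 q.2) 2 (spaceTime T) := hVL.ae_eq hvV
  have hζL : MemLp (fun q : ℝ × ℝ => ζ q.1 q.2) 2 (spaceTime T) := by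
    rw [memLp_two_iff_integrable_sq h.measurable]
    have hm : AEStronglyMeasurable (fun q : ℝ × ℝ => ζ q.1 q.2 ^ 2) (spaceTime T) :=
      h.measurable.pow 2
    obtain ⟨C, hC⟩ := h.bounded
    refine (integrable_prod_iff hm).2 ⟨?_, Integrable.of_bound hm.norm.integral_prod_right' C ?_⟩
    · filter_upwards [h.mean_zero] with t ht using ht.1.integrable_sq
    · filter_upwards [hC] with t ht
      simp only [norm_pow, Real.norm_eq_abs, sq_abs]
      rwa [abs_of_nonneg (integral_nonneg fun _ => sq_nonneg _)]
  have hzL : MemLp (fun q : ℝ × ℝ => z q.1 q.2) 2 (spaceTime T) := hζL.ae_eq hzζ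
  have hz0 : ∀ᵐ t ∂timeMeasure T, ∫ θ, z t θ ∂torusMeasure = 0 := by
    filter_upwards [h.mean_zero, hzs] with t h1 h2
    rw [← integral_congr_ae h2, h1.2]
  have hv0 : ∀ᵐ t ∂timeMeasure T, ∫ θ, v t θ ∂torusMeasure = 0 := by
    filter_upwards [hV0, hvs] with t h1 h2
    rw [← integral_congr_ae h2, h1.2]
  have hdist' : ∀ p : ℝ → ℝ → ℝ, IsTestFun T p →
      ∫ q, z q.1 q.2 * deriv (fun t => p t q.2) q.1 ∂spaceTime T =
        ∫ q, v q.1 q.2 * deriv (fun θ => p q.1 θ) q.2 ∂spaceTime T := by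
    intro p hp
    have e1 := integral_congr_ae (hzζ.mono fun q hq =>
      congrArg (fun x => x * deriv (fun t => p t q.2) q.1) hq)
    have e2 := integral_congr_ae (hvV.mono fun q hq =>
      congrArg (fun x => x * deriv (fun θ => p q.1 θ) q.2) hq)
    rw [← e1, ← e2]
    exact hdist p hp
  have hinit : ∀ ε > 0, ∃ δ > 0, ∀ᵐ t ∂timeMeasure T, t < δ →
      l2norm torusMeasure (prim fun θ => z t θ - ζ₀ θ) ≤ ε := by
    intro ε hε
    obtain ⟨δ, hδ, h1⟩ := h.initial ε hε
    refine ⟨δ, hδ, ?_⟩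
    filter_upwards [h1, hzs] with t h2 h3 ht
    refine le_of_eq_of_le (l2norm_congr ?_) (h2 ht)
    filter_upwards [ae_torus_mem] with θ hθ
    refine prim_congr ?_ (Ico_subset_Icc_self hθ)
    filter_upwards [h3] with x hx
    rw [hx]
  refine ⟨z, v, ?_, hzs⟩
  exact
    { measurable_ζ := hzm
      measurable_V := hvm
      memLp_ζ := hzL
      memLp_V := hvL
      memLp_F := h.memLp_flux.ae_eq (hzζ.mono fun q hq => congrArg (deriv φ) hq)
      memLp_e := memLp_const 0
      memLp_R₀ := memLp_prim (hζ₀.integrable (by simp))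
      mean_ζ := hz0
      mean_V := hv0
      prim_eq := prim_eq_of_distributional hT hzm hzL hz0 hvm hvL hv0 hζ₀ hdist' hinit
      weak := by
        filter_upwards [hweak, hzs, hvs] with t h1 h2 h3 g hg
        have e := h1 g hg
        have e1 : ∫ θ, prim g θ * V t θ ∂torusMeasure = ∫ θ, prim g θ * v t θ ∂torusMeasure :=
          integral_congr_ae (h3.mono fun θ hθ => congrArg (fun x => prim g θ * x) hθ)
        have e2 : ∫ θ, g θ * deriv φ (ζ t θ) ∂torusMeasure =
            ∫ θ, g θ * deriv φ (z t θ) ∂torusMeasure :=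
          integral_congr_ae (h2.mono fun θ hθ => congrArg (fun x => g θ * deriv φ x) hθ)
        have e3 : ∫ θ, prim g θ * deriv φ (ζ t θ) ∂torusMeasure =
            ∫ θ, prim g θ * deriv φ (z t θ) ∂torusMeasure :=
          integral_congr_ae (h2.mono fun θ hθ => congrArg (fun x => prim g θ * deriv φ x) hθ)
        rw [e1, e2, e3] at e
        rw [e, zero_mul, abs_nonpos_iff]
        ring
      flux := ae_of_all _ fun t => by simp [l2norm] }

/-! ### Uniqueness -/

/-- Weak solutions with the same initial value coincide. -/
theorem IsWeakSolution.ae_eq_of_approxSol {φ : ℝ → ℝ} {lam Λ s T : ℝ} (hT : 0 < T) (hlam : 0 < lam)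
    (hΛ : 0 < Λ) (hs : |s| = 1)
    (hmono : ∀ x y, lam * (x - y) ^ 2 ≤ (deriv φ x - deriv φ y) * (x - y))
    (hLip : ∀ x y, |deriv φ x - deriv φ y| ≤ Λ * |x - y|) {ζ₀ : ℝ → ℝ}
    (hζ₀ : MemLp ζ₀ 2 torusMeasure) {ζ z v : ℝ → ℝ → ℝ} (h : IsWeakSolution φ s T ζ₀ ζ)
    (hz : ApproxSol (deriv φ) s T (prim ζ₀) z v (fun t θ => deriv φ (z t θ)) fun _ => 0) :
    ∀ᵐ t ∂timeMeasure T, ζ t =ᵐ[torusMeasure] z t := by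
  obtain ⟨z', v', h', hζz'⟩ := h.exists_approxSol hT hζ₀
  have h1 := (h'.stability hT hlam hΛ hs hmono hLip hz rfl rfl).2
  simp only [sub_self, add_zero, l2norm, ne_eq, OfNat.ofNat_ne_zero, not_false_eq_true, zero_pow,
    integral_zero, Real.sqrt_zero, mul_zero, zero_mul] at h1
  have hI0 : 0 ≤ ∫ q : ℝ × ℝ, (z' q.1 q.2 - z q.1 q.2) ^ 2 ∂spaceTime T :=
    integral_nonneg fun _ => sq_nonneg _
  have hI : ∫ q : ℝ × ℝ, (z' q.1 q.2 - z q.1 q.2) ^ 2 ∂spaceTime T = 0 :=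
    le_antisymm (nonpos_of_mul_nonpos_right h1 hlam) hI0
  have h2 := ae_ae_of_ae_spaceTime ((l2norm_eq_zero_iff (h'.memLp_ζ.sub hz.memLp_ζ)).1 hI)
  filter_upwards [hζz', h2] with t h3 h4
  filter_upwards [h3, h4] with θ h5 h6
  rw [h5]
  exact sub_eq_zero.1 h6

end WeakKawasaki

end

theorem mainTheorem6
    (δψ : ℝ → ℝ) (hδ : ContDiff ℝ 2 δψ)
    (hδb : ∃ C : ℝ, ∀ x, |δψ x| ≤ C ∧ |deriv δψ x| ≤ C ∧ |iteratedDeriv 2 δψ x| ≤ C)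
    (s : ℝ) (hs : s = 1 ∨ s = -1) (T : ℝ) (hT : 0 < T)
    (M K : ℕ → ℕ) (hM : ∀ l, 0 < M l) (hK : ∀ l, 0 < K l)
    (hMlim : Tendsto M atTop atTop) (hKlim : Tendsto K atTop atTop)
    (ζ₀ : ℝ → ℝ) (hζ₀ : MemLp ζ₀ 2 WeakKawasaki.torusMeasure)
    (η : (l : ℕ) → ℝ → WeakKawasaki.meanZero (M l))
    (hη₀ : Tendsto
      (fun l => eLpNorm (fun θ => WeakKawasaki.stepFun (η l 0).1 θ - ζ₀ θ) 2
        WeakKawasaki.torusMeasure) atTop (𝓝 0))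
    (hη : ∀ l, ∀ t ∈ Icc (0 : ℝ) T,
      HasDerivWithinAt (η l)
        (-((WeakKawasaki.macroA (M l) (K l) + WeakKawasaki.macroJ s (M l) (K l))
          (WeakKawasaki.gradY
            (WeakKawasaki.macroH (WeakKawasaki.potential δψ) (M l) (K l)) (η l t))))
        (Icc 0 T) t) :
    ∃ ζ : ℝ → ℝ → ℝ,
      WeakKawasaki.IsWeakSolution
        (WeakKawasaki.cramer (WeakKawasaki.potential δψ)) s T ζ₀ ζ ∧
      (∀ ζ' : ℝ → ℝ → ℝ,
        WeakKawasaki.IsWeakSolution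
          (WeakKawasaki.cramer (WeakKawasaki.potential δψ)) s T ζ₀ ζ' →
        ∀ᵐ t ∂volume.restrict (Icc 0 T), ζ' t =ᵐ[WeakKawasaki.torusMeasure] ζ t) ∧
      Tendsto
        (fun l => eLpNorm
          (fun t => WeakKawasaki.hMinusNorm
            (fun θ => WeakKawasaki.stepFun (η l t).1 θ - ζ t θ))
          ∞ (volume.restrict (Icc 0 T))) atTop (𝓝 0) := by
  have hs1 : |s| = 1 := by rcases hs with rfl | rfl <;> simp
  obtain ⟨B, hB⟩ := hδb
  obtain ⟨lam, Λ, D, hlam, hΛ, hmono, hLip, hD⟩ := WeakKawasaki.exists_cramer_bounds hδ hB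
  set φ := WeakKawasaki.cramer (WeakKawasaki.potential δψ)
  have hstep : ∀ l t, WeakKawasaki.MemL20 (WeakKawasaki.stepFun (η l t).1) := fun l t =>
    WeakKawasaki.memL20_stepFun _
  -- the initial data converge, hence are bounded, in `L²`
  have hinit : Tendsto (fun l => WeakKawasaki.l2norm WeakKawasaki.torusMeasure
      fun θ => WeakKawasaki.stepFun (η l 0).1 θ - ζ₀ θ) atTop (𝓝 0) := by
    have h1 := (ENNReal.tendsto_toReal ENNReal.zero_ne_top).comp hη₀
    refine h1.congr fun l => ?_
    have h2 := WeakKawasaki.eLpNorm_eq_ofReal_l2norm ((hstep l 0).1.sub hζ₀)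
    exact (congrArg ENNReal.toReal h2).trans (ENNReal.toReal_ofReal WeakKawasaki.l2norm_nonneg)
  obtain ⟨R, hR⟩ : ∃ R, ∀ l, WeakKawasaki.l2norm WeakKawasaki.torusMeasure
      (WeakKawasaki.stepFun (η l 0).1) ≤ R := by
    obtain ⟨b, hb⟩ := hinit.bddAbove_range
    refine ⟨b + WeakKawasaki.l2norm WeakKawasaki.torusMeasure ζ₀, fun l => ?_⟩
    have h1 := WeakKawasaki.l2norm_add_le ((hstep l 0).1.sub hζ₀) hζ₀
    simp only [Pi.sub_apply, sub_add_cancel] at h1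
    exact h1.trans (add_le_add_left (hb ⟨l, rfl⟩) _)
  have hinit' : Tendsto (fun l => WeakKawasaki.l2norm WeakKawasaki.torusMeasure
      fun θ => WeakKawasaki.prim (WeakKawasaki.stepFun (η l 0).1) θ - WeakKawasaki.prim ζ₀ θ)
      atTop (𝓝 0) := by
    refine squeeze_zero (fun l => WeakKawasaki.l2norm_nonneg) (fun l => ?_)
      (by simpa using hinit.const_mul 2)
    refine le_of_eq_of_le (WeakKawasaki.l2norm_congr ?_)
      (WeakKawasaki.l2norm_prim_le ((hstep l 0).1.sub hζ₀))
    filter_upwards [WeakKawasaki.ae_torus_mem] with θ hθ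
    exact (WeakKawasaki.prim_sub (hstep l 0).integrable (hζ₀.integrable (by simp))
      (Ico_subset_Icc_self hθ)).symm
  obtain ⟨C, hC0, hC⟩ := WeakKawasaki.exists_approxSol_macro hδ hB hs1 hT (deriv φ) D R hD
  choose ζ V F e happ hζ hζC hV he using fun l =>
    hC (M l) (K l) (hM l) (hK l) (η l) (hR l) (hη l)
  have he0 : Tendsto (fun l => ∫ t, e l t ^ 2 ∂WeakKawasaki.timeMeasure T) atTop (𝓝 0) := by
    refine squeeze_zero (fun l => integral_nonneg fun _ => sq_nonneg _) he ?_
    have h1 := (tendsto_inv_atTop_zero (𝕜 := ℝ)).comp (tendsto_natCast_atTop_atTop.comp hMlim)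
    have h2 := (tendsto_inv_atTop_zero (𝕜 := ℝ)).comp (tendsto_natCast_atTop_atTop.comp hKlim)
    simpa using (h1.add h2).const_mul C
  obtain ⟨z, v, hz, hzC, a, ha, haz⟩ := WeakKawasaki.exists_limit_approxSol hT hlam hΛ hs1 hmono
    hLip happ (WeakKawasaki.memLp_prim (hζ₀.integrable (by simp))) hinit' he0
    (fun l => (ae_restrict_mem measurableSet_Icc).mono (hζC l)) hV
  refine ⟨z, hz.isWeakSolution hT hζ₀ hzC, fun ζ' hζ' =>
    hζ'.ae_eq_of_approxSol hT hlam hΛ hs1 hmono hLip hζ₀ hz, ?_⟩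
  refine tendsto_of_tendsto_of_tendsto_of_le_of_le tendsto_const_nhds
    (by simpa using ENNReal.tendsto_ofReal ha) (fun l => zero_le) fun l => ?_
  rw [eLpNorm_exponent_top]
  refine eLpNormEssSup_le_of_ae_bound ?_
  filter_upwards [haz l, ae_restrict_mem measurableSet_Icc] with t h1 ht
  rw [WeakKawasaki.hMinusNorm_eq, Real.norm_of_nonneg WeakKawasaki.l2norm_nonneg]
  rwa [hζ l t ht] at h1
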